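/- Let $p\ge 2$ be an integer and let $\sigma,\varrho,c_0,c_1$ be real constants with $c_0>0$. Then there is a constant $C>0$, depending only on $p,\sigma,\varrho,c_0,c_1$ (in particular, not on the mesh sizes or on the number of levels), such that the following holds. **Meshes.** Let $\Omega\subset\mathbb R^2$ be a polygonal domain and let $\mathcal T_0,\dots,\mathcal T_L$ be conforming triangulations of $\Omega$ into closed triangles that are nested (every $T\in\mathcal T_{l+1}$ lies in some $T'\in\mathcal T_l$). For a triangle $T$ put $h_T=\operatorname{diam}T$, and put $h_l=\max_{T\in\mathcal T_l}h_T$. Suppose that, on every level $l$ and for every $T\in\mathcal T_l$, the triangle $T$ contains a disc of diameter $d>0$ with $h_T\le\sigma d$ (shape regularity), and $h_l\le\varrho\,h_T$ (quasi-uniformity). Let $\mathcal E_l$ be the set of edges of $\mathcal T_l$. Let the stabilization parameter $\tau_l$ be constant on each $T\in\mathcal T_l$ with $c_0\le\tau_l h_l\le c_1$. **Spaces.** $\mathcal P_p$ denotes the polynomials of total degree at most $p$. $M_l$ is the space of functions $\mu$ on the edges of $\mathcal T_l$ with $\mu|_e\in\mathcal P_p(e)$ for every $e\in\mathcal E_l$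 (no continuity at the vertices), and $M_l^0=\{\mu\in M_l:\mu=0\text{ on }\partial\Omega\}$. $W_l^c$ is the space of continuous functions on $\overline\Omega$ whose restriction to every $T\in\mathcal T_l$ lies in $\mathcal P_p(T)$. **Local solver and energy form (HDG method for the Poisson problem).** For $T\in\mathcal T_l$ with outward unit normal $n$ and $m\in M_l$, let $(Q_m,U_m)\in\mathcal P_p(T)^2\times\mathcal P_p(T)$ be the solution of $$(Q_m,v)_T-(U_m,\operatorname{div}v)_T=-\langle m,v\cdot n\rangle_{\partial T},\qquad -(Q_m,\nabla w)_T+\langle Q_m\cdot n+\tau_l(U_m-m),w\rangle_{\partial T}=0$$ for all $v\in\mathcal P_p(T)^2$ and $w\in\mathcal P_p(T)$, and set $$\hat a_l(\lambda,\mu)=\sum_{T\in\mathcal T_l}\Big[(Q_\lambda,Q_\mu)_T+\langle\tau_l(U_\lambda-\lambda),U_\mu-\mu\rangle_{\partial T}\Big].$$ **Intergrid transfer operator.** For $\mu\in M_l$ let $I_l^W\mu\in W_l^c$ be the function with the following values at the Lagrange nodes of order $p$ (the points of the triangles whose barycentric coordinates are integer multiples of $1/p$): at a vertex $z$ of $\mathcal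 T_l$, the mean of $\mu|_e(z)$ over all edges $e\in\mathcal E_l$ containing $z$; at a node $z$ in the relative interior of an edge, the value $\mu(z)$; and at a node $z$ in the interior of a triangle $T$ (which exists only for $p\ge3$), the value at $z$ of the local solution $U_\mu$ on $T$. For $l<L$ define $I_l\mu\in M_L$ to be the restriction of $I_l^W\mu$ to the edges of $\mathcal T_L$, and let $I_L$ be the identity. **Claim.** For all $0\le l\le L$ and all $\mu\in M_l^0$, $$\hat a_L(I_l\mu,I_l\mu)\le C\,\hat a_l(\mu,\mu).$$ -/

import Mathlib

open MeasureTheory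

namespace HDG

/-- The Euclidean plane. -/
abbrev Plane := EuclideanSpace ℝ (Fin 2)

/-- The closed segment or triangle spanned by a finite set of vertices. -/
abbrev hull (s : Finset Plane) : Set Plane := convexHull ℝ (s : Set Plane)

/-! ### Polynomials in two variables -/

/-- Real polynomials in the two coordinates of the plane. -/
abbrev Poly := MvPolynomial (Fin 2) ℝ

/-- The value of a polynomial at a point of the plane. -/
noncomputable def Poly.val (P : Poly) (x : Plane) : ℝ := MvPolynomial.eval (fun i => x i) P

/-- The space of polynomials of total degree at most `p`. -/
noncomputable abbrev PolyDeg (p : ℕ) : Submodule ℝ Poly := MvPolynomial.restrictTotalDegree (Fin 2) ℝ p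

/-- The divergence of a polynomial vector field. -/
noncomputable def divergence (r : Fin 2 → Poly) : Poly := ∑ i, MvPolynomial.pderiv i (r i)

/-- The gradient of a polynomial. -/
noncomputable def gradient (w : Poly) : Fin 2 → Poly := fun i => MvPolynomial.pderiv i w

/-- The dot product of two polynomial vector fields. -/
noncomputable def dot (q r : Fin 2 → Poly) : Poly := ∑ i, q i * r i

/-- The normal component `q · n` of a polynomial vector field at `x`. -/
noncomputable def normalComponent (q : Fin 2 → Poly) (n x : Plane) : ℝ := ∑ i, (q i).val x * n i

/-! ### Triangulations -/

/-- A conforming triangulation of `Ω` (into closed triangles): a finite simplicial complex in the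
plane, all of whose simplices are faces of triangles, whose triangles cover the closure of `Ω`.
Two simplices of a simplicial complex meet in the simplex spanned by their common vertices
(or not at all), so that there are no hanging nodes. -/
structure Triangulation (Ω : Set Plane) where
  complex : Geometry.SimplicialComplex ℝ Plane
  finite_faces : complex.faces.Finite
  pure : ∀ s ∈ complex.faces, ∃ t ∈ complex.faces, s ⊆ t ∧ t.card = 3
  space_eq : complex.space = closure Ω

namespace Triangulation

variable {Ω : Set Plane}

/-- The triangles, each given by its three vertices. -/
noncomputable def triangles (𝒯 : Triangulation Ω) : Finset (Finset Plane) :=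
  𝒯.finite_faces.toFinset.filter (fun s => s.card = 3)

/-- The edges, each given by its two end points. -/
noncomputable def edges (𝒯 : Triangulation Ω) : Finset (Finset Plane) :=
  𝒯.finite_faces.toFinset.filter (fun s => s.card = 2)

open Classical in
/-- The edges that contain the vertex `z`. -/
noncomputable def edgesAt (𝒯 : Triangulation Ω) (z : Plane) : Finset (Finset Plane) :=
  𝒯.edges.filter (fun e => z ∈ e)

/-- The mesh size `h`: the largest diameter of a triangle. -/
noncomputable def meshSize (𝒯 : Triangulation Ω) : ℝ :=
  sSup ((fun t => Metric.diam (hull t)) '' (𝒯.triangles : Set (Finset Plane)))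

/-- Shape regularity with constant `σ`: every triangle `T` contains a disc of diameter `2 r` such
that `h_T ≤ σ * (2 * r)`. -/
def ShapeRegular (𝒯 : Triangulation Ω) (σ : ℝ) : Prop :=
  ∀ t ∈ 𝒯.triangles, ∃ x : Plane, ∃ r : ℝ, 0 < r ∧ Metric.closedBall x r ⊆ hull t ∧
    Metric.diam (hull t) ≤ σ * (2 * r)

/-- Quasi-uniformity with constant `ρ`: `h ≤ ρ * h_T` for every triangle `T`. -/
def QuasiUniform (𝒯 : Triangulation Ω) (ρ : ℝ) : Prop :=
  ∀ t ∈ 𝒯.triangles, 𝒯.meshSize ≤ ρ * Metric.diam (hull t)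

/-- `𝒯'` is a refinement of `𝒯`: every triangle of `𝒯'` lies in a triangle of `𝒯`. -/
def Refines (𝒯' 𝒯 : Triangulation Ω) : Prop :=
  ∀ t' ∈ 𝒯'.triangles, ∃ t ∈ 𝒯.triangles, hull t' ⊆ hull t

end Triangulation

/-! ### Integrals over triangles and over their boundaries -/

open Classical in
/-- The edge of the triangle `t` opposite to its vertex `a`. -/
noncomputable def oppositeEdge (t : Finset Plane) (a : Plane) : Finset Plane := t.erase a

/-- The outward unit normal of the triangle `t` on the edge opposite to its vertex `a`: the
direction, orthogonal to this edge, that leads from `a` to the edge. -/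
noncomputable def outerNormal (t : Finset Plane) (a : Plane) : Plane :=
  let w : Plane := (vectorSpan ℝ (oppositeEdge t a : Set Plane))ᗮ.starProjection
    ((oppositeEdge t a).centroid ℝ id - a)
  ‖w‖⁻¹ • w

/-- The integral over the triangle `t` with respect to area. -/
noncomputable def triangleIntegral (t : Finset Plane) (f : Plane → ℝ) : ℝ :=
  ∫ x in hull t, f x

/-- The integral over the boundary of the triangle `t` with respect to arc length, where `F a` is
the integrand on the edge opposite to the vertex `a`. -/
noncomputable def boundaryIntegral (t : Finset Plane) (F : Plane → Plane → ℝ) : ℝ :=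
  ∑ a ∈ t, ∫ x in hull (oppositeEdge t a), F a x ∂(Measure.hausdorffMeasure 1)

/-! ### Functions on the skeleton -/

/-- A function on the union of the edges, possibly with several values at a vertex: `μ e x` is the
value at `x` on the edge `e`. Only its values for `e` an edge and `x ∈ e` matter. -/
abbrev SkeletonFun := Finset Plane → Plane → ℝ

variable {Ω : Set Plane}

/-- The space of Lagrange multipliers: on each edge a polynomial of degree at most `p`. -/
def multiplierSpace (𝒯 : Triangulation Ω) (p : ℕ) : Set SkeletonFun :=
  {μ | ∀ e ∈ 𝒯.edges, ∃ P ∈ PolyDeg p, ∀ x ∈ hull e, μ e x = P.val x}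

/-- The Lagrange multipliers that vanish on the edges that lie on the boundary of `Ω`. -/
def multiplierSpaceZero (𝒯 : Triangulation Ω) (p : ℕ) : Set SkeletonFun :=
  {μ ∈ multiplierSpace 𝒯 p | ∀ e ∈ 𝒯.edges, hull e ⊆ frontier Ω → ∀ x ∈ hull e, μ e x = 0}

/-! ### The local solver and the energy form -/

/-- `(Q, U)` solves the local HDG problem on the triangle `t` with boundary data `m` and
stabilization parameter `τ`:
`(Q, r) - (U, div r) = - ⟨m, r · n⟩` for all vector fields `r` of degree at most `p`, and
`- (Q, ∇ w) + ⟨Q · n + τ (U - m), w⟩ = 0` for all polynomials `w` of degree at most `p`. -/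
def IsLocalSolution (p : ℕ) (τ : ℝ) (t : Finset Plane) (m : SkeletonFun)
    (Q : Fin 2 → Poly) (U : Poly) : Prop :=
  (∀ i, Q i ∈ PolyDeg p) ∧ U ∈ PolyDeg p ∧
  (∀ r : Fin 2 → Poly, (∀ i, r i ∈ PolyDeg p) →
    triangleIntegral t (fun x => (dot Q r).val x)
      - triangleIntegral t (fun x => U.val x * (divergence r).val x)
      = - boundaryIntegral t
          (fun a x => m (oppositeEdge t a) x * normalComponent r (outerNormal t a) x)) ∧
  (∀ w ∈ PolyDeg p,
    - triangleIntegral t (fun x => (dot Q (gradient w)).val x)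
      + boundaryIntegral t
          (fun a x => (normalComponent Q (outerNormal t a) x
            + τ * (U.val x - m (oppositeEdge t a) x)) * w.val x) = 0)

/-- The solution `(Q_m, U_m)` of the local HDG problem (it is unique if `τ > 0`). -/
noncomputable def localSolution (p : ℕ) (τ : ℝ) (t : Finset Plane) (m : SkeletonFun) :
    (Fin 2 → Poly) × Poly :=
  Classical.epsilon fun s => IsLocalSolution p τ t m s.1 s.2

/-- The flux `Q_m` of the local HDG problem. -/
noncomputable def localQ (p : ℕ) (τ : ℝ) (t : Finset Plane) (m : SkeletonFun) : Fin 2 → Poly :=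
  (localSolution p τ t m).1

/-- The scalar `U_m` of the local HDG problem. -/
noncomputable def localU (p : ℕ) (τ : ℝ) (t : Finset Plane) (m : SkeletonFun) : Poly :=
  (localSolution p τ t m).2

/-- The bilinear form of the hybridized HDG method for the Poisson problem, where `τ t` is the value
of the stabilization parameter on the triangle `t`:
`∑_T (Q_λ, Q_μ)_T + τ_T ⟨U_λ - λ, U_μ - μ⟩_{∂T}`. -/
noncomputable def energyForm (𝒯 : Triangulation Ω) (p : ℕ) (τ : Finset Plane → ℝ)
    (lam μ : SkeletonFun) : ℝ :=
  ∑ t ∈ 𝒯.triangles,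
    (triangleIntegral t (fun x => (dot (localQ p (τ t) t lam) (localQ p (τ t) t μ)).val x)
      + τ t * boundaryIntegral t (fun a x =>
          ((localU p (τ t) t lam).val x - lam (oppositeEdge t a) x)
            * ((localU p (τ t) t μ).val x - μ (oppositeEdge t a) x)))

/-! ### The intergrid transfer operator -/

/-- The continuous functions on the closure of `Ω` that are polynomials of degree at most `p` on
each triangle. -/
def continuousSpace (𝒯 : Triangulation Ω) (p : ℕ) : Set (Plane → ℝ) :=
  {v | ContinuousOn v (closure Ω) ∧
    ∀ t ∈ 𝒯.triangles, ∃ P ∈ PolyDeg p, ∀ x ∈ hull t, v x = P.val x}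

/-- The Lagrange nodes of order `p` of a simplex: the points whose barycentric coordinates are
integer multiples of `1 / p`. -/
def lagrangeNodes (p : ℕ) (s : Finset Plane) : Set Plane :=
  {z | ∃ α : Plane → ℕ, ∑ v ∈ s, α v = p ∧ z = ∑ v ∈ s, ((α v : ℝ) / p) • v}

/-- `v` is the continuous piecewise polynomial function assigned to the multiplier `μ`: its nodal
values are
* at a vertex `z`, the mean of the values of `μ` at `z` on the edges that contain `z`;
* at a node inside an edge, the value of `μ` on this edge;
* at a node inside a triangle `T` (if `p ≥ 3`), the value of the local solution `U_μ` on `T`. -/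
def IsAveraging (𝒯 : Triangulation Ω) (p : ℕ) (τ : Finset Plane → ℝ) (μ : SkeletonFun)
    (v : Plane → ℝ) : Prop :=
  v ∈ continuousSpace 𝒯 p ∧
  (∀ z ∈ 𝒯.complex.vertices, v z = (∑ e ∈ 𝒯.edgesAt z, μ e z) / (𝒯.edgesAt z).card) ∧
  (∀ e ∈ 𝒯.edges, ∀ z ∈ lagrangeNodes p e, z ∉ 𝒯.complex.vertices → v z = μ e z) ∧
  (∀ t ∈ 𝒯.triangles, ∀ z ∈ lagrangeNodes p t, z ∈ interior (hull t) →
    v z = (localU p (τ t) t μ).val z)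

/-- The operator `I_l^W` into the continuous piecewise polynomials (on the closure of `Ω`, its value
is uniquely determined by `IsAveraging` if `p ≥ 1`). -/
noncomputable def averaging (𝒯 : Triangulation Ω) (p : ℕ) (τ : Finset Plane → ℝ)
    (μ : SkeletonFun) : Plane → ℝ :=
  Classical.epsilon fun v => IsAveraging 𝒯 p τ μ v

/-- The intergrid transfer operator `I_l` from the multipliers of level `l` to those of level `L`:
the restriction of `I_l^W μ` to the edges of level `L` if `l ≠ L`, and the identity if `l = L`. -/
noncomputable def transfer (𝒯 : ℕ → Triangulation Ω) (p : ℕ) (τ : ℕ → Finset Plane → ℝ)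
    (L l : ℕ) (μ : SkeletonFun) : SkeletonFun :=
  if l = L then μ else fun _ x => averaging (𝒯 l) p (τ l) μ x

end HDG

/-!
The energy of the transferred multiplier is bounded by a Dirichlet integral, and this Dirichlet
integral by the energy of the given multiplier.

On the fine level, the transferred multiplier is on each triangle the trace of a polynomial `v` of
degree at most `p`. Testing the local equations with `(Q, U - v)` shows that the local energy is
`-(Q, ∇ v)`, and hence at most the integral of `|∇ v|²` (`IsLocalSolution.energy_le`). The fine
triangles inside a coarse triangle overlap in null sets only, so that the energy on the fine level
is at most the Dirichlet integral of the average `v` over the coarse triangles (`energyForm_le`).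
In particular, the number of levels does not matter.

On the coarse level, `∇ v` is compared with `∇ U` on each triangle. Integration by parts in the flux
equation and the trace inequality bound `∇ U` by the local energy (`exists_gradient_le_energy`); this
uses the lower bound `c₀` on `τ h`. By the inverse inequality, the gradient of `v - U` is bounded by
the values of `v - U` at the Lagrange nodes (`exists_gradient_bound`, `abs_val_le_of_nodes`). These
values vanish inside the triangle, are jumps `μ - U` inside the edges, and are differences of a mean
of values of `μ` and the value of `U` at the vertices; the jumps at single points are bounded by the
energy, again by an inverse inequality (`exists_jump_le_energy`).

At a vertex, the values of `U` on triangles with a common edge differ by two jumps, so that the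
values on two triangles can be compared if they are joined by a chain of such triangles. The number
of triangles at a vertex is bounded by shape regularity and quasi-uniformity (`card_star_le`). If
`Ω` touches itself at the vertex, then the star of the vertex may fall apart into several chains.
In this case each of them ends with an edge that belongs to one triangle only
(`neighbors_chain`: otherwise the cones over the triangles of the chain form a set that is open and
closed in the punctured plane), this edge lies on the boundary of `Ω` (`hull_subset_frontier`), and
there `μ` vanishes. So each value of `U` is bounded by the jumps, and so is the difference from the
mean (`abs_sub_vertex_mean_le`).

As the local solution and the average are defined by choice, their existence has to be shown: the
local problem is a square linear system with trivial kernel (`exists_isLocalSolution`), and the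
Lagrange interpolants of the nodal values agree on common faces (`exists_isAveraging`).
-/

namespace HDG

/-! ### Barycentric coordinates -/

/-- The set `t` consists of the three vertices of a nondegenerate triangle. -/
structure IsTriangle (t : Finset Plane) : Prop where
  card_eq : t.card = 3
  indep : AffineIndependent ℝ ((↑) : t → Plane)

/-- The vertices of a triangle as an affine basis of the plane. -/
noncomputable def IsTriangle.basis {t : Finset Plane} (ht : IsTriangle t) :
    AffineBasis t ℝ Plane where
  toFun := (↑)
  ind' := ht.indep
  tot' := by
    rw [ht.indep.affineSpan_eq_top_iff_card_eq_finrank_add_one]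
    simp [ht.card_eq]

open Classical in
/-- The barycentric coordinate of the triangle `t` that belongs to its vertex `v`, as an affine
function on the plane (zero unless `t` is a triangle with vertex `v`). -/
noncomputable def bary (t : Finset Plane) (v : Plane) : Plane →ᵃ[ℝ] ℝ :=
  if h : IsTriangle t ∧ v ∈ t then h.1.basis.coord ⟨v, h.2⟩ else 0

theorem bary_sum (t : Finset Plane) (v : Plane) (s : Finset Plane) (w : Plane → ℝ)
    (hw : ∑ y ∈ s, w y = 1) : bary t v (∑ y ∈ s, w y • y) = ∑ y ∈ s, w y * bary t v y := by
  have := s.map_affineCombination id w hw (bary t v)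
  rw [s.affineCombination_eq_linear_combination _ _ hw,
    s.affineCombination_eq_linear_combination _ _ hw] at this
  simpa using this

section bary

variable {t : Finset Plane} (ht : IsTriangle t)
include ht

theorem bary_eq_coord (v : t) : bary t v = ht.basis.coord v := by
  simp [bary, ht]

theorem bary_self {v : Plane} (hv : v ∈ t) : bary t v v = 1 := by
  rw [bary_eq_coord ht ⟨v, hv⟩]; exact ht.basis.coord_apply_eq _

theorem bary_of_ne {v w : Plane} (hv : v ∈ t) (hw : w ∈ t) (h : v ≠ w) : bary t v w = 0 := by
  rw [bary_eq_coord ht ⟨v, hv⟩]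
  exact ht.basis.coord_apply_ne (j := ⟨w, hw⟩) (by simpa using h)

theorem sum_bary (x : Plane) : ∑ v ∈ t, bary t v x = 1 := by
  rw [← Finset.sum_coe_sort, ← ht.basis.sum_coord_apply_eq_one x]
  exact Finset.sum_congr rfl fun v _ => by rw [bary_eq_coord ht]

theorem sum_bary_smul (x : Plane) : ∑ v ∈ t, bary t v x • v = x := by
  rw [← Finset.sum_coe_sort]
  conv_rhs => rw [← ht.basis.linear_combination_coord_eq_self x]
  exact Finset.sum_congr rfl fun v _ => by rw [bary_eq_coord ht]; rfl

theorem eq_of_bary_eq {x y : Plane} (h : ∀ v ∈ t, bary t v x = bary t v y) : x = y := by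
  rw [← sum_bary_smul ht x, ← sum_bary_smul ht y]
  exact Finset.sum_congr rfl fun v hv => by rw [h v hv]

theorem range_basis : Set.range ht.basis = (t : Set Plane) := by
  ext x
  constructor
  · rintro ⟨v, rfl⟩
    exact v.2
  · intro hx
    exact ⟨⟨x, hx⟩, rfl⟩

theorem mem_hull_iff {x : Plane} : x ∈ hull t ↔ ∀ v ∈ t, 0 ≤ bary t v x := by
  rw [hull, ← range_basis ht, ht.basis.convexHull_eq_nonneg_coord]
  constructor
  · intro h v hv
    rw [bary_eq_coord ht ⟨v, hv⟩]; exact h _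
  · intro h v
    rw [← bary_eq_coord ht]; exact h _ v.2

theorem mem_interior_hull_iff {x : Plane} : x ∈ interior (hull t) ↔ ∀ v ∈ t, 0 < bary t v x := by
  rw [hull, ← range_basis ht, ht.basis.interior_convexHull]
  constructor
  · intro h v hv
    rw [bary_eq_coord ht ⟨v, hv⟩]; exact h _
  · intro h v
    rw [← bary_eq_coord ht]; exact h _ v.2

theorem bary_eq_zero_of_mem_hull {s : Finset Plane} (hs : s ⊆ t) {x : Plane} (hx : x ∈ hull s)
    {v : Plane} (hv : v ∈ t) (hvs : v ∉ s) : bary t v x = 0 := by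
  obtain ⟨w, _, hw1, hw⟩ := Finset.mem_convexHull'.1 hx
  rw [← hw, bary_sum t v s w hw1]
  exact Finset.sum_eq_zero fun y hy => by
    rw [bary_of_ne ht hv (hs hy) (fun e => hvs (e ▸ hy)), mul_zero]

end bary

theorem continuous_bary (t : Finset Plane) (v : Plane) : Continuous (bary t v) :=
  (bary t v).continuous_of_finiteDimensional

theorem bary_lineMap (t : Finset Plane) (v x y : Plane) (s : ℝ) :
    bary t v (AffineMap.lineMap x y s) = (1 - s) * bary t v x + s * bary t v y := by
  rw [AffineMap.apply_lineMap, AffineMap.lineMap_apply_ring]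

theorem IsTriangle.exists_eq {t : Finset Plane} (ht : IsTriangle t) {a : Plane} (ha : a ∈ t) :
    ∃ b c, a ≠ b ∧ a ≠ c ∧ b ≠ c ∧ t = {a, b, c} := by
  classical
  have h := Finset.card_erase_of_mem ha
  rw [ht.card_eq] at h
  obtain ⟨b, c, hbc, h⟩ := Finset.card_eq_two.1 h
  have hb : b ∈ t.erase a := by rw [h]; simp
  have hc : c ∈ t.erase a := by rw [h]; simp
  refine ⟨b, c, (Finset.ne_of_mem_erase hb).symm, (Finset.ne_of_mem_erase hc).symm, hbc, ?_⟩
  rw [← h, Finset.insert_erase ha]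

/-! ### Polynomials in the plane -/

@[simp] theorem Poly.val_add (P Q : Poly) (x : Plane) : (P + Q).val x = P.val x + Q.val x := by
  simp [Poly.val]

@[simp] theorem Poly.val_sub (P Q : Poly) (x : Plane) : (P - Q).val x = P.val x - Q.val x := by
  simp [Poly.val]

@[simp] theorem Poly.val_mul (P Q : Poly) (x : Plane) : (P * Q).val x = P.val x * Q.val x := by
  simp [Poly.val]

@[simp] theorem Poly.val_smul (c : ℝ) (P : Poly) (x : Plane) : (c • P).val x = c * P.val x := by
  simp [Poly.val]

@[simp] theorem Poly.val_zero (x : Plane) : (0 : Poly).val x = 0 := by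
  simp [Poly.val]

@[simp] theorem Poly.val_one (x : Plane) : (1 : Poly).val x = 1 := by
  simp [Poly.val]

@[simp] theorem Poly.val_C (c : ℝ) (x : Plane) : Poly.val (MvPolynomial.C c) x = c := by
  simp [Poly.val]

@[simp] theorem Poly.val_X (i : Fin 2) (x : Plane) : Poly.val (MvPolynomial.X i) x = x i := by
  simp [Poly.val]

theorem Poly.val_sum {ι : Type*} (s : Finset ι) (P : ι → Poly) (x : Plane) :
    (∑ i ∈ s, P i).val x = ∑ i ∈ s, (P i).val x := by
  simp [Poly.val]

theorem Poly.val_prod {ι : Type*} (s : Finset ι) (P : ι → Poly) (x : Plane) :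
    (∏ i ∈ s, P i).val x = ∏ i ∈ s, (P i).val x := by
  simp [Poly.val]

theorem mem_polyDeg {p : ℕ} {P : Poly} : P ∈ PolyDeg p ↔ P.totalDegree ≤ p :=
  MvPolynomial.mem_restrictTotalDegree _ _ _

/-- A real affine function on the plane as a polynomial. -/
noncomputable def affinePoly (f : Plane →ᵃ[ℝ] ℝ) : Poly :=
  MvPolynomial.C (f 0) +
    ∑ i, MvPolynomial.C (f.linear (EuclideanSpace.single i 1)) * MvPolynomial.X i

theorem val_affinePoly (f : Plane →ᵃ[ℝ] ℝ) (x : Plane) : (affinePoly f).val x = f x := by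
  have hx : x = ∑ i, x i • EuclideanSpace.single i (1 : ℝ) := by
    ext j
    fin_cases j <;> simp [Fin.sum_univ_two]
  have h : f x = f.linear x + f 0 := by
    have := congrFun f.decomp x
    simpa using this
  rw [h]
  conv_rhs => rw [hx]
  simp only [affinePoly, Fin.sum_univ_two, Poly.val_add, Poly.val_mul, Poly.val_C, Poly.val_X,
    map_add, map_smul, smul_eq_mul]
  ring

theorem affinePoly_mem (f : Plane →ᵃ[ℝ] ℝ) : affinePoly f ∈ PolyDeg 1 := by
  rw [mem_polyDeg, affinePoly]
  refine (MvPolynomial.totalDegree_add _ _).trans (max_le (by simp) ?_)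
  refine MvPolynomial.totalDegree_finsetSum_le fun i _ => ?_
  refine (MvPolynomial.totalDegree_mul _ _).trans ?_
  simp

/-! ### Lagrange interpolation on a triangle -/

/-- The Lagrange node of order `p` with multi-index `α`. -/
noncomputable def node (p : ℕ) (t : Finset Plane) (α : Plane → ℕ) : Plane :=
  ∑ v ∈ t, ((α v : ℝ) / p) • v

/-- The Lagrange basis polynomial of order `p` on the triangle `t` that belongs to the multi-index
`α`, as a product of affine functions of the barycentric coordinates. -/
noncomputable def lagrangePoly (p : ℕ) (t : Finset Plane) (α : Plane → ℕ) : Poly :=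
  ∏ v ∈ t, ∏ j ∈ Finset.range (α v),
    MvPolynomial.C ((j + 1 : ℝ)⁻¹) *
      (MvPolynomial.C (p : ℝ) * affinePoly (bary t v) - MvPolynomial.C (j : ℝ))

theorem val_lagrangePoly (p : ℕ) (t : Finset Plane) (α : Plane → ℕ) (x : Plane) :
    (lagrangePoly p t α).val x =
      ∏ v ∈ t, ∏ j ∈ Finset.range (α v), ((j + 1 : ℝ)⁻¹ * (p * bary t v x - j)) := by
  simp only [lagrangePoly, Poly.val_prod, Poly.val_mul, Poly.val_sub, Poly.val_C, val_affinePoly]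

theorem lagrangePoly_mem {p : ℕ} {t : Finset Plane} {α : Plane → ℕ} (hα : ∑ v ∈ t, α v = p) :
    lagrangePoly p t α ∈ PolyDeg p := by
  rw [mem_polyDeg, lagrangePoly]
  refine (MvPolynomial.totalDegree_finsetProd _ _).trans ?_
  rw [← hα]
  refine Finset.sum_le_sum fun v _ => (MvPolynomial.totalDegree_finsetProd _ _).trans ?_
  refine (Finset.sum_le_card_nsmul _ _ 1 fun j _ => ?_).trans (by simp)
  refine (MvPolynomial.totalDegree_mul _ _).trans ?_
  rw [MvPolynomial.totalDegree_C, zero_add]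
  refine (MvPolynomial.totalDegree_sub _ _).trans (max_le ?_ (by rw [MvPolynomial.totalDegree_C]; simp))
  refine (MvPolynomial.totalDegree_mul _ _).trans ?_
  rw [MvPolynomial.totalDegree_C, zero_add]
  exact mem_polyDeg.1 (affinePoly_mem _)

section lagrange

variable {p : ℕ} {t : Finset Plane} (hp : p ≠ 0) (ht : IsTriangle t)

include hp in
theorem sum_node_weights {s : Finset Plane} {α : Plane → ℕ} (hα : ∑ v ∈ s, α v = p) :
    ∑ v ∈ s, ((α v : ℝ) / p) = 1 := by
  rw [← Finset.sum_div, ← Nat.cast_sum, hα, div_self (by exact_mod_cast hp)]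

include hp in
theorem node_mem_hull {s : Finset Plane} {α : Plane → ℕ} (hα : ∑ v ∈ s, α v = p) :
    node p s α ∈ hull s :=
  Finset.mem_convexHull'.2 ⟨fun v => (α v : ℝ) / p, fun v _ => by positivity,
    sum_node_weights hp hα, rfl⟩

include hp ht in
theorem bary_node {α : Plane → ℕ} (hα : ∑ v ∈ t, α v = p) {v : Plane} (hv : v ∈ t) :
    bary t v (node p t α) = (α v : ℝ) / p := by
  rw [node, bary_sum t v t _ (sum_node_weights hp hα), Finset.sum_eq_single v]
  · rw [bary_self ht hv, mul_one]
  · intro w hw hwv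
    rw [bary_of_ne ht hv hw hwv.symm, mul_zero]
  · exact fun h => absurd hv h

include hp ht in
theorem lagrangePoly_node_self {α : Plane → ℕ} (hα : ∑ v ∈ t, α v = p) :
    (lagrangePoly p t α).val (node p t α) = 1 := by
  rw [val_lagrangePoly]
  refine Finset.prod_eq_one fun v hv => ?_
  have hp' : (p : ℝ) ≠ 0 := by exact_mod_cast hp
  rw [bary_node hp ht hα hv, mul_div_cancel₀ _ hp', Finset.prod_mul_distrib,
    ← Finset.prod_range_reflect (fun j : ℕ => ((α v : ℝ) - j)), ← Finset.prod_mul_distrib]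
  refine Finset.prod_eq_one fun j hj => ?_
  have hj' := Finset.mem_range.1 hj
  have : (((α v - 1 - j : ℕ)) : ℝ) = (α v : ℝ) - 1 - j := by
    rw [Nat.cast_sub (by omega), Nat.cast_sub (by omega)]; simp
  rw [this]
  have : (j + 1 : ℝ) ≠ 0 := by positivity
  field_simp
  ring

include hp ht in
theorem lagrangePoly_node_of_ne {α β : Plane → ℕ} (hα : α ∈ t.piAntidiag p)
    (hβ : β ∈ t.piAntidiag p) (h : α ≠ β) : (lagrangePoly p t α).val (node p t β) = 0 := by
  rw [Finset.mem_piAntidiag] at hα hβ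
  -- Both multi-indices have the same sum, so that some component of `β` is below that of `α`.
  obtain ⟨v, hv, hlt⟩ : ∃ v ∈ t, β v < α v := by
    by_contra! hle
    apply h
    have := (Finset.sum_eq_sum_iff_of_le hle).1 (hα.1.trans hβ.1.symm)
    funext v
    by_cases hv : v ∈ t
    · exact this v hv
    · rw [not_not.1 (mt (hα.2 v) hv), not_not.1 (mt (hβ.2 v) hv)]
  rw [val_lagrangePoly]
  refine Finset.prod_eq_zero hv (Finset.prod_eq_zero (Finset.mem_range.2 hlt) ?_)
  rw [bary_node hp ht hβ.1 hv, mul_div_cancel₀ _ (by exact_mod_cast hp)]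
  simp

/-- The polynomial of degree at most `p` on the triangle `t` that has the nodal values `g`. -/
noncomputable def interpolant (p : ℕ) (t : Finset Plane) (g : Plane → ℝ) : Poly :=
  ∑ α ∈ t.piAntidiag p, g (node p t α) • lagrangePoly p t α

theorem interpolant_mem (g : Plane → ℝ) : interpolant p t g ∈ PolyDeg p :=
  Submodule.sum_mem _ fun _ hα =>
    Submodule.smul_mem _ _ (lagrangePoly_mem (Finset.mem_piAntidiag.1 hα).1)

include hp ht in
theorem interpolant_node (g : Plane → ℝ) {α : Plane → ℕ} (hα : α ∈ t.piAntidiag p) :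
    (interpolant p t g).val (node p t α) = g (node p t α) := by
  rw [interpolant, Poly.val_sum, Finset.sum_eq_single α]
  · rw [Poly.val_smul, lagrangePoly_node_self hp ht (Finset.mem_piAntidiag.1 hα).1, mul_one]
  · intro β hβ hne
    rw [Poly.val_smul, lagrangePoly_node_of_ne hp ht hβ hα hne, mul_zero]
  · exact fun h => absurd hα h

include ht in
/-- There are at least as many Lagrange nodes as monomials of degree at most `p`. -/
theorem finrank_polyDeg_le : Module.finrank ℝ (PolyDeg p) ≤ (t.piAntidiag p).card := by
  classical
  obtain ⟨a, ha⟩ : t.Nonempty := Finset.card_pos.1 (by rw [ht.card_eq]; norm_num)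
  obtain ⟨b, c, hab, hac, hbc, rfl⟩ := ht.exists_eq ha
  have hcard : Module.finrank ℝ (PolyDeg p) =
      Nat.card { n : Fin 2 →₀ ℕ | (n.sum fun _ e => e) ≤ p } :=
    Module.finrank_eq_nat_card_basis (MvPolynomial.basisRestrictSupport ℝ _)
  have hsum : ∀ n : Fin 2 →₀ ℕ, (n.sum fun _ e => e) = n 0 + n 1 := fun n => by
    rw [Finsupp.sum_fintype _ _ (fun _ => rfl), Fin.sum_univ_two]
  rw [hcard, ← Nat.card_eq_finsetCard]
  -- The exponents of a monomial, completed to the sum `p`, form a multi-index.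
  let F : { n : Fin 2 →₀ ℕ | (n.sum fun _ e => e) ≤ p } → ({a, b, c} : Finset Plane).piAntidiag p :=
    fun n => ⟨fun v => if v = a then n.1 0 else if v = b then n.1 1 else
      if v = c then p - n.1 0 - n.1 1 else 0, by
        have hn := n.2
        rw [Set.mem_ofPred_eq, hsum] at hn
        rw [Finset.mem_piAntidiag]
        constructor
        · rw [Finset.sum_insert (by simp [hab, hac]), Finset.sum_insert (by simp [hbc]),
            Finset.sum_singleton]
          simp only [if_true, hab.symm, hac.symm, hbc.symm, if_false]
          omega
        · intro v hv
          simp only [Finset.mem_insert, Finset.mem_singleton]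
          by_contra! hne
          simp [hne.1, hne.2.1, hne.2.2] at hv⟩
  refine Nat.card_le_card_of_injective F fun m n hmn => ?_
  have h := fun v => congrFun (congrArg Subtype.val hmn) v
  have h0 := h a
  have h1 := h b
  simp only [F, if_true, hab.symm, if_false] at h0 h1
  refine Subtype.ext (Finsupp.ext fun i => ?_)
  fin_cases i
  · exact h0
  · exact h1

include hp ht in
/-- A polynomial of degree at most `p` is determined by its values at the Lagrange nodes: nodal
evaluation is onto by Lagrange interpolation, hence one-to-one by the dimension count. -/
theorem eq_of_node_eq {P Q : Poly} (hP : P ∈ PolyDeg p) (hQ : Q ∈ PolyDeg p)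
    (h : ∀ α ∈ t.piAntidiag p, P.val (node p t α) = Q.val (node p t α)) : P = Q := by
  classical
  let ev : PolyDeg p →ₗ[ℝ] (t.piAntidiag p → ℝ) :=
    { toFun := fun P α => P.1.val (node p t α)
      map_add' := fun P Q => by ext; simp
      map_smul' := fun c P => by ext; simp }
  have hsurj : Function.Surjective ev := fun g => by
    refine ⟨⟨∑ α : t.piAntidiag p, g α • lagrangePoly p t α, Submodule.sum_mem _ fun α _ =>
      Submodule.smul_mem _ _ (lagrangePoly_mem (Finset.mem_piAntidiag.1 α.2).1)⟩, ?_⟩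
    ext α
    change Poly.val _ _ = _
    rw [Poly.val_sum, Finset.sum_eq_single α]
    · rw [Poly.val_smul, lagrangePoly_node_self hp ht (Finset.mem_piAntidiag.1 α.2).1, mul_one]
    · intro β _ hne
      rw [Poly.val_smul, lagrangePoly_node_of_ne hp ht β.2 α.2 (Subtype.coe_ne_coe.2 hne), mul_zero]
    · exact fun h => absurd (Finset.mem_univ α) h
  have hfr : Module.finrank ℝ (PolyDeg p) = Module.finrank ℝ (t.piAntidiag p → ℝ) := by
    refine le_antisymm ?_ (LinearMap.finrank_le_finrank_of_surjective hsurj)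
    simpa using finrank_polyDeg_le (p := p) ht
  have hinj := (LinearMap.injective_iff_surjective_of_finrank_eq_finrank hfr).2 hsurj
  have : (⟨P, hP⟩ : PolyDeg p) = ⟨Q, hQ⟩ := hinj (by ext α; exact h α α.2)
  exact congrArg Subtype.val this

include hp ht in
theorem eq_interpolant {P : Poly} (hP : P ∈ PolyDeg p) : P = interpolant p t P.val :=
  eq_of_node_eq hp ht hP (interpolant_mem _) fun _ hα => (interpolant_node hp ht _ hα).symm

/-- The nodes of the face `s` of the triangle `t` are those with multi-index supported in `s`. -/
theorem node_mem_lagrangeNodes {s : Finset Plane} (hs : s ⊆ t) {α : Plane → ℕ}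
    (hα : ∑ v ∈ t, α v = p) (h0 : ∀ v ∈ t, v ∉ s → α v = 0) :
    node p t α ∈ lagrangeNodes p s := by
  refine ⟨α, ?_, ?_⟩
  · rw [← hα]
    exact Finset.sum_subset hs h0
  · rw [node]
    exact (Finset.sum_subset hs fun v hv hvs => by simp [h0 v hv hvs]).symm

include hp ht in
/-- A polynomial of degree at most `p` that vanishes at the Lagrange nodes of a face vanishes on
this face. -/
theorem eq_zero_of_lagrangeNodes {P : Poly} (hP : P ∈ PolyDeg p) {s : Finset Plane} (hs : s ⊆ t)
    (h : ∀ z ∈ lagrangeNodes p s, P.val z = 0) {x : Plane} (hx : x ∈ hull s) : P.val x = 0 := by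
  rw [eq_interpolant hp ht hP, interpolant, Poly.val_sum]
  refine Finset.sum_eq_zero fun α hα => ?_
  rw [Finset.mem_piAntidiag] at hα
  rw [Poly.val_smul]
  by_cases h0 : ∀ v ∈ t, v ∉ s → α v = 0
  · rw [h _ (node_mem_lagrangeNodes hs hα.1 h0), zero_mul]
  · push Not at h0
    obtain ⟨v, hv, hvs, hne⟩ := h0
    rw [val_lagrangePoly, Finset.prod_eq_zero hv, mul_zero]
    refine Finset.prod_eq_zero (Finset.mem_range.2 (Nat.pos_of_ne_zero hne)) ?_
    rw [bary_eq_zero_of_mem_hull ht hs hx hv hvs]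
    simp

include ht in
theorem abs_lagrangePoly_le {α : Plane → ℕ} (hα : ∑ v ∈ t, α v = p) {x : Plane}
    (hx : x ∈ hull t) : |(lagrangePoly p t α).val x| ≤ (p : ℝ) ^ p := by
  have hx0 := (mem_hull_iff ht).1 hx
  have h1 : ∀ v ∈ t, bary t v x ≤ 1 := fun v hv => by
    rw [← sum_bary ht x]
    exact Finset.single_le_sum (f := fun v => bary t v x) hx0 hv
  rw [val_lagrangePoly, Finset.abs_prod, ← hα, ← Finset.prod_pow_eq_pow_sum, hα]
  refine Finset.prod_le_prod (fun _ _ => abs_nonneg _) fun v hv => ?_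
  rw [Finset.abs_prod]
  refine (Finset.prod_le_prod (g := fun _ => (p : ℝ)) (fun _ _ => abs_nonneg _)
    fun j hj => ?_).trans (by simp)
  have hjp : j + 1 ≤ p := by
    have := Finset.mem_range.1 hj
    have := Finset.single_le_sum (f := α) (fun _ _ => Nat.zero_le _) hv
    omega
  have hjp' : (j : ℝ) + 1 ≤ p := by exact_mod_cast hjp
  have hb : |p * bary t v x - j| ≤ p := by
    have hp0 : (0 : ℝ) ≤ p := Nat.cast_nonneg p
    have := mul_le_mul_of_nonneg_left (h1 v hv) hp0
    have := mul_nonneg hp0 (hx0 v hv)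
    have : (0 : ℝ) ≤ j := Nat.cast_nonneg j
    rw [abs_le]
    constructor <;> linarith
  rw [abs_mul]
  have hi : |((j : ℝ) + 1)⁻¹| ≤ 1 := by
    rw [abs_of_nonneg (by positivity)]
    exact inv_le_one_of_one_le₀ (by linarith [(Nat.cast_nonneg j : (0 : ℝ) ≤ j)])
  calc _ ≤ 1 * (p : ℝ) := mul_le_mul hi hb (abs_nonneg _) zero_le_one
    _ = p := one_mul _

theorem card_piAntidiag_le (p : ℕ) (ht : t.card = 3) : (t.piAntidiag p).card ≤ (p + 1) ^ 3 := by
  classical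
  have hle : ∀ α : t.piAntidiag p, ∀ v : t, α.1 v < p + 1 := fun α v => by
    have hα : ∑ v ∈ t, α.1 v = p := (Finset.mem_piAntidiag.1 α.2).1
    have := Finset.single_le_sum (f := α.1) (fun _ _ => Nat.zero_le _) v.2
    omega
  have h := Fintype.card_le_of_injective (α := t.piAntidiag p) (β := t → Fin (p + 1))
    (fun α v => ⟨α.1 v, hle α v⟩) fun α β h => by
      refine Subtype.ext (funext fun v => ?_)
      by_cases hv : v ∈ t
      · exact congrArg Fin.val (congrFun h ⟨v, hv⟩)
      · have h1 := mt ((Finset.mem_piAntidiag.1 α.2).2 v) hv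
        have h2 := mt ((Finset.mem_piAntidiag.1 β.2).2 v) hv
        rw [not_not.1 h1, not_not.1 h2]
  simpa [ht] using h

include hp ht in
/-- On a triangle, a polynomial is bounded by its nodal values. -/
theorem abs_val_le_of_nodes {P : Poly} (hP : P ∈ PolyDeg p) {D : ℝ}
    (hD : ∀ α ∈ t.piAntidiag p, |P.val (node p t α)| ≤ D) {x : Plane} (hx : x ∈ hull t) :
    |P.val x| ≤ (p + 1) ^ 3 * (p : ℝ) ^ p * D := by
  classical
  have hD0 : 0 ≤ D := by
    obtain ⟨v, hv⟩ : t.Nonempty := Finset.card_pos.1 (by rw [ht.card_eq]; norm_num)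
    refine (abs_nonneg _).trans (hD (Pi.single v p) ?_)
    rw [Finset.mem_piAntidiag]
    refine ⟨by simp [hv], fun w hw => ?_⟩
    by_contra hwt
    exact hw (Pi.single_eq_of_ne (fun e : w = v => hwt (by rwa [e])) _)
  conv_lhs => rw [eq_interpolant hp ht hP, interpolant, Poly.val_sum]
  refine (Finset.abs_sum_le_sum_abs _ _).trans ?_
  refine (Finset.sum_le_card_nsmul _ _ ((p : ℝ) ^ p * D) fun α hα => ?_).trans ?_
  · rw [Poly.val_smul, abs_mul, mul_comm]
    exact mul_le_mul (abs_lagrangePoly_le ht (Finset.mem_piAntidiag.1 hα).1 hx) (hD α hα)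
      (abs_nonneg _) (by positivity)
  · rw [nsmul_eq_mul, mul_assoc]
    have h := card_piAntidiag_le p ht.card_eq
    refine mul_le_mul_of_nonneg_right ?_ (by positivity)
    exact_mod_cast h

end lagrange

/-! ### Integrals over edges and triangles -/

theorem Poly.continuous_val (P : Poly) : Continuous P.val := by
  have h : Continuous fun x : Plane => (fun i => x i : Fin 2 → ℝ) := by fun_prop
  exact (MvPolynomial.continuous_eval P).comp h

theorem isCompact_hull (s : Finset Plane) : IsCompact (hull s) :=
  s.finite_toSet.isCompact_convexHull (𝕜 := ℝ)

theorem hull_pair (b c : Plane) : hull {b, c} = segment ℝ b c := by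
  simp [hull, convexHull_pair]

/-- The integral of a function over a segment with respect to arc length, in terms of the
parametrization by the unit interval. -/
theorem integral_hull_pair {b c : Plane} (h : b ≠ c) (f : Plane → ℝ) :
    ∫ x in hull {b, c}, f x ∂(Measure.hausdorffMeasure 1) =
      dist b c * ∫ s in (0 : ℝ)..1, f (AffineMap.lineMap b c s) := by
  have hl : 0 < dist b c := dist_pos.2 h
  let g : ℝ → Plane := fun s => AffineMap.lineMap b c (s / dist b c)
  have hg : Isometry g := Isometry.of_dist_eq fun s r => by
    simp only [g]
    rw [dist_lineMap_lineMap, Real.dist_eq, Real.dist_eq, ← sub_div, abs_div, abs_of_pos hl,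
      div_mul_cancel₀ _ hl.ne']
  have hemb : MeasurableEmbedding g := hg.isClosedEmbedding.measurableEmbedding
  have hsub : hull {b, c} ⊆ Set.range g := by
    rw [hull_pair, segment_eq_image_lineMap]
    rintro _ ⟨s, _, rfl⟩
    exact ⟨s * dist b c, by simp only [g]; rw [mul_div_cancel_right₀ _ hl.ne']⟩
  have hpre : g ⁻¹' hull {b, c} = Set.Icc 0 (dist b c) := by
    rw [hull_pair, segment_eq_image_lineMap]
    ext s
    simp only [g, Set.mem_preimage]
    rw [(AffineMap.lineMap_injective ℝ h).mem_set_image, Set.mem_Icc, Set.mem_Icc,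
      div_le_one hl, le_div_iff₀ hl, zero_mul]
  have hmap := hg.map_hausdorffMeasure (d := 1) (Or.inl zero_le_one)
  rw [hausdorffMeasure_real] at hmap
  have hmeas : MeasurableSet (hull {b, c}) := (isCompact_hull _).isClosed.measurableSet
  rw [← Set.inter_eq_left.2 hsub, ← Measure.restrict_restrict hmeas, ← hmap,
    hemb.setIntegral_map, hpre, integral_Icc_eq_integral_Ioc,
    ← intervalIntegral.integral_of_le hl.le]
  simp only [g]
  rw [intervalIntegral.integral_comp_div (fun s => f (AffineMap.lineMap b c s)) hl.ne', zero_div,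
    div_self hl.ne', smul_eq_mul]

theorem integrableOn_hull_pair {b c : Plane} {f : Plane → ℝ} (hf : ContinuousOn f (hull {b, c})) :
    IntegrableOn f (hull {b, c}) (Measure.hausdorffMeasure 1) := by
  have hfin : (Measure.hausdorffMeasure 1 : Measure Plane) (hull {b, c}) < ⊤ := by
    rw [hull_pair, hausdorffMeasure_segment]
    exact edist_lt_top _ _
  have hmeas : MeasurableSet (hull {b, c}) := (isCompact_hull _).isClosed.measurableSet
  obtain ⟨M, hM⟩ := (isCompact_hull {b, c}).exists_bound_of_continuousOn hf
  exact IntegrableOn.of_bound hfin (hf.aestronglyMeasurable hmeas) M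
    ((ae_restrict_iff' hmeas).2 (Filter.Eventually.of_forall hM))

theorem integrableOn_hull {t : Finset Plane} {f : Plane → ℝ} (hf : Continuous f) :
    IntegrableOn f (hull t) :=
  hf.continuousOn.integrableOn_compact (isCompact_hull t)

/-- The determinant of two vectors of the plane. -/
def cross (u v : Plane) : ℝ := u 0 * v 1 - u 1 * v 0

theorem linear_apply (f : Plane →ᵃ[ℝ] ℝ) (d : Plane) :
    f.linear d = d 0 * f.linear (EuclideanSpace.single 0 1)
      + d 1 * f.linear (EuclideanSpace.single 1 1) := by
  have hx : d = ∑ i, d i • EuclideanSpace.single i (1 : ℝ) := by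
    ext j
    fin_cases j <;> simp [Fin.sum_univ_two]
  conv_lhs => rw [hx]
  simp [Fin.sum_univ_two]

theorem bary_sub (t : Finset Plane) (v x y : Plane) :
    (bary t v).linear (x - y) = bary t v x - bary t v y := by
  simpa using (bary t v).linearMap_vsub x y

section labelled

variable {a b c : Plane} (hab : a ≠ b) (hac : a ≠ c) (hbc : b ≠ c)
  (ht : IsTriangle {a, b, c})

include hab hac hbc ht

theorem cross_ne_zero : cross (a - c) (b - c) ≠ 0 := by
  have ha : a ∈ ({a, b, c} : Finset Plane) := by simp
  have hb : b ∈ ({a, b, c} : Finset Plane) := by simp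
  have hc : c ∈ ({a, b, c} : Finset Plane) := by simp
  have h1 := bary_sub {a, b, c} a a c
  have h2 := bary_sub {a, b, c} a b c
  have h3 := bary_sub {a, b, c} b a c
  have h4 := bary_sub {a, b, c} b b c
  rw [linear_apply, bary_self ht ha, bary_of_ne ht ha hc hac] at h1
  rw [linear_apply, bary_of_ne ht ha hb hab, bary_of_ne ht ha hc hac] at h2
  rw [linear_apply, bary_of_ne ht hb ha hab.symm, bary_of_ne ht hb hc hbc] at h3
  rw [linear_apply, bary_self ht hb, bary_of_ne ht hb hc hbc] at h4
  intro h0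
  rw [cross] at h0
  generalize (bary {a, b, c} a).linear (EuclideanSpace.single 0 1) = l0 at *
  generalize (bary {a, b, c} a).linear (EuclideanSpace.single 1 1) = l1 at *
  generalize (bary {a, b, c} b).linear (EuclideanSpace.single 0 1) = m0 at *
  generalize (bary {a, b, c} b).linear (EuclideanSpace.single 1 1) = m1 at *
  generalize (a - c) 0 = u0 at *
  generalize (a - c) 1 = u1 at *
  generalize (b - c) 0 = v0 at *
  generalize (b - c) 1 = v1 at *
  have : (l0 * m1 - l1 * m0) * (u0 * v1 - u1 * v0) = 1 := by
    linear_combination (v0 * m0 + v1 * m1) * h1 - (u0 * m0 + u1 * m1) * h2 + h4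
  rw [h0, mul_zero] at this
  exact zero_ne_one this

omit hab hac hbc ht in
theorem bary_param (v : Plane) (s r : ℝ) :
    bary {a, b, c} v (c + s • (a - c) + r • (b - c)) =
      s * bary {a, b, c} v a + r * bary {a, b, c} v b + (1 - s - r) * bary {a, b, c} v c := by
  have h := (bary {a, b, c} v).map_vadd c (s • (a - c) + r • (b - c))
  rw [map_add, map_smul, map_smul, bary_sub, bary_sub] at h
  have e : (s • (a - c) + r • (b - c)) +ᵥ c = c + s • (a - c) + r • (b - c) := by
    rw [vadd_eq_add]; abel
  rw [e] at h
  rw [h]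
  simp only [smul_eq_mul, vadd_eq_add]
  ring

theorem param_mem_hull_iff (s r : ℝ) :
    c + s • (a - c) + r • (b - c) ∈ hull {a, b, c} ↔ 0 ≤ s ∧ 0 ≤ r ∧ s + r ≤ 1 := by
  have ha : a ∈ ({a, b, c} : Finset Plane) := by simp
  have hb : b ∈ ({a, b, c} : Finset Plane) := by simp
  have hc : c ∈ ({a, b, c} : Finset Plane) := by simp
  rw [mem_hull_iff ht]
  simp only [bary_param, Finset.mem_insert, Finset.mem_singleton, forall_eq_or_imp, forall_eq,
    bary_self ht ha, bary_self ht hb, bary_self ht hc, bary_of_ne ht ha hb hab,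
    bary_of_ne ht ha hc hac, bary_of_ne ht hb hc hbc, bary_of_ne ht hb ha hab.symm,
    bary_of_ne ht hc ha hac.symm, bary_of_ne ht hc hb hbc.symm]
  constructor
  · rintro ⟨h1, h2, h3⟩
    exact ⟨by linarith, by linarith, by linarith⟩
  · rintro ⟨h1, h2, h3⟩
    exact ⟨by linarith, by linarith, by linarith⟩

theorem exists_param (x : Plane) : ∃ s r : ℝ, x = c + s • (a - c) + r • (b - c) := by
  have h := sum_bary_smul ht x
  have h1 := sum_bary ht x
  rw [Finset.sum_insert (by simp [hab, hac]), Finset.sum_insert (by simp [hbc]),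
    Finset.sum_singleton] at h h1
  refine ⟨bary {a, b, c} a x, bary {a, b, c} b x, ?_⟩
  conv_lhs => rw [← h]
  have : bary {a, b, c} c x = 1 - bary {a, b, c} a x - bary {a, b, c} b x := by linarith
  rw [this]
  module

omit hab hac hbc ht in
theorem hasDerivAt_val (P : Poly) (x d : Plane) (s : ℝ) :
    HasDerivAt (fun s : ℝ => P.val (x + s • d)) (∑ i, d i * (gradient P i).val (x + s • d)) s := by
  induction P using MvPolynomial.induction_on with
  | C r => simpa [gradient] using hasDerivAt_const s r
  | add P Q hP hQ =>
    simp only [gradient, map_add, Poly.val_add, mul_add, Finset.sum_add_distrib] at hP hQ ⊢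
    exact hP.add hQ
  | mul_X P i hP =>
    have hX : HasDerivAt (fun s : ℝ => (x + s • d) i) (d i) s := by
      simpa using ((hasDerivAt_id s).mul_const (d i)).const_add (x i)
    simp only [gradient, Poly.val_mul, Poly.val_X, Derivation.leibniz, smul_eq_mul, Poly.val_add,
      MvPolynomial.pderiv_X] at hP ⊢
    refine (hP.mul hX).congr_deriv ?_
    simp only [Fin.sum_univ_two]
    fin_cases i
    · simp
      ring
    · simp
      ring

omit hab hac hbc ht in
theorem integral_standardSimplex {g : ℝ × ℝ → ℝ} (hg : Continuous g) :
    ∫ y in {y : ℝ × ℝ | 0 ≤ y.1 ∧ 0 ≤ y.2 ∧ y.1 + y.2 ≤ 1}, g y =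
      ∫ r in (0 : ℝ)..1, ∫ s in (0 : ℝ)..(1 - r), g (r, s) := by
  set K : Set (ℝ × ℝ) := {y : ℝ × ℝ | 0 ≤ y.1 ∧ 0 ≤ y.2 ∧ y.1 + y.2 ≤ 1} with hK
  have hKc : IsClosed K := by
    refine (isClosed_le continuous_const continuous_fst).inter
      ((isClosed_le continuous_const continuous_snd).inter
        (isClosed_le (continuous_fst.add continuous_snd) continuous_const))
  have hKs : K ⊆ Set.Icc (0 : ℝ) 1 ×ˢ Set.Icc (0 : ℝ) 1 := by
    rintro ⟨r, s⟩ ⟨h1, h2, h3⟩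
    simp only at h1 h2 h3
    exact ⟨⟨h1, by simp only; linarith⟩, ⟨h2, by simp only; linarith⟩⟩
  have hint : IntegrableOn g K :=
    (hg.continuousOn.integrableOn_compact (isCompact_Icc.prod isCompact_Icc)).mono_set hKs
  rw [← integral_indicator hKc.measurableSet, Measure.volume_eq_prod, integral_prod _ (by
    rw [← Measure.volume_eq_prod]; exact (integrable_indicator_iff hKc.measurableSet).2 hint),
    intervalIntegral.integral_of_le zero_le_one, ← integral_Icc_eq_integral_Ioc,
    ← integral_indicator measurableSet_Icc]
  refine integral_congr_ae (Filter.Eventually.of_forall fun r => ?_)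
  by_cases hr : r ∈ Set.Icc (0 : ℝ) 1
  · simp only [Set.indicator_of_mem hr]
    rw [intervalIntegral.integral_of_le (by linarith [hr.2]), ← integral_Icc_eq_integral_Ioc,
      ← integral_indicator measurableSet_Icc]
    refine integral_congr_ae (Filter.Eventually.of_forall fun s => ?_)
    by_cases hs : s ∈ Set.Icc 0 (1 - r)
    · simp only [Set.indicator_of_mem hs]
      have hm : (r, s) ∈ K := ⟨hr.1, hs.1, by simp only; linarith [hs.2]⟩
      exact Set.indicator_of_mem hm _
    · simp only [Set.indicator_of_notMem hs]
      exact Set.indicator_of_notMem (fun h : (r, s) ∈ K =>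
        hs ⟨h.2.1, by have := h.2.2; simp only at this; linarith⟩) _
  · simp only [Set.indicator_of_notMem hr]
    refine integral_eq_zero_of_ae (Filter.Eventually.of_forall fun s => ?_)
    exact Set.indicator_of_notMem (fun h : (r, s) ∈ K => hr (hKs h).1) _

/-- The affine change of variables from the standard simplex. -/
theorem triangleIntegral_eq {f : Plane → ℝ} (hf : Continuous f) :
    triangleIntegral {a, b, c} f = |cross (a - c) (b - c)| *
      ∫ r in (0 : ℝ)..1, ∫ s in (0 : ℝ)..(1 - r), f (c + s • (a - c) + r • (b - c)) := by
  let Ll : Plane →ₗ[ℝ] Plane :=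
    (EuclideanSpace.proj 1 : Plane →L[ℝ] ℝ).toLinearMap.smulRight (a - c) +
      (EuclideanSpace.proj 0 : Plane →L[ℝ] ℝ).toLinearMap.smulRight (b - c)
  let Lc : Plane →L[ℝ] Plane := LinearMap.toContinuousLinearMap Ll
  have hLc : ∀ y, Lc y = y 1 • (a - c) + y 0 • (b - c) := fun y => rfl
  have hdet : |Lc.det| = |cross (a - c) (b - c)| := by
    have : Lc.det = -cross (a - c) (b - c) := by
      change LinearMap.det Ll = _
      rw [← LinearMap.det_toMatrix (EuclideanSpace.basisFun (Fin 2) ℝ).toBasis, Matrix.det_fin_two]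
      simp [LinearMap.toMatrix_apply, Ll, cross]
      ring
    rw [this, abs_neg]
  let φ : Plane → Plane := fun y => c + Lc y
  let e : Plane → ℝ × ℝ := fun y => (y 0, y 1)
  have he : MeasurePreserving e := by
    exact (volume_preserving_finTwoArrow ℝ).comp (PiLp.volume_preserving_ofLp (Fin 2))
  have heemb : MeasurableEmbedding e :=
    ((MeasurableEquiv.toLp 2 (Fin 2 → ℝ)).symm.trans
      MeasurableEquiv.finTwoArrow).measurableEmbedding
  set K : Set (ℝ × ℝ) := {y : ℝ × ℝ | 0 ≤ y.1 ∧ 0 ≤ y.2 ∧ y.1 + y.2 ≤ 1} with hK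
  have hKm : MeasurableSet K :=
    ((isClosed_le continuous_const continuous_fst).inter
      ((isClosed_le continuous_const continuous_snd).inter
        (isClosed_le (continuous_fst.add continuous_snd) continuous_const))).measurableSet
  have hφ : ∀ y, φ y = c + y 1 • (a - c) + y 0 • (b - c) := fun y => by
    simp only [φ]; rw [hLc, add_assoc]
  have hhull : hull {a, b, c} = φ '' (e ⁻¹' K) := by
    ext x
    constructor
    · intro hx
      obtain ⟨s, r, rfl⟩ := exists_param hab hac hbc ht x
      rw [param_mem_hull_iff hab hac hbc ht] at hx
      refine ⟨!₂[r, s], ?_, by simp [hφ]⟩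
      simp only [Set.mem_preimage, hK, e, Set.mem_ofPred_eq]
      exact ⟨by simpa using hx.2.1, by simpa using hx.1, by simpa using by linarith [hx.2.2]⟩
    · rintro ⟨y, hy, rfl⟩
      rw [hφ, param_mem_hull_iff hab hac hbc ht]
      exact ⟨hy.2.1, hy.1, by have := hy.2.2; simp only [e] at this; linarith⟩
  have hinj : Function.Injective φ := by
    have hne : Ll.det ≠ 0 := fun h => cross_ne_zero hab hac hbc ht (by
      have h' : |Ll.det| = |cross (a - c) (b - c)| := hdet
      rw [h, abs_zero] at h'
      exact abs_eq_zero.1 h'.symm)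
    have hL : Function.Injective Ll := (LinearMap.equivOfDetNeZero Ll hne).injective
    intro y z hyz
    exact hL (add_left_cancel hyz)
  have hderiv : ∀ y ∈ e ⁻¹' K, HasFDerivWithinAt φ Lc (e ⁻¹' K) y := fun y _ =>
    (Lc.hasFDerivAt.const_add c).hasFDerivWithinAt
  rw [triangleIntegral, hhull, integral_image_eq_integral_abs_det_fderiv_smul volume
    (he.measurable hKm) hderiv hinj.injOn, integral_smul, hdet, smul_eq_mul]
  congr 1
  have hg : Continuous fun y : ℝ × ℝ => f (c + y.2 • (a - c) + y.1 • (b - c)) := by fun_prop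
  rw [← integral_standardSimplex hg, ← he.setIntegral_preimage_emb heemb]
  simp only [hφ, e]
  rfl

/-- The divergence theorem in the direction of an edge vector, in coordinates. -/
theorem triangleIntegral_dirDeriv (P : Poly) :
    triangleIntegral {a, b, c} (fun x => ∑ i, (a - c) i * (gradient P i).val x) =
      |cross (a - c) (b - c)| * ((∫ r in (0 : ℝ)..1, P.val (AffineMap.lineMap a b r)) -
        ∫ r in (0 : ℝ)..1, P.val (AffineMap.lineMap c b r)) := by
  have hcont : ∀ i, Continuous (gradient P i).val := fun i => Poly.continuous_val _
  rw [triangleIntegral_eq hab hac hbc ht (by fun_prop)]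
  have hP := P.continuous_val
  have hlm : ∀ x : Plane, Continuous fun r : ℝ => P.val (AffineMap.lineMap x b r) := fun x =>
    hP.comp AffineMap.lineMap_continuous
  rw [← intervalIntegral.integral_sub ((hlm a).intervalIntegrable _ _)
    ((hlm c).intervalIntegrable _ _)]
  congr 1
  refine intervalIntegral.integral_congr fun r _ => ?_
  have hcomm : ∀ s : ℝ, c + s • (a - c) + r • (b - c) = (c + r • (b - c)) + s • (a - c) :=
    fun s => by abel
  simp only [hcomm]
  rw [intervalIntegral.integral_eq_sub_of_hasDerivAt
    (fun s _ => hasDerivAt_val P (c + r • (b - c)) (a - c) s)]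
  · congr 2
    · rw [AffineMap.lineMap_apply_module]; module
    · rw [AffineMap.lineMap_apply_module]; module
  · refine Continuous.intervalIntegrable ?_ _ _
    exact continuous_finsetSum _ fun i _ => continuous_const.mul ((hcont i).comp (by fun_prop))

end labelled

/-! ### The divergence theorem on a triangle -/

theorem oppositeEdge_eq {a b c : Plane} (hab : a ≠ b) (hac : a ≠ c) :
    oppositeEdge {a, b, c} a = {b, c} := by
  classical
  simp [oppositeEdge, Finset.erase_insert_eq_erase, Finset.erase_eq_of_notMem, hab, hac]

theorem inner_eq (x y : Plane) : inner ℝ x y = x 0 * y 0 + x 1 * y 1 := by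
  simp [PiLp.inner_apply, Fin.sum_univ_two, mul_comm]

/-- The outer normal is a unit vector orthogonal to the edge, and its product with a vector from the
opposite vertex to the edge is the height: the length of the edge times it is twice the area. -/
theorem outerNormal_spec {a b c : Plane} (hab : a ≠ b) (hac : a ≠ c) (hbc : b ≠ c)
    (ht : IsTriangle {a, b, c}) :
    ‖outerNormal {a, b, c} a‖ = 1 ∧ inner ℝ (outerNormal {a, b, c} a) (c - b) = 0 ∧
      dist b c * inner ℝ (outerNormal {a, b, c} a) (b - a) = |cross (b - a) (c - a)| := by
  classical
  have hcr : cross (b - a) (c - b) = cross (b - a) (c - a) := by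
    simp only [cross, PiLp.sub_apply]; ring
  have hne : cross (b - a) (c - b) ≠ 0 := by
    have hs : ({b, c, a} : Finset Plane) = {a, b, c} := by
      ext x; simp only [Finset.mem_insert, Finset.mem_singleton]; tauto
    rw [hcr]
    exact cross_ne_zero hbc hab.symm hac.symm (hs ▸ ht)
  set S : Submodule ℝ Plane := vectorSpan ℝ (oppositeEdge {a, b, c} a : Set Plane) with hS
  set u : Plane := (oppositeEdge {a, b, c} a).centroid ℝ id - a with hu
  set w : Plane := Sᗮ.starProjection u with hw
  have hn : outerNormal {a, b, c} a = ‖w‖⁻¹ • w := rfl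
  have hSspan : S = Submodule.span ℝ {c - b} := by
    rw [hS, oppositeEdge_eq hab hac, Finset.coe_pair, vectorSpan_pair_rev]
    rfl
  have hvS : c - b ∈ S := by rw [hSspan]; exact Submodule.mem_span_singleton_self _
  have hu' : u = (b - a) + (2⁻¹ : ℝ) • (c - b) := by
    rw [hu, oppositeEdge_eq hab hac, Finset.centroid_pair]
    simp only [id, vsub_eq_sub, vadd_eq_add]
    norm_num
    module
  have hwS : w ∈ Sᗮ := Submodule.starProjection_apply_mem _ _
  have hwv : inner ℝ w (c - b) = 0 := Submodule.inner_left_of_mem_orthogonal hvS hwS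
  have huw : u - w ∈ Sᗮᗮ := Submodule.sub_starProjection_mem_orthogonal _
  have hwq : inner ℝ w (b - a) = ‖w‖ ^ 2 := by
    have h1 : inner ℝ w (u - w) = 0 := Submodule.inner_right_of_mem_orthogonal hwS huw
    rw [inner_sub_right, real_inner_self_eq_norm_sq, hu', inner_add_right, inner_smul_right, hwv]
      at h1
    linarith
  have hw0 : w ≠ 0 := by
    intro h0
    rw [h0, sub_zero, Submodule.orthogonal_orthogonal, hSspan, Submodule.mem_span_singleton] at huw
    obtain ⟨k, hk⟩ := huw
    apply hne
    have hq : b - a = (k - 2⁻¹ : ℝ) • (c - b) := by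
      rw [sub_smul, hk, hu']; abel
    rw [hq]
    simp only [cross, PiLp.smul_apply, smul_eq_mul]
    ring
  have hwn : 0 < ‖w‖ := norm_pos_iff.2 hw0
  refine ⟨?_, ?_, ?_⟩
  · rw [hn, norm_smul, norm_inv, norm_norm, inv_mul_cancel₀ hwn.ne']
  · rw [hn, inner_smul_left, hwv, mul_zero]
  · rw [hn, inner_smul_left, hwq, dist_comm, dist_eq_norm, ← hcr]
    have h1 : (starRingEnd ℝ) ‖w‖⁻¹ * ‖w‖ ^ 2 = ‖w‖ := by
      simp only [conj_trivial]
      field_simp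
    rw [h1]
    have hwsq := real_inner_self_eq_norm_sq w
    have hvsq := real_inner_self_eq_norm_sq (c - b)
    rw [inner_eq] at hwv hwq hwsq hvsq
    -- In the plane, `w ⟂ c - b` makes the cross product of `w` and `c - b` the product of norms.
    have h2 : cross w (c - b) ^ 2 = (‖c - b‖ * ‖w‖) ^ 2 := by
      rw [mul_pow, ← hwsq, ← hvsq, cross]
      linear_combination (-(w 0 * (c - b) 0 + w 1 * (c - b) 1)) * hwv
    have h3 : cross w (c - b) * cross (b - a) (c - b) = cross w (c - b) * cross w (c - b) := by
      rw [← sq (cross w (c - b)), h2, mul_pow, ← hwq, ← hvsq]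
      simp only [cross]
      linear_combination (-((b - a) 0 * (c - b) 0 + (b - a) 1 * (c - b) 1)) * hwv
    have h4 : cross w (c - b) ≠ 0 := by
      intro h0
      rw [h0, zero_pow two_ne_zero] at h2
      have : ‖c - b‖ ≠ 0 := norm_ne_zero_iff.2 (sub_ne_zero.2 hbc.symm)
      exact (pow_ne_zero 2 (mul_ne_zero this hwn.ne')) h2.symm
    rw [mul_left_cancel₀ h4 h3, ← abs_of_nonneg (by positivity : 0 ≤ ‖c - b‖ * ‖w‖)]
    exact ((sq_eq_sq_iff_abs_eq_abs _ _).1 h2).symm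

/-- The integral over the edge of `t` opposite to `a`. -/
noncomputable def edgeIntegral (t : Finset Plane) (a : Plane) (f : Plane → ℝ) : ℝ :=
  ∫ x in hull (oppositeEdge t a), f x ∂(Measure.hausdorffMeasure 1)

/-- The divergence theorem in the direction of an edge vector. -/
theorem divergence_theorem_dir {a b c : Plane} (hab : a ≠ b) (hac : a ≠ c) (hbc : b ≠ c)
    (ht : IsTriangle {a, b, c}) (P : Poly) :
    triangleIntegral {a, b, c} (fun x => ∑ i, (a - c) i * (gradient P i).val x) =
      ∑ v ∈ {a, b, c}, edgeIntegral {a, b, c} v P.val *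
        inner ℝ (outerNormal {a, b, c} v) (a - c) := by
  rw [triangleIntegral_dirDeriv hab hac hbc ht]
  have hb : ({a, b, c} : Finset Plane) = {b, c, a} := by
    ext x; simp only [Finset.mem_insert, Finset.mem_singleton]; tauto
  have hc : ({a, b, c} : Finset Plane) = {c, a, b} := by
    ext x; simp only [Finset.mem_insert, Finset.mem_singleton]; tauto
  have ha := outerNormal_spec hab hac hbc ht
  have hb' := outerNormal_spec hbc hab.symm hac.symm (hb ▸ ht)
  have hc' := outerNormal_spec hac.symm hbc.symm hab (hc ▸ ht)
  rw [← hb] at hb'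
  rw [← hc] at hc'
  rw [Finset.sum_insert (by simp [hab, hac]), Finset.sum_insert (by simp [hbc]),
    Finset.sum_singleton, hb'.2.1, mul_zero, zero_add]
  have ea : edgeIntegral {a, b, c} a P.val =
      dist b c * ∫ r in (0 : ℝ)..1, P.val (AffineMap.lineMap c b r) := by
    rw [edgeIntegral, oppositeEdge_eq hab hac, Finset.pair_comm, integral_hull_pair hbc.symm,
      dist_comm]
  have ec : edgeIntegral {a, b, c} c P.val =
      dist a b * ∫ r in (0 : ℝ)..1, P.val (AffineMap.lineMap a b r) := by
    rw [edgeIntegral, hc, oppositeEdge_eq hac.symm hbc.symm, integral_hull_pair hab]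
  have hcr : |cross (b - a) (c - a)| = |cross (a - c) (b - c)| := by
    congr 1
    simp only [cross, PiLp.sub_apply]
    ring
  have hna : inner ℝ (outerNormal {a, b, c} a) (a - c) =
      -inner ℝ (outerNormal {a, b, c} a) (b - a) := by
    have : a - c = -(b - a) - (c - b) := by abel
    rw [this, inner_sub_right, ha.2.1, inner_neg_right, sub_zero]
  rw [ea, ec, hna, mul_sub]
  conv_lhs => rw [← hc'.2.2]
  rw [hc'.2.2, ← hcr, ← ha.2.2]
  linear_combination (∫ r in (0 : ℝ)..1, P.val (AffineMap.lineMap a b r)) * (ha.2.2 + hcr - hc'.2.2)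

/-- The divergence theorem on a triangle, for the partial derivatives of a polynomial. -/
theorem divergence_theorem {t : Finset Plane} (ht : IsTriangle t) (P : Poly) (i : Fin 2) :
    triangleIntegral t (gradient P i).val =
      ∑ v ∈ t, edgeIntegral t v P.val * outerNormal t v i := by
  obtain ⟨c, hc⟩ : t.Nonempty := Finset.card_pos.1 (by rw [ht.card_eq]; norm_num)
  obtain ⟨a, b, hca, hcb, hab, rfl⟩ := ht.exists_eq hc
  -- The identity is linear in the direction, and two edge vectors span the plane.
  have h1 : ({c, a, b} : Finset Plane) = {a, b, c} := by
    ext x; simp only [Finset.mem_insert, Finset.mem_singleton]; tauto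
  have h2 : ({c, a, b} : Finset Plane) = {b, a, c} := by
    ext x; simp only [Finset.mem_insert, Finset.mem_singleton]; tauto
  have d1 := divergence_theorem_dir hab hca.symm hcb.symm (h1 ▸ ht) P
  have d2 := divergence_theorem_dir hab.symm hcb.symm hca.symm (h2 ▸ ht) P
  rw [← h1] at d1
  rw [← h2] at d2
  have hcr := cross_ne_zero hab hca.symm hcb.symm (h1 ▸ ht)
  set t : Finset Plane := {c, a, b}
  have hlin : ∀ d : Plane, triangleIntegral t (fun x => ∑ i, d i * (gradient P i).val x) =
      d 0 * triangleIntegral t (gradient P 0).val + d 1 * triangleIntegral t (gradient P 1).val := by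
    intro d
    simp only [triangleIntegral, Fin.sum_univ_two]
    rw [integral_add, integral_const_mul, integral_const_mul]
    · exact (integrableOn_hull (Poly.continuous_val _)).const_mul _
    · exact (integrableOn_hull (Poly.continuous_val _)).const_mul _
  have hlin' : ∀ d : Plane, ∑ v ∈ t, edgeIntegral t v P.val * inner ℝ (outerNormal t v) d =
      d 0 * (∑ v ∈ t, edgeIntegral t v P.val * outerNormal t v 0) +
      d 1 * (∑ v ∈ t, edgeIntegral t v P.val * outerNormal t v 1) := by
    intro d
    rw [Finset.mul_sum, Finset.mul_sum, ← Finset.sum_add_distrib]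
    refine Finset.sum_congr rfl fun v _ => ?_
    rw [inner_eq]
    ring
  rw [hlin, hlin'] at d1 d2
  rw [cross] at hcr
  generalize h0 : (∑ v ∈ t, edgeIntegral t v P.val * outerNormal t v 0) = Y0 at *
  generalize h1 : (∑ v ∈ t, edgeIntegral t v P.val * outerNormal t v 1) = Y1 at *
  generalize hX0 : triangleIntegral t (gradient P 0).val = X0 at *
  generalize hX1 : triangleIntegral t (gradient P 1).val = X1 at *
  have e0 : X0 = Y0 := mul_left_cancel₀ hcr (by linear_combination (b - c) 1 * d1 - (a - c) 1 * d2)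
  have e1 : X1 = Y1 := mul_left_cancel₀ hcr (by linear_combination (a - c) 0 * d2 - (b - c) 0 * d1)
  fin_cases i
  · exact hX0.trans (e0.trans h0.symm)
  · exact hX1.trans (e1.trans h1.symm)

/-! ### Linearity of the integrals -/

theorem IsTriangle.oppositeEdge_eq_pair {t : Finset Plane} (ht : IsTriangle t) {a : Plane}
    (ha : a ∈ t) : ∃ b c, b ≠ c ∧ b ∈ t ∧ c ∈ t ∧ oppositeEdge t a = {b, c} := by
  obtain ⟨b, c, hab, hac, hbc, rfl⟩ := ht.exists_eq ha
  exact ⟨b, c, hbc, by simp, by simp, oppositeEdge_eq hab hac⟩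

theorem IsTriangle.nonempty {t : Finset Plane} (ht : IsTriangle t) : t.Nonempty :=
  Finset.card_pos.1 (by rw [ht.card_eq]; norm_num)

theorem oppositeEdge_subset (t : Finset Plane) (a : Plane) : oppositeEdge t a ⊆ t := by
  classical
  rw [oppositeEdge]
  convert Finset.erase_subset a t

/-- The functions `F a` are continuous on the edges opposite to the vertices `a` of `t`. -/
def EdgeContinuous (t : Finset Plane) (F : Plane → Plane → ℝ) : Prop :=
  ∀ a ∈ t, ContinuousOn (F a) (hull (oppositeEdge t a))

section integrals

variable {t : Finset Plane} (ht : IsTriangle t)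

include ht in
theorem integrableOn_edge {a : Plane} (ha : a ∈ t) {f : Plane → ℝ}
    (hf : ContinuousOn f (hull (oppositeEdge t a))) :
    IntegrableOn f (hull (oppositeEdge t a)) (Measure.hausdorffMeasure 1) := by
  obtain ⟨b, c, _, _, _, h⟩ := ht.oppositeEdge_eq_pair ha
  rw [h] at hf ⊢
  exact integrableOn_hull_pair hf

theorem measurableSet_hull (s : Finset Plane) : MeasurableSet (hull s) :=
  (isCompact_hull s).isClosed.measurableSet

theorem EdgeContinuous.add {F G : Plane → Plane → ℝ} (hF : EdgeContinuous t F)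
    (hG : EdgeContinuous t G) : EdgeContinuous t (fun a x => F a x + G a x) :=
  fun a ha => (hF a ha).add (hG a ha)

theorem EdgeContinuous.sub {F G : Plane → Plane → ℝ} (hF : EdgeContinuous t F)
    (hG : EdgeContinuous t G) : EdgeContinuous t (fun a x => F a x - G a x) :=
  fun a ha => (hF a ha).sub (hG a ha)

theorem EdgeContinuous.mul {F G : Plane → Plane → ℝ} (hF : EdgeContinuous t F)
    (hG : EdgeContinuous t G) : EdgeContinuous t (fun a x => F a x * G a x) :=
  fun a ha => (hF a ha).mul (hG a ha)

theorem edgeContinuous_const (k : ℝ) : EdgeContinuous t (fun _ _ => k) :=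
  fun _ _ => continuousOn_const

theorem edgeContinuous_val (P : Poly) : EdgeContinuous t (fun _ x => P.val x) :=
  fun _ _ => P.continuous_val.continuousOn

include ht in
theorem boundaryIntegral_add {F G : Plane → Plane → ℝ} (hF : EdgeContinuous t F)
    (hG : EdgeContinuous t G) :
    boundaryIntegral t (fun a x => F a x + G a x) =
      boundaryIntegral t F + boundaryIntegral t G := by
  rw [boundaryIntegral, boundaryIntegral, boundaryIntegral, ← Finset.sum_add_distrib]
  exact Finset.sum_congr rfl fun a ha =>
    integral_add (integrableOn_edge ht ha (hF a ha)) (integrableOn_edge ht ha (hG a ha))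

include ht in
theorem boundaryIntegral_sub {F G : Plane → Plane → ℝ} (hF : EdgeContinuous t F)
    (hG : EdgeContinuous t G) :
    boundaryIntegral t (fun a x => F a x - G a x) =
      boundaryIntegral t F - boundaryIntegral t G := by
  rw [boundaryIntegral, boundaryIntegral, boundaryIntegral, ← Finset.sum_sub_distrib]
  exact Finset.sum_congr rfl fun a ha =>
    integral_sub (integrableOn_edge ht ha (hF a ha)) (integrableOn_edge ht ha (hG a ha))

theorem boundaryIntegral_const_mul (k : ℝ) (F : Plane → Plane → ℝ) :
    boundaryIntegral t (fun a x => k * F a x) = k * boundaryIntegral t F := by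
  rw [boundaryIntegral, boundaryIntegral, Finset.mul_sum]
  exact Finset.sum_congr rfl fun a _ => integral_const_mul _ _

theorem boundaryIntegral_congr {F G : Plane → Plane → ℝ}
    (h : ∀ a ∈ t, ∀ x ∈ hull (oppositeEdge t a), F a x = G a x) :
    boundaryIntegral t F = boundaryIntegral t G :=
  Finset.sum_congr rfl fun a ha => setIntegral_congr_fun (measurableSet_hull _) (h a ha)

include ht in
theorem boundaryIntegral_mono {F G : Plane → Plane → ℝ} (hF : EdgeContinuous t F)
    (hG : EdgeContinuous t G) (h : ∀ a ∈ t, ∀ x ∈ hull (oppositeEdge t a), F a x ≤ G a x) :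
    boundaryIntegral t F ≤ boundaryIntegral t G :=
  Finset.sum_le_sum fun a ha => setIntegral_mono_on (integrableOn_edge ht ha (hF a ha))
    (integrableOn_edge ht ha (hG a ha)) (measurableSet_hull _) (h a ha)

theorem boundaryIntegral_nonneg {F : Plane → Plane → ℝ} (h : ∀ a x, 0 ≤ F a x) :
    0 ≤ boundaryIntegral t F :=
  Finset.sum_nonneg fun a _ => integral_nonneg (h a)

theorem triangleIntegral_add {f g : Plane → ℝ} (hf : Continuous f) (hg : Continuous g) :
    triangleIntegral t (fun x => f x + g x) = triangleIntegral t f + triangleIntegral t g :=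
  integral_add (integrableOn_hull hf) (integrableOn_hull hg)

theorem triangleIntegral_sub {f g : Plane → ℝ} (hf : Continuous f) (hg : Continuous g) :
    triangleIntegral t (fun x => f x - g x) = triangleIntegral t f - triangleIntegral t g :=
  integral_sub (integrableOn_hull hf) (integrableOn_hull hg)

theorem triangleIntegral_const_mul (k : ℝ) (f : Plane → ℝ) :
    triangleIntegral t (fun x => k * f x) = k * triangleIntegral t f :=
  integral_const_mul _ _

theorem triangleIntegral_mono {f g : Plane → ℝ} (hf : Continuous f) (hg : Continuous g)
    (h : ∀ x ∈ hull t, f x ≤ g x) : triangleIntegral t f ≤ triangleIntegral t g :=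
  setIntegral_mono_on (integrableOn_hull hf) (integrableOn_hull hg) (measurableSet_hull _) h

theorem triangleIntegral_nonneg {f : Plane → ℝ} (h : ∀ x, 0 ≤ f x) : 0 ≤ triangleIntegral t f :=
  integral_nonneg h

end integrals

/-! ### Polynomial vector fields -/

theorem val_dot (q r : Fin 2 → Poly) (x : Plane) :
    (dot q r).val x = ∑ i, (q i).val x * (r i).val x := by
  simp [dot]

/-- The normal component of a polynomial vector field as a polynomial. -/
noncomputable def normalPoly (q : Fin 2 → Poly) (n : Plane) : Poly := ∑ i, n i • q i

theorem val_normalPoly (q : Fin 2 → Poly) (n x : Plane) :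
    (normalPoly q n).val x = normalComponent q n x := by
  simp [normalPoly, normalComponent, mul_comm]

theorem pderiv_mem {p : ℕ} {P : Poly} (hP : P ∈ PolyDeg p) (i : Fin 2) :
    MvPolynomial.pderiv i P ∈ PolyDeg p := by
  rw [← MvPolynomial.support_sum_monomial_coeff P, map_sum]
  refine Submodule.sum_mem _ fun d hd => ?_
  rw [MvPolynomial.pderiv_monomial, mem_polyDeg]
  refine (MvPolynomial.totalDegree_monomial_le _ _).trans
    (le_trans ?_ ((MvPolynomial.le_totalDegree hd).trans (mem_polyDeg.1 hP)))
  change (Finsupp.sum _ fun _ e => e) ≤ _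
  have hsum : ∀ n : Fin 2 →₀ ℕ, (n.sum fun _ e => e) = n 0 + n 1 := fun n => by
    rw [Finsupp.sum_fintype _ _ (fun _ => rfl), Fin.sum_univ_two]
  simp only [hsum, Finsupp.coe_tsub, Pi.sub_apply]
  omega

theorem gradient_mem {p : ℕ} {P : Poly} (hP : P ∈ PolyDeg p) (i : Fin 2) :
    gradient P i ∈ PolyDeg p := pderiv_mem hP i

theorem edgeContinuous_normalComponent (t : Finset Plane) (q : Fin 2 → Poly) :
    EdgeContinuous t (fun a x => normalComponent q (outerNormal t a) x) := fun a _ => by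
  simp only [← val_normalPoly]
  exact (Poly.continuous_val _).continuousOn

/-- Integration by parts on a triangle. -/
theorem integral_by_parts {t : Finset Plane} (ht : IsTriangle t) (U : Poly) (r : Fin 2 → Poly) :
    triangleIntegral t (fun x => U.val x * (divergence r).val x) +
      triangleIntegral t (dot (gradient U) r).val =
      boundaryIntegral t (fun a x => U.val x * normalComponent r (outerNormal t a) x) := by
  have h0 := divergence_theorem ht (U * r 0) 0
  have h1 := divergence_theorem ht (U * r 1) 1
  have hc : ∀ P : Poly, Continuous P.val := Poly.continuous_val
  have hR : boundaryIntegral t (fun a x => U.val x * normalComponent r (outerNormal t a) x) =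
      ∑ v ∈ t, edgeIntegral t v (U * r 0).val * outerNormal t v 0 +
      ∑ v ∈ t, edgeIntegral t v (U * r 1).val * outerNormal t v 1 := by
    rw [boundaryIntegral, ← Finset.sum_add_distrib]
    refine Finset.sum_congr rfl fun v hv => ?_
    rw [edgeIntegral, edgeIntegral, ← integral_mul_const, ← integral_mul_const, ← integral_add]
    · refine integral_congr_ae (Filter.Eventually.of_forall fun x => ?_)
      simp only [normalComponent, Fin.sum_univ_two, Poly.val_mul]
      ring
    · exact (integrableOn_edge ht hv (hc _).continuousOn).mul_const _
    · exact (integrableOn_edge ht hv (hc _).continuousOn).mul_const _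
  rw [hR, ← h0, ← h1,
    ← triangleIntegral_add (f := fun x => U.val x * (divergence r).val x)
      ((hc U).mul (hc _)) (hc _), ← triangleIntegral_add (hc _) (hc _)]
  congr 1
  funext x
  simp only [divergence, dot, gradient, Fin.sum_univ_two, Poly.val_add, Poly.val_mul,
    Derivation.leibniz, smul_eq_mul]
  ring

/-! ### The energy of a local solution -/

/-- The contribution of the triangle `t` to the energy. -/
noncomputable def localEnergy (τ : ℝ) (t : Finset Plane) (m : SkeletonFun) (Q : Fin 2 → Poly)
    (U : Poly) : ℝ :=
  triangleIntegral t (dot Q Q).val +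
    τ * boundaryIntegral t (fun a x =>
      (U.val x - m (oppositeEdge t a) x) * (U.val x - m (oppositeEdge t a) x))

section solution

variable {p : ℕ} {τ : ℝ} {t : Finset Plane} (ht : IsTriangle t) {m : SkeletonFun}
  (hm : EdgeContinuous t fun a x => m (oppositeEdge t a) x) {Q : Fin 2 → Poly} {U : Poly}

theorem dot_self_nonneg (Q : Fin 2 → Poly) (x : Plane) : 0 ≤ (dot Q Q).val x := by
  rw [val_dot]; exact Finset.sum_nonneg fun i _ => mul_self_nonneg _

theorem triangleIntegral_dot_self_nonneg (t : Finset Plane) (Q : Fin 2 → Poly) :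
    0 ≤ triangleIntegral t (dot Q Q).val := triangleIntegral_nonneg (dot_self_nonneg Q)

theorem jump_nonneg (t : Finset Plane) (m : SkeletonFun) (U : Poly) :
    0 ≤ boundaryIntegral t (fun a x =>
      (U.val x - m (oppositeEdge t a) x) * (U.val x - m (oppositeEdge t a) x)) :=
  boundaryIntegral_nonneg fun _ _ => mul_self_nonneg _

theorem flux_le_localEnergy (hτ : 0 ≤ τ) :
    triangleIntegral t (dot Q Q).val ≤ localEnergy τ t m Q U :=
  le_add_of_nonneg_right (mul_nonneg hτ (jump_nonneg _ _ _))

theorem jump_le_localEnergy :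
    τ * boundaryIntegral t (fun a x =>
      (U.val x - m (oppositeEdge t a) x) * (U.val x - m (oppositeEdge t a) x)) ≤
      localEnergy τ t m Q U :=
  le_add_of_nonneg_left (triangleIntegral_dot_self_nonneg _ _)

theorem localEnergy_nonneg (hτ : 0 ≤ τ) : 0 ≤ localEnergy τ t m Q U :=
  (triangleIntegral_dot_self_nonneg _ _).trans (flux_le_localEnergy hτ)

include ht hm in
/-- The first local equation after integration by parts. -/
theorem IsLocalSolution.flux_eq (h : IsLocalSolution p τ t m Q U) {r : Fin 2 → Poly}
    (hr : ∀ i, r i ∈ PolyDeg p) :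
    triangleIntegral t (dot Q r).val + triangleIntegral t (dot (gradient U) r).val =
      boundaryIntegral t (fun a x => (U.val x - m (oppositeEdge t a) x) *
        normalComponent r (outerNormal t a) x) := by
  have h1 := h.2.2.1 r hr
  have h2 := integral_by_parts ht U r
  have hn := edgeContinuous_normalComponent t r
  have h3 : boundaryIntegral t (fun a x => (U.val x - m (oppositeEdge t a) x) *
        normalComponent r (outerNormal t a) x) =
      boundaryIntegral t (fun a x => U.val x * normalComponent r (outerNormal t a) x) -
      boundaryIntegral t (fun a x => m (oppositeEdge t a) x *
        normalComponent r (outerNormal t a) x) := by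
    rw [← boundaryIntegral_sub ht ((edgeContinuous_val U).mul hn) (hm.mul hn)]
    simp only [sub_mul]
  rw [h3, ← h2]
  change triangleIntegral t (dot Q r).val - _ = _ at h1
  linarith

theorem triangleIntegral_dot_comm (t : Finset Plane) (q r : Fin 2 → Poly) :
    triangleIntegral t (dot q r).val = triangleIntegral t (dot r q).val := by
  have : dot q r = dot r q := Finset.sum_congr rfl fun i _ => mul_comm _ _
  rw [this]

include ht hm in
/-- If the data are the boundary values of a polynomial `v`, then the energy of the local solution
is `-(Q, ∇ v)`: test the first equation with `Q` and the second one with `U - v`. -/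
theorem IsLocalSolution.energy_eq (h : IsLocalSolution p τ t m Q U) {v : Poly} (hv : v ∈ PolyDeg p)
    (hmv : ∀ a ∈ t, ∀ x ∈ hull (oppositeEdge t a), m (oppositeEdge t a) x = v.val x) :
    localEnergy τ t m Q U = -triangleIntegral t (dot Q (gradient v)).val := by
  have h1 := h.flux_eq ht hm h.1
  have h2 := h.2.2.2 (U - v) (Submodule.sub_mem _ h.2.1 hv)
  have hc : ∀ P : Poly, Continuous P.val := Poly.continuous_val
  have hn := edgeContinuous_normalComponent t Q
  have hj : EdgeContinuous t (fun a x => U.val x - m (oppositeEdge t a) x) :=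
    (edgeContinuous_val U).sub hm
  have h3 : triangleIntegral t (fun x => (dot Q (gradient (U - v))).val x) =
      triangleIntegral t (dot (gradient U) Q).val - triangleIntegral t (dot Q (gradient v)).val := by
    rw [triangleIntegral_dot_comm t (gradient U), ← triangleIntegral_sub (hc _) (hc _)]
    congr 1
    funext x
    simp only [val_dot, gradient, map_sub, Poly.val_sub, Fin.sum_univ_two]
    ring
  have h4 : boundaryIntegral t (fun a x => (normalComponent Q (outerNormal t a) x +
        τ * (U.val x - m (oppositeEdge t a) x)) * (U - v).val x) =
      boundaryIntegral t (fun a x => (U.val x - m (oppositeEdge t a) x) *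
        normalComponent Q (outerNormal t a) x) +
      τ * boundaryIntegral t (fun a x =>
        (U.val x - m (oppositeEdge t a) x) * (U.val x - m (oppositeEdge t a) x)) := by
    rw [← boundaryIntegral_const_mul, ← boundaryIntegral_add ht (hj.mul hn)
      ((edgeContinuous_const τ).mul (hj.mul hj))]
    refine boundaryIntegral_congr fun a ha x hx => ?_
    rw [Poly.val_sub, ← hmv a ha x hx]
    ring
  rw [h3, h4] at h2
  rw [localEnergy]
  linarith

include ht hm in
/-- The energy of the boundary values of a polynomial is at most its Dirichlet energy. -/
theorem IsLocalSolution.energy_le (hτ : 0 ≤ τ) (h : IsLocalSolution p τ t m Q U) {v : Poly}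
    (hv : v ∈ PolyDeg p)
    (hmv : ∀ a ∈ t, ∀ x ∈ hull (oppositeEdge t a), m (oppositeEdge t a) x = v.val x) :
    localEnergy τ t m Q U ≤ triangleIntegral t (dot (gradient v) (gradient v)).val := by
  have hc : ∀ P : Poly, Continuous P.val := Poly.continuous_val
  have h1 := h.energy_eq ht hm hv hmv
  have h2 : -triangleIntegral t (dot Q (gradient v)).val ≤
      1 / 2 * triangleIntegral t (dot Q Q).val +
      1 / 2 * triangleIntegral t (dot (gradient v) (gradient v)).val := by
    rw [← neg_one_mul, ← triangleIntegral_const_mul, ← triangleIntegral_const_mul,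
      ← triangleIntegral_const_mul, ← triangleIntegral_add ((hc _).const_mul _) ((hc _).const_mul _)]
    refine triangleIntegral_mono ((hc _).const_mul _)
      (((hc _).const_mul _).add ((hc _).const_mul _)) fun x _ => ?_
    simp only [val_dot, Fin.sum_univ_two]
    nlinarith [sq_nonneg ((Q 0).val x + (gradient v 0).val x),
      sq_nonneg ((Q 1).val x + (gradient v 1).val x)]
  have h3 := flux_le_localEnergy (t := t) (m := m) (Q := Q) (U := U) hτ
  linarith

include ht hm in
/-- The flux equation, tested with the gradient of `U`. -/
theorem IsLocalSolution.gradient_eq (h : IsLocalSolution p τ t m Q U) :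
    triangleIntegral t (dot (gradient U) (gradient U)).val =
      boundaryIntegral t (fun a x => (U.val x - m (oppositeEdge t a) x) *
        normalComponent (gradient U) (outerNormal t a) x) -
      triangleIntegral t (dot Q (gradient U)).val := by
  have := h.flux_eq ht hm (gradient_mem h.2.1)
  linarith

end solution

/-! ### Solvability of the local problem -/

section solvability

variable {p : ℕ} {t : Finset Plane} (ht : IsTriangle t)

include ht in
theorem eq_zero_of_hull (hp : p ≠ 0) {P : Poly} (hP : P ∈ PolyDeg p)
    (h : ∀ x ∈ hull t, P.val x = 0) : P = 0 :=
  eq_of_node_eq hp ht hP (Submodule.zero_mem _) fun α hα => by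
    rw [Poly.val_zero]
    exact h _ (node_mem_hull hp (Finset.mem_piAntidiag.1 hα).1)

include ht in
theorem hull_subset_closure_interior : hull t ⊆ closure (interior (hull t)) := by
  have hne : (interior (hull t)).Nonempty := by
    rw [hull, interior_convexHull_nonempty_iff_affineSpan_eq_top, ← range_basis ht]
    exact ht.basis.tot
  rw [(convex_convexHull ℝ _).closure_interior_eq_closure_of_nonempty_interior hne]
  exact subset_closure

include ht in
theorem eq_zero_of_triangleIntegral_eq_zero {f : Plane → ℝ} (hf : Continuous f)
    (h0 : ∀ x, 0 ≤ f x) (h : triangleIntegral t f = 0) {x : Plane} (hx : x ∈ hull t) :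
    f x = 0 := by
  have h1 := (integral_eq_zero_iff_of_nonneg h0 (integrableOn_hull hf)).1 h
  have h2 : f =ᵐ[volume.restrict (interior (hull t))] 0 := ae_restrict_of_ae_restrict_of_subset interior_subset h1
  have h3 := Measure.eqOn_open_of_ae_eq h2 isOpen_interior hf.continuousOn continuousOn_const
  exact h3.of_subset_closure hf.continuousOn continuousOn_const interior_subset
    (hull_subset_closure_interior ht) hx

include ht in
theorem dot_self_eq_zero (hp : p ≠ 0) {Q : Fin 2 → Poly} (hQ : ∀ i, Q i ∈ PolyDeg p)
    (h : triangleIntegral t (dot Q Q).val = 0) : Q = 0 := by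
  funext i
  refine eq_zero_of_hull ht hp (hQ i) fun x hx => ?_
  have h1 := eq_zero_of_triangleIntegral_eq_zero ht (Poly.continuous_val _) (dot_self_nonneg Q) h hx
  rw [val_dot, Fin.sum_univ_two] at h1
  have h2 := mul_self_nonneg ((Q 0).val x)
  have h3 := mul_self_nonneg ((Q 1).val x)
  have h4 : (Q 0).val x * (Q 0).val x = 0 := by linarith
  have h5 : (Q 1).val x * (Q 1).val x = 0 := by linarith
  fin_cases i
  · exact mul_self_eq_zero.1 h4
  · exact mul_self_eq_zero.1 h5

theorem val_eq_of_gradient_eq_zero {U : Poly} (h : gradient U = 0) (x : Plane) :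
    U.val x = U.val 0 := by
  have hd : ∀ s : ℝ, HasDerivAt (fun s : ℝ => U.val (0 + s • x)) 0 s := fun s => by
    simpa [h] using hasDerivAt_val U 0 x s
  have := is_const_of_deriv_eq_zero (fun s => (hd s).differentiableAt) (fun s => (hd s).deriv) 1 0
  simpa using this

/-- The homogeneous local problem has only the trivial solution. -/
theorem IsLocalSolution.eq_zero (ht : IsTriangle t) (hp : p ≠ 0) {τ : ℝ} (hτ : 0 < τ)
    {Q : Fin 2 → Poly} {U : Poly} (h : IsLocalSolution p τ t (fun _ _ => 0) Q U) :
    Q = 0 ∧ U = 0 := by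
  have hm : EdgeContinuous t fun a x => (fun _ _ => 0 : SkeletonFun) (oppositeEdge t a) x :=
    edgeContinuous_const 0
  have he := h.energy_eq ht hm (Submodule.zero_mem _) (fun a _ x _ => (Poly.val_zero x).symm)
  have he0 : localEnergy τ t (fun _ _ => 0) Q U = 0 := by
    rw [he]
    simp [gradient, dot, triangleIntegral]
  have hQ0 := flux_le_localEnergy (t := t) (m := fun _ _ => 0) (Q := Q) (U := U) hτ.le
  have hJ0 := jump_le_localEnergy (τ := τ) (t := t) (m := fun _ _ => 0) (Q := Q) (U := U)
  rw [he0] at hQ0 hJ0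
  have hQ : Q = 0 :=
    dot_self_eq_zero ht hp h.1 (le_antisymm hQ0 (triangleIntegral_dot_self_nonneg _ _))
  simp only [sub_zero] at hJ0
  have hJ : ∀ a ∈ t, ∫ x in hull (oppositeEdge t a), U.val x * U.val x
      ∂(Measure.hausdorffMeasure 1) = 0 := by
    have hnn : ∀ a ∈ t, 0 ≤ ∫ x in hull (oppositeEdge t a), U.val x * U.val x
      ∂(Measure.hausdorffMeasure 1) := fun a _ => integral_nonneg fun x => mul_self_nonneg _
    have hsum : boundaryIntegral t (fun _ x => U.val x * U.val x) = 0 := by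
      refine le_antisymm ?_ (boundaryIntegral_nonneg fun _ _ => mul_self_nonneg _)
      by_contra! hpos
      exact absurd hJ0 (not_le.2 (mul_pos hτ hpos))
    exact (Finset.sum_eq_zero_iff_of_nonneg hnn).1 hsum
  refine ⟨hQ, ?_⟩
  have hg := h.gradient_eq ht hm
  have hB : boundaryIntegral t (fun a x => (U.val x - (fun _ _ => 0 : SkeletonFun)
      (oppositeEdge t a) x) * normalComponent (gradient U) (outerNormal t a) x) = 0 := by
    refine Finset.sum_eq_zero fun a ha => integral_eq_zero_of_ae ?_
    have h0 := (integral_eq_zero_iff_of_nonneg (fun x => mul_self_nonneg (U.val x))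
      (integrableOn_edge ht ha (U.continuous_val.mul U.continuous_val).continuousOn)).1 (hJ a ha)
    filter_upwards [h0] with x hx
    rw [sub_zero, mul_self_eq_zero.1 hx, zero_mul]
    rfl
  rw [hB, hQ] at hg
  have hg0 : gradient U = 0 := by
    refine dot_self_eq_zero ht hp (gradient_mem h.2.1) ?_
    rw [hg]
    simp [dot, triangleIntegral]
  have hconst := val_eq_of_gradient_eq_zero hg0
  obtain ⟨a, ha⟩ := ht.nonempty
  obtain ⟨b, c, hbc, _, _, hopp⟩ := ht.oppositeEdge_eq_pair ha
  have h1 := hJ a ha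
  rw [hopp, integral_hull_pair hbc] at h1
  simp only [hconst _, intervalIntegral.integral_const, sub_zero, one_smul] at h1
  have h2 : U.val 0 = 0 :=
    mul_self_eq_zero.1 ((mul_eq_zero.1 h1).resolve_left (dist_pos.2 hbc).ne')
  exact eq_zero_of_hull ht hp h.2.1 fun x _ => by rw [hconst, h2]

/-- The integral over a triangle as a linear functional on polynomials. -/
noncomputable def triangleFunctional (t : Finset Plane) : Poly →ₗ[ℝ] ℝ where
  toFun P := triangleIntegral t P.val
  map_add' P Q := by
    rw [← triangleIntegral_add P.continuous_val Q.continuous_val]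
    simp only [← Poly.val_add]
  map_smul' k P := by
    rw [RingHom.id_apply, smul_eq_mul, ← triangleIntegral_const_mul]
    simp only [← Poly.val_smul]

theorem normalComponent_add (q r : Fin 2 → Poly) (n x : Plane) :
    normalComponent (q + r) n x = normalComponent q n x + normalComponent r n x := by
  simp only [normalComponent, Pi.add_apply, Poly.val_add, add_mul, Finset.sum_add_distrib]

theorem normalComponent_smul (k : ℝ) (q : Fin 2 → Poly) (n x : Plane) :
    normalComponent (k • q) n x = k * normalComponent q n x := by
  simp only [normalComponent, Pi.smul_apply, Poly.val_smul, mul_assoc, Finset.mul_sum]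

/-- The boundary term of the second local equation, as a linear map in the unknowns with values in
the functionals of the test polynomial. -/
noncomputable def boundaryForm (ht : IsTriangle t) (τ : ℝ) :
    ((Fin 2 → Poly) × Poly) →ₗ[ℝ] Poly →ₗ[ℝ] ℝ :=
  have hc : ∀ (s : (Fin 2 → Poly) × Poly) (w : Poly), EdgeContinuous t (fun a x =>
      (normalComponent s.1 (outerNormal t a) x + τ * s.2.val x) * w.val x) := fun s w =>
    ((edgeContinuous_normalComponent t s.1).add
      ((edgeContinuous_const τ).mul (edgeContinuous_val s.2))).mul (edgeContinuous_val w)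
  LinearMap.mk₂ ℝ (fun s w => boundaryIntegral t (fun a x =>
      (normalComponent s.1 (outerNormal t a) x + τ * s.2.val x) * w.val x))
    (fun s s' w => by
      rw [← boundaryIntegral_add ht (hc s w) (hc s' w)]
      congr 1
      funext a x
      simp only [Prod.fst_add, Prod.snd_add, normalComponent_add, Poly.val_add]
      ring)
    (fun k s w => by
      rw [smul_eq_mul, ← boundaryIntegral_const_mul]
      congr 1
      funext a x
      simp only [Prod.smul_fst, Prod.smul_snd, normalComponent_smul, Poly.val_smul]
      ring)
    (fun s w w' => by
      rw [← boundaryIntegral_add ht (hc s w) (hc s w')]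
      congr 1
      funext a x
      simp only [Poly.val_add]
      ring)
    (fun k s w => by
      rw [smul_eq_mul, ← boundaryIntegral_const_mul]
      congr 1
      funext a x
      simp only [Poly.val_smul]
      ring)

/-- The bilinear form of the local problem: the sum of the left-hand sides of both equations. -/
noncomputable def localForm (ht : IsTriangle t) (τ : ℝ) :
    ((Fin 2 → Poly) × Poly) →ₗ[ℝ] ((Fin 2 → Poly) × Poly) →ₗ[ℝ] ℝ :=
  LinearMap.mk₂ ℝ (fun s w => triangleFunctional t (dot s.1 w.1) -
      triangleFunctional t (s.2 * divergence w.1) -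
      triangleFunctional t (dot s.1 (gradient w.2)) + boundaryForm ht τ s w.2)
    (fun s s' w => by
      simp only [dot, divergence, gradient, Prod.fst_add, Prod.snd_add, Pi.add_apply, map_add,
        LinearMap.add_apply, add_mul, Fin.sum_univ_two]
      ring)
    (fun k s w => by
      simp only [dot, divergence, gradient, Prod.smul_fst, Prod.smul_snd, Pi.smul_apply, map_smul,
        map_add, LinearMap.smul_apply, smul_mul_assoc, Fin.sum_univ_two, smul_eq_mul]
      ring)
    (fun s w w' => by
      simp only [dot, divergence, gradient, Prod.fst_add, Prod.snd_add, Pi.add_apply, map_add,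
        mul_add, Fin.sum_univ_two]
      ring)
    (fun k s w => by
      simp only [dot, divergence, gradient, Prod.smul_fst, Prod.smul_snd, Pi.smul_apply, map_smul,
        Derivation.map_smul, map_add, mul_smul_comm, mul_add, Fin.sum_univ_two, smul_eq_mul]
      ring)

/-- The right-hand side of the local problem as a functional of the test functions. -/
noncomputable def localData (ht : IsTriangle t) (τ : ℝ) {m : SkeletonFun}
    (hm : EdgeContinuous t fun a x => m (oppositeEdge t a) x) :
    ((Fin 2 → Poly) × Poly) →ₗ[ℝ] ℝ :=
  have hc : ∀ w : (Fin 2 → Poly) × Poly, EdgeContinuous t (fun a x => m (oppositeEdge t a) x *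
      (τ * w.2.val x - normalComponent w.1 (outerNormal t a) x)) := fun w =>
    hm.mul (((edgeContinuous_const τ).mul (edgeContinuous_val w.2)).sub
      (edgeContinuous_normalComponent t w.1))
  { toFun := fun w => boundaryIntegral t (fun a x => m (oppositeEdge t a) x *
      (τ * w.2.val x - normalComponent w.1 (outerNormal t a) x))
    map_add' := fun w w' => by
      rw [← boundaryIntegral_add ht (hc w) (hc w')]
      congr 1
      funext a x
      simp only [Prod.fst_add, Prod.snd_add, normalComponent_add, Poly.val_add]
      ring
    map_smul' := fun k w => by
      rw [RingHom.id_apply, smul_eq_mul, ← boundaryIntegral_const_mul]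
      congr 1
      funext a x
      simp only [Prod.smul_fst, Prod.smul_snd, normalComponent_smul, Poly.val_smul]
      ring }

/-- The local problem is the variational problem of `localForm` and `localData`. -/
theorem isLocalSolution_of_form (ht : IsTriangle t) {τ : ℝ} {m : SkeletonFun}
    (hm : EdgeContinuous t fun a x => m (oppositeEdge t a) x)
    {Q : Fin 2 → Poly} {U : Poly} (hQ : ∀ i, Q i ∈ PolyDeg p) (hU : U ∈ PolyDeg p)
    (h : ∀ (r : Fin 2 → Poly) (w : Poly), (∀ i, r i ∈ PolyDeg p) → w ∈ PolyDeg p →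
      localForm ht τ (Q, U) (r, w) = localData ht τ hm (r, w)) :
    IsLocalSolution p τ t m Q U := by
  refine ⟨hQ, hU, fun r hr => ?_, fun w hw => ?_⟩
  · have h1 := h r 0 hr (Submodule.zero_mem _)
    have e1 : localForm ht τ (Q, U) (r, 0) = triangleIntegral t (fun x => (dot Q r).val x)
        - triangleIntegral t (fun x => U.val x * (divergence r).val x) := by
      have h0 : dot Q (gradient 0) = 0 := by simp [dot, gradient]
      have hU : (U * divergence r).val = fun x => U.val x * (divergence r).val x :=
        funext (Poly.val_mul _ _)
      change triangleIntegral t (dot Q r).val - triangleIntegral t (U * divergence r).val -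
        triangleFunctional t (dot Q (gradient 0)) + boundaryForm ht τ (Q, U) 0 = _
      rw [h0, map_zero, map_zero, sub_zero, add_zero, hU]
    have e2 : localData ht τ hm (r, 0) = -boundaryIntegral t
        (fun a x => m (oppositeEdge t a) x * normalComponent r (outerNormal t a) x) := by
      rw [← neg_one_mul, ← boundaryIntegral_const_mul]
      simp [localData]
    rw [← e1, h1, e2]
  · have h1 := h 0 w (fun _ => Submodule.zero_mem _) hw
    have hj : EdgeContinuous t (fun a x =>
        (normalComponent Q (outerNormal t a) x + τ * U.val x) * w.val x) :=
      ((edgeContinuous_normalComponent t Q).add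
        ((edgeContinuous_const τ).mul (edgeContinuous_val U))).mul (edgeContinuous_val w)
    have e1 : localForm ht τ (Q, U) (0, w) = -triangleIntegral t (fun x => (dot Q (gradient w)).val x)
        + boundaryIntegral t (fun a x =>
          (normalComponent Q (outerNormal t a) x + τ * U.val x) * w.val x) := by
      have h0 : dot Q 0 = 0 := by simp [dot]
      have h0' : U * divergence 0 = 0 := by simp [divergence]
      change triangleFunctional t (dot Q 0) - triangleFunctional t (U * divergence 0) -
        triangleIntegral t (dot Q (gradient w)).val + boundaryForm ht τ (Q, U) w = _
      rw [h0, h0', map_zero, sub_zero, zero_sub]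
      rfl
    have e2 : localData ht τ hm (0, w) = boundaryIntegral t
        (fun a x => τ * (m (oppositeEdge t a) x * w.val x)) := by
      simp [localData, normalComponent, mul_left_comm]
    have e3 : boundaryIntegral t (fun a x => (normalComponent Q (outerNormal t a) x
            + τ * (U.val x - m (oppositeEdge t a) x)) * w.val x) =
        boundaryIntegral t (fun a x =>
          (normalComponent Q (outerNormal t a) x + τ * U.val x) * w.val x) -
        boundaryIntegral t (fun a x => τ * (m (oppositeEdge t a) x * w.val x)) := by
      rw [← boundaryIntegral_sub ht hj
        ((edgeContinuous_const τ).mul (hm.mul (edgeContinuous_val w)))]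
      congr 1
      funext a x
      ring
    rw [e3, ← e2, ← h1, e1]
    ring

/-- The local problem is solvable, as a square linear system with trivial kernel. -/
theorem exists_isLocalSolution (ht : IsTriangle t) (hp : p ≠ 0) {τ : ℝ} (hτ : 0 < τ)
    {m : SkeletonFun} (hm : EdgeContinuous t fun a x => m (oppositeEdge t a) x) :
    ∃ Q U, IsLocalSolution p τ t m Q U := by
  let V := (Fin 2 → PolyDeg p) × PolyDeg p
  let ι : V →ₗ[ℝ] (Fin 2 → Poly) × Poly :=
    LinearMap.prodMap (LinearMap.pi fun i => (PolyDeg p).subtype ∘ₗ LinearMap.proj i)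
      (PolyDeg p).subtype
  let Φ : V →ₗ[ℝ] Module.Dual ℝ V := (localForm ht τ).compl₁₂ ι ι
  have hsol : ∀ {m : SkeletonFun} (hm : EdgeContinuous t fun a x => m (oppositeEdge t a) x) (s : V),
      Φ s = localData ht τ hm ∘ₗ ι → IsLocalSolution p τ t m (ι s).1 (ι s).2 := fun hm s hs => by
    refine isLocalSolution_of_form ht hm (fun i => (s.1 i).2) s.2.2 fun r w hr hw => ?_
    exact LinearMap.congr_fun hs (fun i => ⟨r i, hr i⟩, ⟨w, hw⟩)
  have hinj : Function.Injective Φ := by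
    refine (injective_iff_map_eq_zero Φ).2 fun s hs => ?_
    have h0 : localData ht τ (m := fun _ _ => 0) (edgeContinuous_const 0) = 0 := by
      ext <;> simp [localData, boundaryIntegral]
    have h1 := hsol (m := fun _ _ => 0) (edgeContinuous_const 0) s (by rw [hs, h0]; rfl)
    obtain ⟨hQ, hU⟩ := h1.eq_zero ht hp hτ
    refine Prod.ext (funext fun i => Subtype.ext ?_) (Subtype.ext hU)
    exact congrFun hQ i
  have hsurj := (LinearMap.injective_iff_surjective_of_finrank_eq_finrank
    (Subspace.dual_finrank_eq (K := ℝ) (V := V)).symm).1 hinj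
  obtain ⟨s, hs⟩ := hsurj (localData ht τ hm ∘ₗ ι)
  exact ⟨_, _, hsol hm s hs⟩

theorem localSolution_spec (ht : IsTriangle t) (hp : p ≠ 0) {τ : ℝ} (hτ : 0 < τ)
    {m : SkeletonFun} (hm : EdgeContinuous t fun a x => m (oppositeEdge t a) x) :
    IsLocalSolution p τ t m (localQ p τ t m) (localU p τ t m) := by
  obtain ⟨Q, U, h⟩ := exists_isLocalSolution ht hp hτ hm
  exact Classical.epsilon_spec (p := fun s : (Fin 2 → Poly) × Poly =>
    IsLocalSolution p τ t m s.1 s.2) ⟨(Q, U), h⟩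

end solvability

/-! ### Inverse estimates for polynomials -/

/-- On a finite-dimensional space, a positive definite form bounds the squares of the values of
functionals that depend continuously on a parameter in a compact set. -/
theorem exists_sq_le_of_posDef {V X : Type*} [AddCommGroup V] [Module ℝ V] [FiniteDimensional ℝ V]
    [TopologicalSpace X] {K : Set X} (hK : IsCompact K) (B : V →ₗ[ℝ] V →ₗ[ℝ] ℝ)
    (hB : ∀ v, 0 ≤ B v v) (hB0 : ∀ v, B v v = 0 → v = 0) (l : X → V →ₗ[ℝ] ℝ)
    (hl : ∀ v, Continuous fun x => l x v) :
    ∃ C, 0 < C ∧ ∀ x ∈ K, ∀ v, (l x v) ^ 2 ≤ C * B v v := by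
  let b := Module.finBasis ℝ V
  let W := Fin (Module.finrank ℝ V) → ℝ
  let e : V ≃ₗ[ℝ] W := b.equivFun
  -- The form is bounded below by a multiple of the maximum norm of the coordinates.
  let B' : W →ₗ[ℝ] W →ₗ[ℝ] ℝ := B.compl₁₂ e.symm.toLinearMap e.symm.toLinearMap
  let g : W →ₗ[ℝ] W →L[ℝ] ℝ := (LinearMap.toContinuousLinearMap : (W →ₗ[ℝ] ℝ) ≃ₗ[ℝ] _) ∘ₗ B'
  have hg : Continuous fun y : W => B' y y :=
    (LinearMap.continuous_of_finiteDimensional g).clm_apply continuous_id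
  obtain ⟨δ, hδ, hle⟩ := (isCompact_sphere (0 : W) 1).exists_forall_le' hg.continuousOn (a := 0)
    fun y hy => lt_of_le_of_ne (hB _) fun h0 => by
      have : y = 0 := by simpa using hB0 _ h0.symm
      rw [this] at hy
      simp at hy
  have hlow : ∀ y : W, δ * ‖y‖ ^ 2 ≤ B' y y := fun y => by
    rcases eq_or_ne y 0 with rfl | hy
    · simp
    · have hn : 0 < ‖y‖ := norm_pos_iff.2 hy
      have h1 := hle (‖y‖⁻¹ • y) (by simp [norm_smul, hn.ne'])
      rw [map_smul, map_smul, LinearMap.smul_apply, smul_eq_mul, smul_eq_mul] at h1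
      have h2 : δ * ‖y‖ ^ 2 ≤ ‖y‖⁻¹ * (‖y‖⁻¹ * B' y y) * ‖y‖ ^ 2 :=
        mul_le_mul_of_nonneg_right h1 (by positivity)
      have h3 : ‖y‖⁻¹ * (‖y‖⁻¹ * B' y y) * ‖y‖ ^ 2 = B' y y := by field_simp
      rwa [h3] at h2
  choose M hM using fun i => hK.exists_bound_of_continuousOn (hl (b i)).continuousOn
  have hup : ∀ x ∈ K, ∀ v, |l x v| ≤ (∑ i, |M i|) * ‖e v‖ := fun x hx v => by
    conv_lhs => rw [← b.sum_equivFun v, map_sum]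
    refine (Finset.abs_sum_le_sum_abs _ _).trans ?_
    rw [Finset.sum_mul]
    refine Finset.sum_le_sum fun i _ => ?_
    rw [map_smul, smul_eq_mul, abs_mul, mul_comm]
    refine mul_le_mul (((Real.norm_eq_abs _).symm.le.trans (hM i x hx)).trans (le_abs_self _))
      (norm_le_pi_norm (e v) i) (abs_nonneg _) (abs_nonneg _)
  refine ⟨(∑ i, |M i|) ^ 2 / δ + 1, by positivity, fun x hx v => ?_⟩
  have h1 := hlow (e v)
  have h2 : B' (e v) (e v) = B v v := by simp [B']
  rw [h2] at h1
  have h3 := hup x hx v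
  have h4 : (l x v) ^ 2 ≤ ((∑ i, |M i|) * ‖e v‖) ^ 2 := by
    rw [← sq_abs]
    exact pow_le_pow_left₀ (abs_nonneg _) h3 2
  calc (l x v) ^ 2 ≤ (∑ i, |M i|) ^ 2 / δ * (δ * ‖e v‖ ^ 2) := by
        refine h4.trans (le_of_eq ?_)
        field_simp
    _ ≤ (∑ i, |M i|) ^ 2 / δ * B v v := mul_le_mul_of_nonneg_left h1 (by positivity)
    _ ≤ _ := by nlinarith [hB v]

/-- The form `(P, Q) ↦ I (P Q)` on a subspace of an algebra. -/
noncomputable def productForm {A : Type*} [CommRing A] [Algebra ℝ A] (I : A →ₗ[ℝ] ℝ)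
    (V : Submodule ℝ A) : V →ₗ[ℝ] V →ₗ[ℝ] ℝ :=
  ((LinearMap.mul ℝ A).compr₂ I).compl₁₂ V.subtype V.subtype

theorem productForm_apply {A : Type*} [CommRing A] [Algebra ℝ A] (I : A →ₗ[ℝ] ℝ)
    (V : Submodule ℝ A) (P Q : V) : productForm I V P Q = I (P * Q) := rfl

/-- The integral over the unit disc as a linear functional on polynomials. -/
noncomputable def discFunctional : Poly →ₗ[ℝ] ℝ where
  toFun P := ∫ x in Metric.closedBall (0 : Plane) 1, P.val x
  map_add' P Q := by
    rw [← integral_add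
      (P.continuous_val.continuousOn.integrableOn_compact (isCompact_closedBall _ _))
      (Q.continuous_val.continuousOn.integrableOn_compact (isCompact_closedBall _ _))]
    simp only [← Poly.val_add]
  map_smul' k P := by
    rw [RingHom.id_apply, smul_eq_mul, ← integral_const_mul]
    simp only [← Poly.val_smul]

theorem discFunctional_mul_self (P : Poly) :
    discFunctional (P * P) = ∫ x in Metric.closedBall (0 : Plane) 1, P.val x ^ 2 := by
  simp only [discFunctional, LinearMap.coe_mk, AddHom.coe_mk, Poly.val_mul, sq]

theorem eq_zero_of_discFunctional {P : Poly} (h : discFunctional (P * P) = 0) : P = 0 := by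
  rw [discFunctional_mul_self] at h
  have hc : Continuous fun x => P.val x ^ 2 := P.continuous_val.pow 2
  have h1 := (integral_eq_zero_iff_of_nonneg (fun x => sq_nonneg (P.val x))
    (hc.continuousOn.integrableOn_compact (isCompact_closedBall _ _))).1 h
  have h2 := Measure.eqOn_open_of_ae_eq
    (ae_restrict_of_ae_restrict_of_subset Metric.ball_subset_closedBall h1) Metric.isOpen_ball
    hc.continuousOn continuousOn_const
  -- The unit disc contains a square.
  refine MvPolynomial.funext_set (fun _ => Set.Ioo (0 : ℝ) (1 / 2))
    (fun _ => Set.Ioo_infinite (by norm_num)) fun x hx => ?_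
  have hx0 := hx 0 (Set.mem_univ _)
  have hx1 := hx 1 (Set.mem_univ _)
  have hmem : (WithLp.toLp 2 x : Plane) ∈ Metric.ball (0 : Plane) 1 := by
    rw [mem_ball_zero_iff, EuclideanSpace.norm_eq, Fin.sum_univ_two]
    refine (Real.sqrt_lt' one_pos).2 ?_
    simp only [Real.norm_eq_abs, sq_abs]
    nlinarith [hx0.1, hx0.2, hx1.1, hx1.2]
  rw [map_zero]
  exact pow_eq_zero_iff two_ne_zero |>.1 (h2 hmem)

/-- On a larger disc, values and derivatives of polynomials are bounded by the mean square over the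
unit disc. -/
theorem exists_unit_disc_bound (p : ℕ) (R : ℝ) :
    ∃ C, 0 < C ∧ ∀ P ∈ PolyDeg p, ∀ x : Plane, ‖x‖ ≤ R →
      P.val x ^ 2 ≤ C * ∫ y in Metric.closedBall (0 : Plane) 1, P.val y ^ 2 ∧
      ∀ i, (gradient P i).val x ^ 2 ≤
        C * ∫ y in Metric.closedBall (0 : Plane) 1, P.val y ^ 2 := by
  have hB : ∀ P : PolyDeg p, 0 ≤ productForm discFunctional (PolyDeg p) P P := fun P => by
    rw [productForm_apply, discFunctional_mul_self]
    exact integral_nonneg fun x => sq_nonneg _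
  have hB0 : ∀ P : PolyDeg p, productForm discFunctional (PolyDeg p) P P = 0 → P = 0 :=
    fun P h => Subtype.ext (eq_zero_of_discFunctional h)
  have hK := isCompact_closedBall (0 : Plane) R
  let l : Plane → PolyDeg p →ₗ[ℝ] ℝ := fun x =>
    { toFun := fun P => P.1.val x
      map_add' := fun P Q => by simp
      map_smul' := fun c P => by simp }
  let l' : Fin 2 → Plane → PolyDeg p →ₗ[ℝ] ℝ := fun i x =>
    { toFun := fun P => (gradient P.1 i).val x
      map_add' := fun P Q => by simp [gradient]
      map_smul' := fun c P => by simp [gradient] }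
  obtain ⟨C, hC, h⟩ := exists_sq_le_of_posDef hK _ hB hB0 l fun P => P.1.continuous_val
  obtain ⟨C0, hC0, h0⟩ := exists_sq_le_of_posDef hK _ hB hB0 (l' 0) fun P => Poly.continuous_val _
  obtain ⟨C1, hC1, h1⟩ := exists_sq_le_of_posDef hK _ hB hB0 (l' 1) fun P => Poly.continuous_val _
  refine ⟨C + C0 + C1, by positivity, fun P hP x hx => ?_⟩
  have hx' : x ∈ Metric.closedBall (0 : Plane) R := mem_closedBall_zero_iff.2 hx
  have e : productForm discFunctional (PolyDeg p) ⟨P, hP⟩ ⟨P, hP⟩ =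
      ∫ y in Metric.closedBall (0 : Plane) 1, P.val y ^ 2 := discFunctional_mul_self P
  have hn := hB ⟨P, hP⟩
  have k := h x hx' ⟨P, hP⟩
  have k0 := h0 x hx' ⟨P, hP⟩
  have k1 := h1 x hx' ⟨P, hP⟩
  rw [e] at hn k k0 k1
  refine ⟨k.trans (mul_le_mul_of_nonneg_right (by linarith) hn), fun i => ?_⟩
  fin_cases i
  · exact k0.trans (mul_le_mul_of_nonneg_right (by linarith) hn)
  · exact k1.trans (mul_le_mul_of_nonneg_right (by linarith) hn)

/-- On an interval, values of polynomials are bounded by the mean square. -/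
theorem exists_unit_interval_bound (p : ℕ) :
    ∃ C, 0 < C ∧ ∀ q : Polynomial ℝ, q.natDegree ≤ p → ∀ s ∈ Set.Icc (0 : ℝ) 1,
      q.eval s ^ 2 ≤ C * ∫ r in (0 : ℝ)..1, q.eval r ^ 2 := by
  let I : Polynomial ℝ →ₗ[ℝ] ℝ :=
    { toFun := fun q => ∫ r in (0 : ℝ)..1, q.eval r
      map_add' := fun P Q => by
        rw [← intervalIntegral.integral_add (P.continuous.intervalIntegrable _ _)
          (Q.continuous.intervalIntegrable _ _)]
        simp only [Polynomial.eval_add]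
      map_smul' := fun k P => by
        rw [RingHom.id_apply, smul_eq_mul, ← intervalIntegral.integral_const_mul]
        simp only [Polynomial.eval_smul, smul_eq_mul] }
  have hI : ∀ q, I (q * q) = ∫ r in (0 : ℝ)..1, q.eval r ^ 2 := fun q => by
    simp only [I, LinearMap.coe_mk, AddHom.coe_mk, Polynomial.eval_mul, sq]
  let V := Polynomial.degreeLT ℝ (p + 1)
  have : FiniteDimensional ℝ V := Module.Finite.equiv (Polynomial.degreeLTEquiv ℝ (p + 1)).symm
  have hB : ∀ q : V, 0 ≤ productForm I V q q := fun q => by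
    rw [productForm_apply, hI]
    exact intervalIntegral.integral_nonneg zero_le_one fun x _ => sq_nonneg _
  have hB0 : ∀ q : V, productForm I V q q = 0 → q = 0 := fun q h => by
    rw [productForm_apply, hI] at h
    refine Subtype.ext (Polynomial.eq_zero_of_infinite_isRoot _ ?_)
    refine (Set.Ioo_infinite (zero_lt_one (α := ℝ))).mono fun s hs => ?_
    by_contra hne
    have hc : Continuous fun r : ℝ => q.1.eval r ^ 2 := q.1.continuous.pow 2
    have := intervalIntegral.integral_pos zero_lt_one hc.continuousOn (fun _ _ => sq_nonneg _)
      ⟨s, Set.Ioo_subset_Icc_self hs, lt_of_le_of_ne (sq_nonneg _) (pow_ne_zero 2 hne).symm⟩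
    exact this.ne' h
  let l : ℝ → V →ₗ[ℝ] ℝ := fun s => Polynomial.leval s ∘ₗ V.subtype
  obtain ⟨C, hC, h⟩ := exists_sq_le_of_posDef (isCompact_Icc (a := (0 : ℝ)) (b := 1)) _ hB hB0 l
    fun q => q.1.continuous
  refine ⟨C, hC, fun q hq s hs => ?_⟩
  have := h s hs ⟨q, Polynomial.mem_degreeLT.2 (by
    refine lt_of_le_of_lt Polynomial.degree_le_natDegree ?_
    exact_mod_cast Nat.lt_succ_of_le hq)⟩
  rwa [productForm_apply, hI] at this

/-! ### Scaling -/

/-- The polynomial `y ↦ P (c + r y)`. -/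
noncomputable def dilate (c : Plane) (r : ℝ) (P : Poly) : Poly :=
  MvPolynomial.aeval (fun i => (MvPolynomial.C (c i) + MvPolynomial.C r * MvPolynomial.X i : Poly)) P

theorem val_dilate (c : Plane) (r : ℝ) (P : Poly) (y : Plane) :
    (dilate c r P).val y = P.val (c + r • y) := by
  induction P using MvPolynomial.induction_on with
  | C k => simp [dilate]
  | add P Q hP hQ =>
    have : dilate c r (P + Q) = dilate c r P + dilate c r Q := map_add _ _ _
    rw [this, Poly.val_add, hP, hQ, Poly.val_add]
  | mul_X P i hP =>
    have : dilate c r (P * MvPolynomial.X i) =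
        dilate c r P * (MvPolynomial.C (c i) + MvPolynomial.C r * MvPolynomial.X i) := by
      simp [dilate]
    rw [this, Poly.val_mul, hP]
    simp

theorem dilate_mem {p : ℕ} (c : Plane) (r : ℝ) {P : Poly} (hP : P ∈ PolyDeg p) :
    dilate c r P ∈ PolyDeg p := by
  rw [dilate, MvPolynomial.aeval_def, MvPolynomial.eval₂_eq]
  refine Submodule.sum_mem _ fun d hd => mem_polyDeg.2 ?_
  refine (MvPolynomial.totalDegree_mul _ _).trans ?_
  rw [MvPolynomial.algebraMap_eq, MvPolynomial.totalDegree_C, zero_add]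
  refine (MvPolynomial.totalDegree_finsetProd _ _).trans ?_
  refine le_trans (Finset.sum_le_sum fun i _ => ?_)
    ((MvPolynomial.le_totalDegree hd).trans (mem_polyDeg.1 hP))
  refine (MvPolynomial.totalDegree_pow _ _).trans ?_
  refine (Nat.mul_le_mul_left _ (?_ : _ ≤ 1)).trans (mul_one _).le
  refine (MvPolynomial.totalDegree_add _ _).trans (max_le (by simp) ?_)
  refine (MvPolynomial.totalDegree_mul _ _).trans ?_
  simp

theorem val_gradient_dilate (c : Plane) (r : ℝ) (P : Poly) (y : Plane) (i : Fin 2) :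
    (gradient (dilate c r P) i).val y = r * (gradient P i).val (c + r • y) := by
  have h1 := hasDerivAt_val (dilate c r P) y (EuclideanSpace.single i 1) 0
  have h2 := hasDerivAt_val P (c + r • y) (r • EuclideanSpace.single i 1) 0
  have h3 : (fun s : ℝ => P.val (c + r • y + s • r • EuclideanSpace.single i (1 : ℝ))) =
      fun s : ℝ => (dilate c r P).val (y + s • EuclideanSpace.single i (1 : ℝ)) := by
    funext s
    rw [val_dilate]
    congr 1
    module
  rw [h3] at h2
  have := h1.unique h2
  fin_cases i <;> simpa [Fin.sum_univ_two] using this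

theorem integral_closedBall (c : Plane) {r : ℝ} (hr : 0 < r) (f : Plane → ℝ) :
    ∫ y in Metric.closedBall (0 : Plane) 1, f (c + r • y) =
      (r ^ 2)⁻¹ * ∫ x in Metric.closedBall c r, f x := by
  rw [Measure.setIntegral_comp_smul_of_pos volume (fun y => f (c + y)) _ hr, smul_unitClosedBall,
    finrank_euclideanSpace_fin, smul_eq_mul, Real.norm_of_nonneg hr.le]
  congr 1
  have h := (measurePreserving_add_left (volume : Measure Plane) c).setIntegral_preimage_emb
    (measurableEmbedding_addLeft c) f (Metric.closedBall c r)
  rw [← h]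
  congr 2
  ext y
  simp [dist_eq_norm]

/-- The inverse estimates on a disc of radius `r`. -/
theorem exists_disc_bound (p : ℕ) (R : ℝ) :
    ∃ C, 0 < C ∧ ∀ P ∈ PolyDeg p, ∀ (c : Plane) (r : ℝ), 0 < r → ∀ x : Plane, dist x c ≤ R * r →
      P.val x ^ 2 ≤ C * (r ^ 2)⁻¹ * ∫ y in Metric.closedBall c r, P.val y ^ 2 ∧
      ∀ i, (gradient P i).val x ^ 2 ≤
        C * (r ^ 4)⁻¹ * ∫ y in Metric.closedBall c r, P.val y ^ 2 := by
  obtain ⟨C, hC, h⟩ := exists_unit_disc_bound p R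
  refine ⟨C, hC, fun P hP c r hr x hx => ?_⟩
  have hy : ‖r⁻¹ • (x - c)‖ ≤ R := by
    rw [norm_smul, norm_inv, Real.norm_of_nonneg hr.le, ← dist_eq_norm, inv_mul_le_iff₀ hr,
      mul_comm]
    exact hx
  have hxy : c + r • r⁻¹ • (x - c) = x := by
    rw [smul_inv_smul₀ hr.ne']; abel
  obtain ⟨h1, h2⟩ := h _ (dilate_mem c r hP) _ hy
  simp only [val_dilate, val_gradient_dilate, hxy,
    integral_closedBall c hr (fun x => P.val x ^ 2)] at h1 h2
  refine ⟨by rw [mul_assoc]; exact h1, fun i => ?_⟩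
  have h3 := h2 i
  rw [mul_pow, ← le_div_iff₀' (by positivity)] at h3
  refine h3.trans (le_of_eq ?_)
  field_simp

/-- On an edge, values of polynomials are bounded by the mean square over this edge. -/
theorem exists_edge_bound (p : ℕ) :
    ∃ C, 0 < C ∧ ∀ P ∈ PolyDeg p, ∀ b c : Plane, b ≠ c → ∀ z ∈ hull {b, c},
      P.val z ^ 2 ≤ C * (dist b c)⁻¹ *
        ∫ x in hull {b, c}, P.val x ^ 2 ∂(Measure.hausdorffMeasure 1) := by
  obtain ⟨C, hC, h⟩ := exists_unit_interval_bound p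
  refine ⟨C, hC, fun P hP b c hbc z hz => ?_⟩
  let q : Polynomial ℝ := MvPolynomial.aeval
    (fun i => Polynomial.C (b i) + Polynomial.C (c i - b i) * Polynomial.X) P
  have hq : q.natDegree ≤ p := by
    have := MvPolynomial.aeval_natDegree_le P (mem_polyDeg.1 hP)
      (fun i => Polynomial.C (b i) + Polynomial.C (c i - b i) * Polynomial.X) (n := 1) fun i => by
        compute_degree
    rwa [mul_one] at this
  have hev : ∀ s, q.eval s = P.val (AffineMap.lineMap b c s) := fun s => by
    have h1 : q.eval s = MvPolynomial.aeval (fun i => b i + (c i - b i) * s) P := by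
      have := MvPolynomial.comp_aeval_apply (f := fun i => Polynomial.C (b i) +
        Polynomial.C (c i - b i) * Polynomial.X) (Polynomial.aeval (R := ℝ) s) P
      rw [Polynomial.coe_aeval_eq_eval] at this
      rw [this]
      congr 2
      funext i
      simp
    rw [h1, Poly.val, ← MvPolynomial.coe_aeval_eq_eval, RingHom.coe_coe]
    congr 2
    funext i
    simp [AffineMap.lineMap_apply]
    ring
  rw [hull_pair, segment_eq_image_lineMap] at hz
  obtain ⟨s, hs, rfl⟩ := hz
  have h1 := h q hq s hs
  simp only [hev] at h1
  have hd : dist b c ≠ 0 := (dist_pos.2 hbc).ne'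
  rw [integral_hull_pair hbc, mul_assoc, inv_mul_cancel_left₀ hd]
  exact h1

/-! ### Estimates on a shape regular triangle -/

theorem bary_le_one {t : Finset Plane} (ht : IsTriangle t) {v : Plane} (hv : v ∈ t) {x : Plane}
    (hx : x ∈ hull t) : bary t v x ≤ 1 := by
  rw [← sum_bary ht x]
  exact Finset.single_le_sum (f := fun v => bary t v x) ((mem_hull_iff ht).1 hx) hv

/-- The sides of a triangle are at least as long as the diameter of a disc inside. -/
theorem two_mul_radius_le_dist {t : Finset Plane} (ht : IsTriangle t) {x : Plane} {r : ℝ}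
    (hr : 0 < r) (hball : Metric.closedBall x r ⊆ hull t) {b c : Plane} (hb : b ∈ t) (hc : c ∈ t)
    (hbc : b ≠ c) : 2 * r ≤ dist b c := by
  -- The gradient `g` of a barycentric coordinate varies by one over the side, and by at most one
  -- over the disc.
  let g : Plane := !₂[(bary t b).linear (EuclideanSpace.single 0 1),
    (bary t b).linear (EuclideanSpace.single 1 1)]
  have hg : ∀ y z : Plane, bary t b y - bary t b z = inner ℝ g (y - z) := fun y z => by
    rw [← bary_sub, linear_apply, inner_eq]
    simp [g, mul_comm]
  have h1 : 1 ≤ ‖g‖ * dist b c := by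
    have := hg b c
    rw [bary_self ht hb, bary_of_ne ht hb hc hbc, sub_zero] at this
    rw [this, dist_eq_norm]
    exact real_inner_le_norm _ _
  have hg0 : 0 < ‖g‖ := by
    by_contra! h0
    rw [le_antisymm h0 (norm_nonneg _), zero_mul] at h1
    linarith
  have hmem : ∀ k : ℝ, |k| = r → x + (k * ‖g‖⁻¹) • g ∈ hull t := fun k hk => hball (by
    rw [mem_closedBall_iff_norm, add_sub_cancel_left, norm_smul, norm_mul, norm_inv, norm_norm,
      Real.norm_eq_abs, hk, mul_assoc, inv_mul_cancel₀ hg0.ne', mul_one])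
  have hp := hmem r (abs_of_pos hr)
  have hm := hmem (-r) (by rw [abs_neg, abs_of_pos hr])
  have h2 := bary_le_one ht hb hp
  have h3 := (mem_hull_iff ht).1 hm b hb
  have h4 := hg (x + (r * ‖g‖⁻¹) • g) (x + (-r * ‖g‖⁻¹) • g)
  have h5 : x + (r * ‖g‖⁻¹) • g - (x + (-r * ‖g‖⁻¹) • g) = (2 * r * ‖g‖⁻¹) • g := by module
  have h7 : 2 * r * ‖g‖⁻¹ * ‖g‖ ^ 2 = 2 * r * ‖g‖ := by field_simp
  rw [h5, inner_smul_right, real_inner_self_eq_norm_sq, h7] at h4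
  have h6 : 2 * r * ‖g‖ ≤ ‖g‖ * dist b c := by linarith
  rw [mul_comm] at h6
  exact le_of_mul_le_mul_left h6 hg0

/-- The triangle `t` contains a disc of radius `r` and has diameter at most `2 σ r`. -/
structure ShapeBound (σ : ℝ) (t : Finset Plane) (x : Plane) (r : ℝ) : Prop where
  pos : 0 < r
  ball_subset : Metric.closedBall x r ⊆ hull t
  diam_le : Metric.diam (hull t) ≤ σ * (2 * r)

section shape

variable {p : ℕ} {σ : ℝ} {t : Finset Plane} {c : Plane} {r : ℝ}

theorem ShapeBound.dist_le (hs : ShapeBound σ t c r) {x y : Plane} (hx : x ∈ hull t)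
    (hy : y ∈ hull t) : dist x y ≤ 2 * σ * r := by
  refine (Metric.dist_le_diam_of_mem (isCompact_hull t).isBounded hx hy).trans ?_
  linarith [hs.diam_le]

theorem ShapeBound.center_mem (hs : ShapeBound σ t c r) : c ∈ hull t :=
  hs.ball_subset (Metric.mem_closedBall_self hs.pos.le)

theorem ShapeBound.sigma_nonneg (hs : ShapeBound σ t c r) : 0 ≤ σ := by
  have h := hs.dist_le hs.center_mem hs.center_mem
  rw [dist_self] at h
  by_contra! hneg
  nlinarith [mul_pos (neg_pos.2 hneg) hs.pos]

theorem triangleIntegral_disc_le (hs : ShapeBound σ t c r) (P : Poly) :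
    ∫ y in Metric.closedBall c r, P.val y ^ 2 ≤ triangleIntegral t (fun x => P.val x ^ 2) :=
  setIntegral_mono_set (integrableOn_hull (P.continuous_val.pow 2))
    (Filter.Eventually.of_forall fun _ => sq_nonneg _) (Filter.Eventually.of_forall hs.ball_subset)

theorem hull_oppositeEdge_subset (t : Finset Plane) (a : Plane) :
    hull (oppositeEdge t a) ⊆ hull t :=
  convexHull_mono (by exact_mod_cast oppositeEdge_subset t a)

/-- The trace inequality. -/
theorem exists_trace_bound (p : ℕ) (σ : ℝ) :
    ∃ C, 0 < C ∧ ∀ P ∈ PolyDeg p, ∀ t c r, IsTriangle t → ShapeBound σ t c r →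
      boundaryIntegral t (fun _ x => P.val x ^ 2) ≤
        C * r⁻¹ * triangleIntegral t (fun x => P.val x ^ 2) := by
  obtain ⟨C, hC, h⟩ := exists_disc_bound p (2 * σ)
  refine ⟨6 * |σ| * C + 1, by positivity, fun P hP t c r ht hs => ?_⟩
  have hr := hs.pos
  set J := triangleIntegral t (fun x => P.val x ^ 2) with hJ
  have hJ0 : 0 ≤ J := triangleIntegral_nonneg fun _ => sq_nonneg _
  have hedge : ∀ a ∈ t, ∫ x in hull (oppositeEdge t a), P.val x ^ 2
      ∂(Measure.hausdorffMeasure 1) ≤ 2 * σ * C * r⁻¹ * J := fun a ha => by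
    obtain ⟨b, d, hbd, hb, hd, hopp⟩ := ht.oppositeEdge_eq_pair ha
    have hle : ∀ s ∈ Set.Icc (0 : ℝ) 1, P.val (AffineMap.lineMap b d s) ^ 2 ≤
        C * (r ^ 2)⁻¹ * J := fun s hs' => by
      have hmem : AffineMap.lineMap b d s ∈ hull t := by
        refine hull_oppositeEdge_subset t a ?_
        rw [hopp, hull_pair, segment_eq_image_lineMap]
        exact ⟨s, hs', rfl⟩
      refine (h P hP c r hr _ (hs.dist_le hmem hs.center_mem)).1.trans ?_
      exact mul_le_mul_of_nonneg_left (triangleIntegral_disc_le hs P) (by positivity)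
    rw [hopp, integral_hull_pair hbd]
    have h1 : ∫ s in (0 : ℝ)..1, P.val (AffineMap.lineMap b d s) ^ 2 ≤ C * (r ^ 2)⁻¹ * J := by
      have hcont : Continuous fun s : ℝ => P.val (AffineMap.lineMap b d s) ^ 2 :=
        (P.continuous_val.comp AffineMap.lineMap_continuous).pow 2
      have := intervalIntegral.integral_mono_on zero_le_one (hcont.intervalIntegrable 0 1)
        (continuous_const.intervalIntegrable (μ := volume) 0 1) hle
      simpa using this
    calc _ ≤ 2 * σ * r * (C * (r ^ 2)⁻¹ * J) :=
          mul_le_mul (hs.dist_le (subset_convexHull ℝ _ hb) (subset_convexHull ℝ _ hd)) h1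
            (intervalIntegral.integral_nonneg zero_le_one fun _ _ => sq_nonneg _)
            (by have := hs.sigma_nonneg; positivity)
      _ = _ := by field_simp
  refine (Finset.sum_le_card_nsmul _ _ _ hedge).trans ?_
  rw [ht.card_eq, nsmul_eq_mul, abs_of_nonneg hs.sigma_nonneg]
  have : 0 ≤ r⁻¹ * J := by positivity
  push_cast
  nlinarith

/-- The inverse inequality for the gradient. -/
theorem exists_gradient_bound (p : ℕ) (σ : ℝ) :
    ∃ C, 0 < C ∧ ∀ P ∈ PolyDeg p, ∀ t c r, ShapeBound σ t c r → ∀ M : ℝ,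
      (∀ x ∈ hull t, |P.val x| ≤ M) →
      triangleIntegral t (dot (gradient P) (gradient P)).val ≤ C * M ^ 2 := by
  obtain ⟨C, hC, h⟩ := exists_disc_bound p (2 * σ)
  set v := (volume : Measure Plane).real (Metric.closedBall 0 1) with hv
  have hv0 : 0 ≤ v := measureReal_nonneg
  have hvol : ∀ (x : Plane) {r : ℝ}, 0 ≤ r →
      (volume : Measure Plane).real (Metric.closedBall x r) = r ^ 2 * v := fun x r hr => by
    rw [Measure.addHaar_real_closedBall' volume x hr, finrank_euclideanSpace_fin]
  refine ⟨8 * σ ^ 2 * C * v ^ 2 + 1, by positivity, fun P hP t c r hs M hM => ?_⟩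
  have hr := hs.pos
  have h1 : ∫ y in Metric.closedBall c r, P.val y ^ 2 ≤ M ^ 2 * (r ^ 2 * v) := by
    rw [← hvol c hr.le]
    refine (Real.le_norm_self _).trans (norm_setIntegral_le_of_norm_le_const
      measure_closedBall_lt_top fun y hy => ?_)
    rw [Real.norm_eq_abs, abs_of_nonneg (sq_nonneg _), ← sq_abs]
    exact pow_le_pow_left₀ (abs_nonneg _) (hM y (hs.ball_subset hy)) 2
  have h2 : ∀ x ∈ hull t, ‖(dot (gradient P) (gradient P)).val x‖ ≤
      2 * (C * (r ^ 4)⁻¹ * (M ^ 2 * (r ^ 2 * v))) := fun x hx => by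
    have h3 := (h P hP c r hr x (hs.dist_le hx hs.center_mem)).2
    have h4 : ∀ i, (gradient P i).val x ^ 2 ≤ C * (r ^ 4)⁻¹ * (M ^ 2 * (r ^ 2 * v)) := fun i =>
      (h3 i).trans (mul_le_mul_of_nonneg_left h1 (by positivity))
    rw [Real.norm_of_nonneg (dot_self_nonneg _ _), val_dot, Fin.sum_univ_two]
    linarith [h4 0, h4 1]
  have h5 : (volume : Measure Plane).real (hull t) ≤ (2 * σ * r) ^ 2 * v := by
    have hσ := hs.sigma_nonneg
    rw [← hvol c (by positivity : 0 ≤ 2 * σ * r)]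
    exact measureReal_mono (fun x hx => hs.dist_le hx hs.center_mem)
      measure_closedBall_lt_top.ne
  calc _ ≤ 2 * (C * (r ^ 4)⁻¹ * (M ^ 2 * (r ^ 2 * v))) * (volume : Measure Plane).real (hull t) :=
        (Real.le_norm_self _).trans (norm_setIntegral_le_of_norm_le_const
          (isCompact_hull t).measure_lt_top h2)
    _ ≤ 2 * (C * (r ^ 4)⁻¹ * (M ^ 2 * (r ^ 2 * v))) * ((2 * σ * r) ^ 2 * v) :=
        mul_le_mul_of_nonneg_left h5 (by positivity)
    _ = 8 * σ ^ 2 * C * v ^ 2 * M ^ 2 := by field_simp; ring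
    _ ≤ _ := by nlinarith [sq_nonneg M]

theorem norm_outerNormal (ht : IsTriangle t) {a : Plane} (ha : a ∈ t) :
    ‖outerNormal t a‖ = 1 := by
  obtain ⟨b, c, hab, hac, hbc, rfl⟩ := ht.exists_eq ha
  exact (outerNormal_spec hab hac hbc ht).1

theorem normalComponent_sq_le (ht : IsTriangle t) {a : Plane} (ha : a ∈ t) (q : Fin 2 → Poly)
    (x : Plane) : normalComponent q (outerNormal t a) x ^ 2 ≤ (dot q q).val x := by
  have h := real_inner_self_eq_norm_sq (outerNormal t a)
  rw [norm_outerNormal ht ha, inner_eq] at h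
  rw [normalComponent, val_dot, Fin.sum_univ_two, Fin.sum_univ_two]
  have : (q 0).val x * (q 0).val x + (q 1).val x * (q 1).val x -
      ((q 0).val x * outerNormal t a 0 + (q 1).val x * outerNormal t a 1) ^ 2 =
      ((q 0).val x * outerNormal t a 1 - (q 1).val x * outerNormal t a 0) ^ 2 := by
    linear_combination (-((q 0).val x ^ 2 + (q 1).val x ^ 2)) * h
  linarith [sq_nonneg ((q 0).val x * outerNormal t a 1 - (q 1).val x * outerNormal t a 0)]

/-- The gradient of the scalar unknown is controlled by the local energy. The number `θ` measures
the stabilization parameter against the size of the triangle. -/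
theorem exists_gradient_le_energy (p : ℕ) (σ θ : ℝ) :
    ∃ C, 0 < C ∧ ∀ t c r, IsTriangle t → ShapeBound σ t c r → ∀ τ, 0 < τ → r⁻¹ ≤ θ * τ →
      ∀ m Q U, EdgeContinuous t (fun a x => m (oppositeEdge t a) x) →
      IsLocalSolution p τ t m Q U →
      triangleIntegral t (dot (gradient U) (gradient U)).val ≤ C * localEnergy τ t m Q U := by
  obtain ⟨K, hK, h⟩ := exists_trace_bound p σ
  refine ⟨2 * (K * |θ| + 1), by positivity, fun t c r ht hs τ hτ hθ m Q U hm hsol => ?_⟩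
  have hr := hs.pos
  have hc : ∀ P : Poly, Continuous P.val := Poly.continuous_val
  have hθ0 : 0 < θ := by
    by_contra! hneg
    have : 0 < r⁻¹ := inv_pos.2 hr
    nlinarith
  have h1 := hsol.gradient_eq ht hm
  set G := triangleIntegral t (dot (gradient U) (gradient U)).val with hG
  have hj : EdgeContinuous t (fun a x => U.val x - m (oppositeEdge t a) x) :=
    (edgeContinuous_val U).sub hm
  have hn := edgeContinuous_normalComponent t (gradient U)
  set J := boundaryIntegral t (fun a x =>
      (U.val x - m (oppositeEdge t a) x) * (U.val x - m (oppositeEdge t a) x)) with hJ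
  have hJ0 : 0 ≤ J := jump_nonneg t m U
  have htrace : boundaryIntegral t (fun _ x => (dot (gradient U) (gradient U)).val x) ≤
      K * r⁻¹ * G := by
    have e1 : boundaryIntegral t (fun _ x => (dot (gradient U) (gradient U)).val x) =
        boundaryIntegral t (fun _ x => (gradient U 0).val x ^ 2) +
        boundaryIntegral t (fun _ x => (gradient U 1).val x ^ 2) := by
      rw [← boundaryIntegral_add ht (F := fun _ x => (gradient U 0).val x ^ 2)
        (G := fun _ x => (gradient U 1).val x ^ 2) (fun _ _ => ((hc _).pow 2).continuousOn)
        (fun _ _ => ((hc _).pow 2).continuousOn)]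
      congr 1
      funext _ x
      rw [val_dot, Fin.sum_univ_two, sq, sq]
    have e2 : G = triangleIntegral t (fun x => (gradient U 0).val x ^ 2) +
        triangleIntegral t (fun x => (gradient U 1).val x ^ 2) := by
      rw [← triangleIntegral_add (f := fun x => (gradient U 0).val x ^ 2)
        (g := fun x => (gradient U 1).val x ^ 2) ((hc _).pow 2) ((hc _).pow 2), hG]
      congr 1
      funext x
      rw [val_dot, Fin.sum_univ_two, sq, sq]
    rw [e1, e2, mul_add]
    exact add_le_add (h _ (gradient_mem hsol.2.1 0) t c r ht hs)
      (h _ (gradient_mem hsol.2.1 1) t c r ht hs)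
  -- The weight in Young's inequality is chosen so that the trace inequality leaves `G / 4`, which,
  -- together with `G / 4` from the flux term below, is absorbed by the left-hand side.
  have hyoung : boundaryIntegral t (fun a x => (U.val x - m (oppositeEdge t a) x) *
        normalComponent (gradient U) (outerNormal t a) x) ≤ K * r⁻¹ * J + 1 / 4 * G := by
    have hKr : 0 < K * r⁻¹ := by positivity
    have e1 : boundaryIntegral t (fun a x => (U.val x - m (oppositeEdge t a) x) *
        normalComponent (gradient U) (outerNormal t a) x) ≤
        boundaryIntegral t (fun a x => K * r⁻¹ *
          ((U.val x - m (oppositeEdge t a) x) * (U.val x - m (oppositeEdge t a) x)) +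
          (4 * (K * r⁻¹))⁻¹ * (dot (gradient U) (gradient U)).val x) := by
      refine boundaryIntegral_mono ht (hj.mul hn) (((edgeContinuous_const _).mul (hj.mul hj)).add
        ((edgeContinuous_const _).mul (edgeContinuous_val _))) fun a ha x _ => ?_
      refine le_trans ?_ (add_le_add_right (mul_le_mul_of_nonneg_left
        (normalComponent_sq_le ht ha (gradient U) x) (by positivity)) _)
      generalize U.val x - m (oppositeEdge t a) x = A
      generalize normalComponent (gradient U) (outerNormal t a) x = B
      have e : K * r⁻¹ * (A * A) + (4 * (K * r⁻¹))⁻¹ * B ^ 2 - A * B =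
          (K * r⁻¹) * (A - (2 * (K * r⁻¹))⁻¹ * B) ^ 2 := by
        field_simp
        ring
      have := mul_nonneg hKr.le (sq_nonneg (A - (2 * (K * r⁻¹))⁻¹ * B))
      linarith
    refine e1.trans ?_
    rw [boundaryIntegral_add ht ((edgeContinuous_const _).mul (hj.mul hj))
      ((edgeContinuous_const _).mul (edgeContinuous_val _)), boundaryIntegral_const_mul,
      boundaryIntegral_const_mul]
    refine add_le_add_right ((mul_le_mul_of_nonneg_left htrace (by positivity)).trans
      (le_of_eq ?_)) _
    field_simp
  have hflux : -triangleIntegral t (dot Q (gradient U)).val ≤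
      triangleIntegral t (dot Q Q).val + 1 / 4 * G := by
    rw [← neg_one_mul, ← triangleIntegral_const_mul, hG, ← triangleIntegral_const_mul,
      ← triangleIntegral_add (hc _) ((hc _).const_mul _)]
    refine triangleIntegral_mono ((hc _).const_mul _) ((hc _).add ((hc _).const_mul _))
      fun x _ => ?_
    simp only [val_dot, Fin.sum_univ_two]
    nlinarith [sq_nonneg ((Q 0).val x + 1 / 2 * (gradient U 0).val x),
      sq_nonneg ((Q 1).val x + 1 / 2 * (gradient U 1).val x)]
  have hE1 := flux_le_localEnergy (t := t) (m := m) (Q := Q) (U := U) hτ.le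
  have hE2 := jump_le_localEnergy (τ := τ) (t := t) (m := m) (Q := Q) (U := U)
  rw [← hJ] at hE2
  have h2 : K * r⁻¹ * J ≤ K * θ * localEnergy τ t m Q U := by
    calc K * r⁻¹ * J ≤ K * (θ * τ) * J := by gcongr
      _ = K * θ * (τ * J) := by ring
      _ ≤ _ := by gcongr
  rw [abs_of_pos hθ0]
  linarith

/-- The jump at a point of the boundary is controlled by the local energy. -/
theorem exists_jump_le_energy (p : ℕ) (σ θ : ℝ) :
    ∃ C, 0 < C ∧ ∀ t c r, IsTriangle t → ShapeBound σ t c r → ∀ τ, 0 < τ → r⁻¹ ≤ θ * τ →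
      ∀ m Q U, U ∈ PolyDeg p →
      (∀ a ∈ t, ∃ P ∈ PolyDeg p, ∀ x ∈ hull (oppositeEdge t a), m (oppositeEdge t a) x = P.val x) →
      ∀ a ∈ t, ∀ z ∈ hull (oppositeEdge t a),
      (U.val z - m (oppositeEdge t a) z) ^ 2 ≤ C * localEnergy τ t m Q U := by
  obtain ⟨K, hK, h⟩ := exists_edge_bound p
  refine ⟨K * |θ| + 1, by positivity, fun t c r ht hs τ hτ hθ m Q U hU hm a ha z hz => ?_⟩
  have hr := hs.pos
  have hθ0 : 0 < θ := by
    by_contra! hneg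
    have : 0 < r⁻¹ := inv_pos.2 hr
    nlinarith
  obtain ⟨P, hP, hPm⟩ := hm a ha
  obtain ⟨b, d, hbd, hb, hd, hopp⟩ := ht.oppositeEdge_eq_pair ha
  have h1 := h (U - P) (Submodule.sub_mem _ hU hP) b d hbd z (hopp ▸ hz)
  rw [← hopp, Poly.val_sub, ← hPm z hz] at h1
  set J := boundaryIntegral t (fun a x =>
      (U.val x - m (oppositeEdge t a) x) * (U.val x - m (oppositeEdge t a) x)) with hJ
  have h2 : ∫ x in hull (oppositeEdge t a), (U - P).val x ^ 2 ∂(Measure.hausdorffMeasure 1) ≤ J := by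
    have e : ∫ x in hull (oppositeEdge t a), (U - P).val x ^ 2 ∂(Measure.hausdorffMeasure 1) =
        ∫ x in hull (oppositeEdge t a), (U.val x - m (oppositeEdge t a) x) *
          (U.val x - m (oppositeEdge t a) x) ∂(Measure.hausdorffMeasure 1) :=
      setIntegral_congr_fun (measurableSet_hull _) fun x hx => by
        simp only [Poly.val_sub, hPm x hx, sq]
    rw [e]
    exact Finset.single_le_sum (f := fun a => ∫ x in hull (oppositeEdge t a),
      (U.val x - m (oppositeEdge t a) x) * (U.val x - m (oppositeEdge t a) x)
      ∂(Measure.hausdorffMeasure 1)) (fun a _ => integral_nonneg fun x => mul_self_nonneg _) ha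
  have h3 : (dist b d)⁻¹ ≤ r⁻¹ := by
    have := two_mul_radius_le_dist ht hr hs.ball_subset hb hd hbd
    exact inv_anti₀ hr (by linarith)
  have hJ0 : 0 ≤ J := jump_nonneg t m U
  have hE2 := jump_le_localEnergy (τ := τ) (t := t) (m := m) (Q := Q) (U := U)
  have hE := localEnergy_nonneg (t := t) (m := m) (Q := Q) (U := U) hτ.le
  rw [← hJ] at hE2
  rw [abs_of_pos hθ0]
  calc _ ≤ K * (dist b d)⁻¹ * J := h1.trans (mul_le_mul_of_nonneg_left h2 (by positivity))
    _ ≤ K * (θ * τ) * J := by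
        have := h3.trans hθ
        gcongr
    _ = K * θ * (τ * J) := by ring
    _ ≤ K * θ * localEnergy τ t m Q U := by gcongr
    _ ≤ _ := by linarith

end shape

/-! ### Simplices of a triangulation -/

namespace Triangulation

variable {Ω : Set Plane} (𝒯 : Triangulation Ω)

theorem mem_triangles {t : Finset Plane} :
    t ∈ 𝒯.triangles ↔ t ∈ 𝒯.complex.faces ∧ t.card = 3 := by
  simp [triangles]

theorem mem_edges {e : Finset Plane} : e ∈ 𝒯.edges ↔ e ∈ 𝒯.complex.faces ∧ e.card = 2 := by
  simp [edges]

theorem mem_edgesAt {z : Plane} {e : Finset Plane} : e ∈ 𝒯.edgesAt z ↔ e ∈ 𝒯.edges ∧ z ∈ e := by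
  simp [edgesAt]

variable {𝒯}

theorem isTriangle {t : Finset Plane} (ht : t ∈ 𝒯.triangles) : IsTriangle t :=
  ⟨(𝒯.mem_triangles.1 ht).2, 𝒯.complex.indep (𝒯.mem_triangles.1 ht).1⟩

theorem face_of_subset {t s : Finset Plane} (ht : t ∈ 𝒯.triangles) (hs : s ⊆ t)
    (hne : s.Nonempty) : s ∈ 𝒯.complex.faces :=
  𝒯.complex.down_closed (𝒯.mem_triangles.1 ht).1 hs hne

theorem edge_of_mem {t : Finset Plane} (ht : t ∈ 𝒯.triangles) {a b : Plane} (ha : a ∈ t)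
    (hb : b ∈ t) (hab : a ≠ b) : {a, b} ∈ 𝒯.edges :=
  𝒯.mem_edges.2 ⟨face_of_subset ht (Finset.insert_subset ha (Finset.singleton_subset_iff.2 hb))
    ⟨a, by simp⟩, Finset.card_pair hab⟩

theorem oppositeEdge_mem {t : Finset Plane} (ht : t ∈ 𝒯.triangles) {a : Plane} (ha : a ∈ t) :
    oppositeEdge t a ∈ 𝒯.edges := by
  obtain ⟨b, c, hbc, hb, hc, h⟩ := (isTriangle ht).oppositeEdge_eq_pair ha
  rw [h]
  exact edge_of_mem ht hb hc hbc

theorem exists_triangle {s : Finset Plane} (hs : s ∈ 𝒯.complex.faces) :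
    ∃ t ∈ 𝒯.triangles, s ⊆ t := by
  obtain ⟨t, ht, hst, hc⟩ := 𝒯.pure s hs
  exact ⟨t, 𝒯.mem_triangles.2 ⟨ht, hc⟩, hst⟩

theorem exists_triangle_of_mem_closure {x : Plane} (hx : x ∈ closure Ω) :
    ∃ t ∈ 𝒯.triangles, x ∈ hull t := by
  rw [← 𝒯.space_eq, Geometry.SimplicialComplex.mem_space_iff] at hx
  obtain ⟨s, hs, hxs⟩ := hx
  obtain ⟨t, ht, hst⟩ := exists_triangle hs
  exact ⟨t, ht, convexHull_mono (by exact_mod_cast hst) hxs⟩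

theorem hull_subset_closure {s : Finset Plane} (hs : s ∈ 𝒯.complex.faces) :
    hull s ⊆ closure Ω := by
  rw [← 𝒯.space_eq]
  exact Geometry.SimplicialComplex.convexHull_subset_space hs

theorem triangle_eq_of_subset {t t' : Finset Plane} (ht : t ∈ 𝒯.triangles)
    (ht' : t' ∈ 𝒯.triangles) (h : t ⊆ t') : t = t' :=
  Finset.eq_of_subset_of_card_le h
    (by rw [(𝒯.mem_triangles.1 ht).2, (𝒯.mem_triangles.1 ht').2])

theorem mem_hull_inter [DecidableEq Plane] {s s' : Finset Plane} (hs : s ∈ 𝒯.complex.faces)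
    (hs' : s' ∈ 𝒯.complex.faces) {x : Plane} (hx : x ∈ hull s) (hx' : x ∈ hull s') :
    x ∈ hull (s ∩ s') := by
  have := 𝒯.complex.inter_subset_convexHull hs hs' ⟨hx, hx'⟩
  rwa [hull, Finset.coe_inter]

/-- A common point of a triangle `t` and another simplex lies in the face of `t` spanned by the
common vertices. -/
theorem bary_eq_zero_of_mem_face {t s : Finset Plane} (ht : t ∈ 𝒯.triangles)
    (hs : s ∈ 𝒯.complex.faces) {x : Plane} (hx : x ∈ hull t) (hx' : x ∈ hull s) {v : Plane}
    (hv : v ∈ t) (hvs : v ∉ s) : bary t v x = 0 := by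
  classical
  exact bary_eq_zero_of_mem_hull (isTriangle ht) Finset.inter_subset_left
    (mem_hull_inter (𝒯.mem_triangles.1 ht).1 hs hx hx') hv (by simp [hvs])

theorem disjoint_interior {t t' : Finset Plane} (ht : t ∈ 𝒯.triangles) (ht' : t' ∈ 𝒯.triangles)
    (hne : t ≠ t') : Disjoint (interior (hull t)) (interior (hull t')) := by
  refine Set.disjoint_left.2 fun x hx hx' => hne (triangle_eq_of_subset ht ht' fun v hv => ?_)
  by_contra hvt
  have h0 := bary_eq_zero_of_mem_face ht (𝒯.mem_triangles.1 ht').1 (interior_subset hx)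
    (interior_subset hx') hv hvt
  exact ((mem_interior_hull_iff (isTriangle ht)).1 hx v hv).ne' h0

end Triangulation

/-! ### The star of a vertex -/

/-- The cone with apex `z` over the triangle `t`. -/
def cone (z : Plane) (t : Finset Plane) : Set Plane := {x | ∀ v ∈ t, v ≠ z → 0 ≤ bary t v x}

theorem isClosed_cone (z : Plane) (t : Finset Plane) : IsClosed (cone z t) := by
  have : cone z t = ⋂ v ∈ t, ⋂ _ : v ≠ z, {x | 0 ≤ bary t v x} := by
    ext x; simp [cone]
  rw [this]
  exact isClosed_biInter fun v _ => isClosed_iInter fun _ =>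
    isClosed_le continuous_const (continuous_bary t v)

theorem lineMap_mem_hull {t : Finset Plane} (ht : IsTriangle t) {z x : Plane} (hz : z ∈ t)
    (hx : x ∈ cone z t) {s : ℝ} (hs : 0 ≤ s) (hs1 : s * (1 + |bary t z x|) ≤ 1) :
    AffineMap.lineMap z x s ∈ hull t := by
  rw [mem_hull_iff ht]
  intro v hv
  rw [bary_lineMap]
  by_cases hvz : v = z
  · subst hvz
    rw [bary_self ht hv]
    nlinarith [neg_abs_le (bary t v x)]
  · rw [bary_of_ne ht hv hz hvz, mul_zero, zero_add]
    exact mul_nonneg hs (hx v hv hvz)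

namespace Triangulation

variable {Ω : Set Plane} {𝒯 : Triangulation Ω}

/-- Cones over triangles at `z` meet in the cone over the common face. -/
theorem bary_eq_zero_of_mem_cone {t t' : Finset Plane} (ht : t ∈ 𝒯.triangles)
    (ht' : t' ∈ 𝒯.triangles) {z x : Plane} (hz : z ∈ t) (hz' : z ∈ t') (hx : x ∈ cone z t)
    (hx' : x ∈ cone z t') {v : Plane} (hv : v ∈ t) (hvt : v ∉ t') : bary t v x = 0 := by
  set s : ℝ := (2 + |bary t z x| + |bary t' z x|)⁻¹ with hs
  have h0 := abs_nonneg (bary t z x)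
  have h1 := abs_nonneg (bary t' z x)
  have hpos : 0 < 2 + |bary t z x| + |bary t' z x| := by linarith
  have hs0 : 0 < s := inv_pos.2 hpos
  have hy := lineMap_mem_hull (isTriangle ht) hz hx hs0.le (by
    rw [hs, inv_mul_le_iff₀ hpos]; linarith)
  have hy' := lineMap_mem_hull (isTriangle ht') hz' hx' hs0.le (by
    rw [hs, inv_mul_le_iff₀ hpos]; linarith)
  have h := bary_eq_zero_of_mem_face ht (𝒯.mem_triangles.1 ht').1 hy hy' hv hvt
  rw [bary_lineMap, bary_of_ne (isTriangle ht) hv hz (fun e => hvt (e ▸ hz')), mul_zero,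
    zero_add] at h
  exact (mul_eq_zero.1 h).resolve_left hs0.ne'

variable (𝒯) in
/-- Two triangles with vertex `z` have an edge at `z` in common. -/
def Neighbors (z : Plane) (t t' : Finset Plane) : Prop :=
  t ∈ 𝒯.triangles ∧ t' ∈ 𝒯.triangles ∧ z ∈ t ∧ z ∈ t' ∧ ∃ a, a ≠ z ∧ a ∈ t ∧ a ∈ t'

/-- Around an inner point of an edge at `z`, the cones over two triangles at this edge fill a
neighbourhood. -/
theorem cone_union_mem_nhds {z a b b' x : Plane} (hza : z ≠ a) (hzb : z ≠ b) (hab : a ≠ b)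
    (hzb' : z ≠ b') (hab' : a ≠ b') (hbb' : b ≠ b') (ht : {z, a, b} ∈ 𝒯.triangles)
    (ht' : {z, a, b'} ∈ 𝒯.triangles) (hxa : 0 < bary {z, a, b} a x)
    (hxb : bary {z, a, b} b x = 0) :
    cone z {z, a, b} ∪ cone z {z, a, b'} ∈ nhds x := by
  have hT := isTriangle ht
  have hT' := isTriangle ht'
  have sum3 : ∀ (b : Plane) (_ : z ≠ b) (_ : a ≠ b) (f : Plane → ℝ),
      ∑ v ∈ {z, a, b}, f v = f z + f a + f b := fun b hzb hab f => by
    rw [Finset.sum_insert (by simp [hza, hzb]), Finset.sum_insert (by simp [hab]),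
      Finset.sum_singleton, add_assoc]
  -- Every affine function is determined by its values at the vertices.
  have haff : ∀ (s : Finset Plane) (v y : Plane), bary s v y = bary {z, a, b} z y * bary s v z +
      bary {z, a, b} a y * bary s v a + bary {z, a, b} b y * bary s v b := fun s v y => by
    conv_lhs => rw [← sum_bary_smul hT y]
    rw [bary_sum _ v _ _ (sum_bary hT y), sum3 b hzb hab]
  have hz : z ∈ ({z, a, b} : Finset Plane) := by simp
  have ha : a ∈ ({z, a, b} : Finset Plane) := by simp
  have hb : b ∈ ({z, a, b} : Finset Plane) := by simp
  have hz' : z ∈ ({z, a, b'} : Finset Plane) := by simp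
  have ha' : a ∈ ({z, a, b'} : Finset Plane) := by simp
  have hb' : b' ∈ ({z, a, b'} : Finset Plane) := by simp
  have hbt' : b ∉ ({z, a, b'} : Finset Plane) := by simp [hzb.symm, hab.symm, hbb']
  set t : Finset Plane := {z, a, b}
  set t' : Finset Plane := {z, a, b'}
  set k := bary t' b' b with hk
  set β := bary t' a b with hβ
  have hf : ∀ y, bary t' b' y = bary t b y * k := fun y => by
    rw [haff t' b' y, bary_of_ne hT' hb' hz' hzb'.symm, bary_of_ne hT' hb' ha' hab'.symm]
    ring
  have hg : ∀ y, bary t' a y = bary t a y + bary t b y * β := fun y => by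
    rw [haff t' a y, bary_of_ne hT' ha' hz' hza.symm, bary_self hT' ha']
    ring
  have hcone : ∀ y, 0 ≤ bary t a y → 0 ≤ bary t b y → y ∈ cone z t := fun y h1 h2 v hv hvz => by
    simp only [t, Finset.mem_insert, Finset.mem_singleton] at hv
    rcases hv with rfl | rfl | rfl
    · exact absurd rfl hvz
    · exact h1
    · exact h2
  have hcone' : ∀ y, 0 ≤ bary t' a y → 0 ≤ bary t' b' y → y ∈ cone z t' :=
    fun y h1 h2 v hv hvz => by
      simp only [t', Finset.mem_insert, Finset.mem_singleton] at hv
      rcases hv with rfl | rfl | rfl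
      · exact absurd rfl hvz
      · exact h1
      · exact h2
  -- The vertices `b` and `b'` lie on opposite sides of the edge, as the triangles do not overlap.
  have hk0 : k < 0 := by
    by_contra! hk0
    set κ := bary t a x
    set s := κ / (1 + |β|) with hs
    have hpos : 0 < 1 + |β| := by positivity
    have hs0 : 0 < s := div_pos hxa hpos
    have hy : ∀ v, bary t v (x + s • (b - z)) = bary t v x + s * (bary t v b - bary t v z) :=
      fun v => by
        have h := (bary t v).map_vadd x (s • (b - z))
        rw [map_smul, bary_sub, vadd_eq_add, vadd_eq_add, smul_eq_mul] at h
        rw [add_comm x, h, add_comm]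
    have hya : bary t a (x + s • (b - z)) = κ := by
      rw [hy, bary_of_ne hT ha hb hab, bary_of_ne hT ha hz hza.symm]; simp [κ]
    have hyb : bary t b (x + s • (b - z)) = s := by
      rw [hy, hxb, bary_self hT hb, bary_of_ne hT hb hz hzb.symm]; simp
    have h1 := hcone (x + s • (b - z)) (by rw [hya]; exact hxa.le) (by rw [hyb]; exact hs0.le)
    have h2 := hcone' (x + s • (b - z))
      (by
        rw [hg, hya, hyb]
        have e : s * (1 + |β|) = κ := by rw [hs, div_mul_cancel₀ _ hpos.ne']
        nlinarith [neg_abs_le β])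
      (by rw [hf, hyb]; positivity)
    have h3 := bary_eq_zero_of_mem_cone ht ht' hz hz' h1 h2 hb hbt'
    rw [hyb] at h3
    exact hs0.ne' h3
  have hopen : IsOpen {y | 0 < bary t a y ∧ 0 < bary t' a y} :=
    (isOpen_lt continuous_const (continuous_bary t a)).inter
      (isOpen_lt continuous_const (continuous_bary t' a))
  refine Filter.mem_of_superset (hopen.mem_nhds ⟨hxa, by rw [hg, hxb, zero_mul, add_zero]; exact hxa⟩)
    fun y hy => ?_
  rcases le_total 0 (bary t b y) with h | h
  · exact Or.inl (hcone y hy.1.le h)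
  · exact Or.inr (hcone' y hy.2.le (by rw [hf]; exact mul_nonneg_of_nonpos_of_nonpos h hk0.le))

/-- If no triangle of an edge-connected component of the star of `z` has an edge at `z` that
belongs to this triangle only, then the component is the whole star: the union of its cones is
both open and closed in the punctured plane. -/
theorem neighbors_chain {z : Plane} {t₀ : Finset Plane} (ht₀ : t₀ ∈ 𝒯.triangles) (hz₀ : z ∈ t₀) :
    (∃ t, Relation.ReflTransGen (𝒯.Neighbors z) t₀ t ∧ t ∈ 𝒯.triangles ∧ z ∈ t ∧
      ∃ a ∈ t, a ≠ z ∧ ∀ t' ∈ 𝒯.triangles, z ∈ t' → a ∈ t' → t' = t) ∨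
    ∀ t ∈ 𝒯.triangles, z ∈ t → Relation.ReflTransGen (𝒯.Neighbors z) t₀ t := by
  classical
  by_contra! hcon
  obtain ⟨hno, t₁, ht₁, hz₁, hnot⟩ := hcon
  apply hnot
  let 𝒞 := 𝒯.triangles.filter fun t => z ∈ t ∧ Relation.ReflTransGen (𝒯.Neighbors z) t₀ t
  have h𝒞 : ∀ {t}, t ∈ 𝒞 ↔ t ∈ 𝒯.triangles ∧ z ∈ t ∧
      Relation.ReflTransGen (𝒯.Neighbors z) t₀ t := by simp [𝒞]
  let A : Set Plane := ⋃ t ∈ 𝒞, cone z t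
  have hA : IsClosed A := 𝒞.finite_toSet.isClosed_biUnion fun t _ => isClosed_cone z t
  have hsub : ∀ t ∈ 𝒞, cone z t ⊆ A := fun t ht => Set.subset_biUnion_of_mem (u := cone z) ht
  -- The case of a point on the ray from `z` through `a`: two triangles of the component meet there.
  have hedge : ∀ a b : Plane, z ≠ a → z ≠ b → a ≠ b → ({z, a, b} : Finset Plane) ∈ 𝒞 → ∀ x,
      0 < bary {z, a, b} a x → bary {z, a, b} b x = 0 → A ∈ nhds x := by
    intro a b hza hzb hab hmem x hxa hxb
    obtain ⟨ht, hz, hreach⟩ := h𝒞.1 hmem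
    obtain ⟨t', ht', hz', ha', hne⟩ := hno _ hreach ht hz a (by simp) hza.symm
    obtain ⟨b₁, c₁, h1, h2, h3, hteq⟩ := (isTriangle ht').exists_eq hz'
    obtain ⟨b', hzb', hab', hteq'⟩ : ∃ b', z ≠ b' ∧ a ≠ b' ∧ t' = {z, a, b'} := by
      rw [hteq] at ha'
      simp only [Finset.mem_insert, Finset.mem_singleton] at ha'
      rcases ha' with rfl | rfl | rfl
      · exact absurd rfl hza
      · exact ⟨c₁, h2, h3, hteq⟩
      · refine ⟨b₁, h1, h3.symm, ?_⟩
        rw [hteq, Finset.pair_comm]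
    subst hteq'
    have hbb' : b ≠ b' := fun e => hne (by rw [e])
    have hmem' : ({z, a, b'} : Finset Plane) ∈ 𝒞 := h𝒞.2 ⟨ht', hz',
      hreach.tail ⟨ht, ht', hz, hz', a, hza.symm, by simp, by simp⟩⟩
    exact Filter.mem_of_superset
      (cone_union_mem_nhds hza hzb hab hzb' hab' hbb' ht ht' hxa hxb)
      (Set.union_subset (hsub _ hmem) (hsub _ hmem'))
  have hnhds : ∀ x ∈ A, x ≠ z → A ∈ nhds x := by
    intro x hx hxz
    obtain ⟨t, ht, hxt⟩ := Set.mem_iUnion₂.1 hx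
    obtain ⟨htT, hz, _⟩ := h𝒞.1 ht
    have hT := isTriangle htT
    obtain ⟨a, b, hza, hzb, hab, rfl⟩ := hT.exists_eq hz
    have hxa := hxt a (by simp) hza.symm
    have hxb := hxt b (by simp) hzb.symm
    rcases hxa.eq_or_lt with ha0 | ha0
    · rcases hxb.eq_or_lt with hb0 | hb0
      · exfalso
        have h1 := sum_bary_smul hT x
        have h2 := sum_bary hT x
        rw [Finset.sum_insert (by simp [hza, hzb]), Finset.sum_insert (by simp [hab]),
          Finset.sum_singleton, ← ha0, ← hb0] at h1 h2
        simp only [add_zero] at h2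
        rw [h2] at h1
        apply hxz
        simpa using h1.symm
      · have hcomm : ({z, a, b} : Finset Plane) = {z, b, a} := by rw [Finset.pair_comm]
        rw [hcomm] at ht hb0 ha0
        exact hedge b a hzb hza hab.symm ht x hb0 ha0.symm
    · rcases hxb.eq_or_lt with hb0 | hb0
      · exact hedge a b hza hzb hab ht x ha0 hb0.symm
      · have hopen : IsOpen {y | 0 < bary {z, a, b} a y ∧ 0 < bary {z, a, b} b y} :=
          (isOpen_lt continuous_const (continuous_bary _ a)).inter
            (isOpen_lt continuous_const (continuous_bary _ b))
        refine Filter.mem_of_superset (hopen.mem_nhds ⟨ha0, hb0⟩) fun y hy => hsub _ ht ?_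
        intro v hv hvz
        simp only [Finset.mem_insert, Finset.mem_singleton] at hv
        rcases hv with rfl | rfl | rfl
        · exact absurd rfl hvz
        · exact hy.1.le
        · exact hy.2.le
  have hall : ∀ x, x ≠ z → x ∈ A := by
    have hconn : IsPreconnected ({z}ᶜ : Set Plane) :=
      (isConnected_compl_singleton_of_one_lt_rank (by
        rw [← Module.finrank_eq_rank, finrank_euclideanSpace_fin]; norm_num) z).isPreconnected
    have hne : (({z}ᶜ : Set Plane) ∩ interior A).Nonempty := by
      have hT := isTriangle ht₀
      obtain ⟨a, b, hza, hzb, hab, rfl⟩ := hT.exists_eq hz₀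
      have haA : a ∈ A := hsub _ (h𝒞.2 ⟨ht₀, hz₀, .refl⟩) fun v hv _ => by
        by_cases hva : v = a
        · rw [hva, bary_self hT (by simp)]; norm_num
        · rw [bary_of_ne hT hv (by simp) hva]
      exact ⟨a, hza.symm, mem_interior_iff_mem_nhds.2 (hnhds a haA hza.symm)⟩
    have := hconn.subset_of_closure_inter_subset isOpen_interior hne fun x hx =>
      mem_interior_iff_mem_nhds.2 (hnhds x (hA.closure_subset_iff.2 interior_subset hx.1) hx.2)
    exact fun x hx => interior_subset (this hx)
  have hT₁ := isTriangle ht₁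
  obtain ⟨a, b, hza, hzb, hab, heq⟩ := hT₁.exists_eq hz₁
  have hz1 : z ∈ ({a, b, z} : Finset Plane) := by simp
  have ha1 : a ∈ ({a, b, z} : Finset Plane) := by simp
  have hb1 : b ∈ ({a, b, z} : Finset Plane) := by simp
  have heq' : t₁ = {a, b, z} := by
    rw [heq]; ext x; simp only [Finset.mem_insert, Finset.mem_singleton]; tauto
  subst heq'
  -- A point in the interior of the cone over `t₁` lies in the cone over a triangle of the
  -- component, which therefore is `t₁`.
  set x := z + (1 : ℝ) • (a - z) + (1 : ℝ) • (b - z) with hx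
  have hbx : ∀ v, bary {a, b, z} v x =
      1 * bary {a, b, z} v a + 1 * bary {a, b, z} v b + (1 - 1 - 1) * bary {a, b, z} v z :=
    fun v => bary_param v 1 1
  have hxa : bary {a, b, z} a x = 1 := by
    rw [hbx, bary_self hT₁ ha1, bary_of_ne hT₁ ha1 hb1 hab, bary_of_ne hT₁ ha1 hz1 hza.symm]
    norm_num
  have hxb : bary {a, b, z} b x = 1 := by
    rw [hbx, bary_self hT₁ hb1, bary_of_ne hT₁ hb1 ha1 hab.symm, bary_of_ne hT₁ hb1 hz1 hzb.symm]
    norm_num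
  have hxz : x ≠ z := fun e => by
    rw [e, bary_of_ne hT₁ ha1 hz1 hza.symm] at hxa
    exact zero_ne_one hxa
  have hxc : x ∈ cone z {a, b, z} := fun v hv hvz => by
    simp only [Finset.mem_insert, Finset.mem_singleton] at hv
    rcases hv with rfl | rfl | rfl
    · rw [hxa]; norm_num
    · rw [hxb]; norm_num
    · exact absurd rfl hvz
  obtain ⟨t, ht, hxt⟩ := Set.mem_iUnion₂.1 (hall x hxz)
  obtain ⟨htT, hz, hreach⟩ := h𝒞.1 ht
  have hin : ∀ v ∈ ({a, b, z} : Finset Plane), v ∈ t := fun v hv => by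
    by_contra hvt
    have h0 := bary_eq_zero_of_mem_cone ht₁ htT hz1 hz hxc hxt hv hvt
    simp only [Finset.mem_insert, Finset.mem_singleton] at hv
    rcases hv with rfl | rfl | rfl
    · rw [hxa] at h0; exact one_ne_zero h0
    · rw [hxb] at h0; exact one_ne_zero h0
    · exact hvt hz
  rwa [triangle_eq_of_subset ht₁ htT hin]

end Triangulation

namespace Triangulation

variable {Ω : Set Plane} {𝒯 : Triangulation Ω}

/-! ### Boundary edges -/

/-- An edge of only one triangle lies on the boundary of `Ω`: across its inner points, there is no
triangle on the other side. -/
theorem hull_subset_frontier (hΩ : IsOpen Ω) {t : Finset Plane} (ht : t ∈ 𝒯.triangles)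
    {z a : Plane} (hz : z ∈ t) (ha : a ∈ t) (haz : a ≠ z)
    (honly : ∀ t' ∈ 𝒯.triangles, z ∈ t' → a ∈ t' → t' = t) : hull {z, a} ⊆ frontier Ω := by
  have hT := isTriangle ht
  obtain ⟨b, hb, hzb, hab⟩ : ∃ b ∈ t, z ≠ b ∧ a ≠ b := by
    obtain ⟨b, c, h1, h2, h3, rfl⟩ := hT.exists_eq hz
    simp only [Finset.mem_insert, Finset.mem_singleton] at ha
    rcases ha with rfl | rfl | rfl
    · exact absurd rfl haz
    · exact ⟨c, by simp, h2, h3⟩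
    · exact ⟨b, by simp, h1, h3.symm⟩
  have hopen : openSegment ℝ z a ⊆ frontier Ω := by
    rw [openSegment_eq_image_lineMap]
    rintro _ ⟨s, hs, rfl⟩
    set x := AffineMap.lineMap z a s with hx
    have hxz : bary t z x = 1 - s := by
      rw [hx, bary_lineMap, bary_self hT hz, bary_of_ne hT hz ha haz.symm]; ring
    have hxa : bary t a x = s := by
      rw [hx, bary_lineMap, bary_self hT ha, bary_of_ne hT ha hz haz]; ring
    have hxb : bary t b x = 0 := by
      rw [hx, bary_lineMap, bary_of_ne hT hb hz hzb.symm, bary_of_ne hT hb ha hab.symm]; ring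
    have hxt : x ∈ hull t := by
      refine convexHull_mono (s := {z, a}) ?_ ?_
      · rintro y (rfl | rfl)
        · exact hz
        · exact ha
      · rw [convexHull_pair, segment_eq_image_lineMap]
        exact ⟨s, Set.Ioo_subset_Icc_self hs, rfl⟩
    rw [hΩ.frontier_eq]
    refine ⟨hull_subset_closure (𝒯.mem_triangles.1 ht).1 hxt, fun hxΩ => ?_⟩
    -- Close to `x`, only the triangles that contain `x` are met.
    classical
    let N : Set Plane := Ω ∩ (⋃ t' ∈ 𝒯.triangles.filter (fun t' => x ∉ hull t'), hull t')ᶜ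
    have hN : IsOpen N := hΩ.inter
      ((Finset.finite_toSet _).isClosed_biUnion fun t' _ => (isCompact_hull t').isClosed).isOpen_compl
    have hxN : x ∈ N := ⟨hxΩ, fun h => by
      obtain ⟨t', ht', hxt'⟩ := Set.mem_iUnion₂.1 h
      exact (Finset.mem_filter.1 ht').2 hxt'⟩
    have hcont : Continuous fun r : ℝ => (AffineMap.lineMap x b (-r) : Plane) :=
      AffineMap.lineMap_continuous.comp continuous_neg
    have hev : ∀ᶠ r in nhdsWithin (0 : ℝ) (Set.Ioi 0), AffineMap.lineMap x b (-r) ∈ N :=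
      (hcont.tendsto' 0 x (by simp)).mono_left nhdsWithin_le_nhds (hN.mem_nhds hxN)
    obtain ⟨r, hrN, hr⟩ := (hev.and self_mem_nhdsWithin).exists
    obtain ⟨t', ht', hyt'⟩ := exists_triangle_of_mem_closure (𝒯 := 𝒯) (subset_closure hrN.1)
    have hxt' : x ∈ hull t' := by
      by_contra hxt'
      exact hrN.2 (Set.mem_iUnion₂.2 ⟨t', Finset.mem_filter.2 ⟨ht', hxt'⟩, hyt'⟩)
    have hin : ∀ v ∈ t, bary t v x ≠ 0 → v ∈ t' := fun v hv hne => by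
      by_contra hvt
      exact hne (bary_eq_zero_of_mem_face ht (𝒯.mem_triangles.1 ht').1 hxt hxt' hv hvt)
    have := honly t' ht' (hin z hz (by rw [hxz]; linarith [hs.2]))
      (hin a ha (by rw [hxa]; exact hs.1.ne'))
    subst this
    have hyb := (mem_hull_iff hT).1 hyt' b hb
    rw [bary_lineMap, hxb, bary_self hT hb] at hyb
    have : (0 : ℝ) < r := hr
    linarith
  rw [hull_pair]
  exact segment_subset_closure_openSegment.trans (closure_minimal hopen isClosed_frontier)

/-! ### The number of triangles at a vertex -/

open Classical in
variable (𝒯) in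
/-- The triangles with vertex `z`. -/
noncomputable def star (z : Plane) : Finset (Finset Plane) := 𝒯.triangles.filter (z ∈ ·)

theorem mem_star {z : Plane} {t : Finset Plane} : t ∈ 𝒯.star z ↔ t ∈ 𝒯.triangles ∧ z ∈ t := by
  simp [star]

/-- The number of triangles at a vertex is bounded, by comparison of areas. -/
theorem card_star_le {h r : ℝ} (hr : 0 < r) (hh : 0 ≤ h)
    (hdiam : ∀ t ∈ 𝒯.triangles, Metric.diam (hull t) ≤ h)
    (hball : ∀ t ∈ 𝒯.triangles, ∃ c, Metric.closedBall c r ⊆ hull t) (z : Plane) :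
    ((𝒯.star z).card : ℝ) ≤ (h / r) ^ 2 := by
  choose! c hc using hball
  set v := (volume : Measure Plane).real (Metric.ball 0 1) with hv
  have hv0 : 0 < v := by
    rw [hv, measureReal_def]
    exact ENNReal.toReal_pos (Metric.measure_ball_pos volume 0 one_pos).ne'
      measure_ball_lt_top.ne
  have hvol : ∀ (x : Plane) {r : ℝ}, 0 < r →
      (volume : Measure Plane).real (Metric.ball x r) = r ^ 2 * v := fun x r hr => by
    rw [← Measure.addHaar_real_closedBall_eq_addHaar_real_ball,
      Measure.addHaar_real_closedBall volume x hr.le, finrank_euclideanSpace_fin]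
  have hdisj : Set.PairwiseDisjoint (𝒯.star z : Set (Finset Plane))
      fun t => Metric.ball (c t) r := fun t ht t' ht' hne => by
    have hsub : ∀ t ∈ 𝒯.star z, Metric.ball (c t) r ⊆ interior (hull t) := fun t ht =>
      interior_maximal (Metric.ball_subset_closedBall.trans (hc t (mem_star.1 ht).1))
        Metric.isOpen_ball
    exact (disjoint_interior (mem_star.1 ht).1 (mem_star.1 ht').1 hne).mono (hsub t ht) (hsub t' ht')
  have h1 := measureReal_biUnion_finset (μ := volume) hdisj (fun t _ => Metric.isOpen_ball.measurableSet)
    (fun t _ => measure_ball_lt_top.ne)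
  have h2 : ⋃ t ∈ 𝒯.star z, Metric.ball (c t) r ⊆ Metric.closedBall z h := by
    refine Set.iUnion₂_subset fun t ht x hx => ?_
    obtain ⟨ht, hz⟩ := mem_star.1 ht
    exact (Metric.dist_le_diam_of_mem (isCompact_hull t).isBounded
      (hc t ht (Metric.ball_subset_closedBall hx)) (subset_convexHull ℝ _ hz)).trans (hdiam t ht)
  have h3 := measureReal_mono (μ := volume) h2 measure_closedBall_lt_top.ne
  rw [h1, Finset.sum_congr rfl fun t _ => hvol (c t) hr, Finset.sum_const, nsmul_eq_mul,
    Measure.addHaar_real_closedBall volume z hh, finrank_euclideanSpace_fin, ← mul_assoc] at h3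
  have h4 := le_of_mul_le_mul_right h3 hv0
  rw [div_pow, le_div_iff₀ (by positivity)]
  exact h4

end Triangulation

/-! ### Averages at a vertex -/

/-- Along a chain in a finite set, a function varies by at most the variation between neighbours
times the number of elements. -/
theorem abs_sub_le_of_chain {α : Type*} {r : α → α → Prop} (S : Finset α) {u : α → ℝ} {δ : ℝ}
    (hδ : 0 ≤ δ) (hS : ∀ a b, r a b → a ∈ S ∧ b ∈ S) (hu : ∀ a b, r a b → |u a - u b| ≤ δ)
    {a b : α} (h : Relation.ReflTransGen r a b) : |u a - u b| ≤ S.card * δ := by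
  by_cases ha : a ∈ S
  swap
  · rcases Relation.ReflTransGen.cases_head h with rfl | ⟨c, hac, _⟩
    · rw [sub_self, abs_zero]; positivity
    · exact absurd (hS _ _ hac).1 ha
  let G : SimpleGraph S := SimpleGraph.fromRel fun a b => r a b
  have hreach : ∃ hb : b ∈ S, G.Reachable ⟨a, ha⟩ ⟨b, hb⟩ := by
    induction h with
    | refl => exact ⟨ha, .refl _⟩
    | @tail b c _ hbc ih =>
      obtain ⟨hb, hr⟩ := ih
      refine ⟨(hS _ _ hbc).2, ?_⟩
      by_cases e : b = c
      · subst e; exact hr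
      · refine hr.trans (SimpleGraph.Adj.reachable ?_)
        rw [SimpleGraph.fromRel_adj]
        exact ⟨fun h => e (congrArg Subtype.val h), Or.inl hbc⟩
  obtain ⟨hb, hr⟩ := hreach
  have hwalk : ∀ (x y : S) (w : G.Walk x y), |u x - u y| ≤ w.length * δ := by
    intro x y w
    induction w with
    | nil => simp
    | @cons x y z hxy w ih =>
      have h1 : |u x - u y| ≤ δ := by
        rcases ((SimpleGraph.fromRel_adj _ _ _).1 hxy).2 with h | h
        · exact hu _ _ h
        · rw [abs_sub_comm]; exact hu _ _ h
      rw [SimpleGraph.Walk.length_cons]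
      push_cast
      linarith [abs_sub_le (u x) (u y) (u z)]
  obtain ⟨w⟩ := hr
  classical
  have h2 := hwalk _ _ w.toPath.1
  have h3 := w.toPath.2.length_lt
  rw [Fintype.card_coe] at h3
  exact h2.trans (mul_le_mul_of_nonneg_right (by exact_mod_cast h3.le) hδ)

theorem abs_sub_mean_le {α : Type*} {S : Finset α} (hS : S.Nonempty) {f : α → ℝ} {u B : ℝ}
    (h : ∀ a ∈ S, |u - f a| ≤ B) : |u - (∑ a ∈ S, f a) / S.card| ≤ B := by
  have hc : (0 : ℝ) < S.card := by exact_mod_cast hS.card_pos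
  have e : u - (∑ a ∈ S, f a) / S.card = (∑ a ∈ S, (u - f a)) / S.card := by
    rw [Finset.sum_sub_distrib, Finset.sum_const, nsmul_eq_mul]
    field_simp
  rw [e, abs_div, abs_of_pos hc, div_le_iff₀ hc]
  refine (Finset.abs_sum_le_sum_abs _ _).trans ((Finset.sum_le_card_nsmul _ _ _ h).trans ?_)
  rw [nsmul_eq_mul, mul_comm]

namespace Triangulation

variable {Ω : Set Plane} {𝒯 : Triangulation Ω}

theorem Neighbors.symm {z : Plane} {t t' : Finset Plane} (h : 𝒯.Neighbors z t t') :
    𝒯.Neighbors z t' t := by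
  obtain ⟨h1, h2, h3, h4, a, h5, h6, h7⟩ := h
  exact ⟨h2, h1, h4, h3, a, h5, h7, h6⟩

/-- If the values `u t` on the triangles and the values `g e` on the edges at a vertex `z` differ
by at most `D` for each edge of a triangle, and the values on boundary edges vanish, then the
values on the triangles differ from the mean of the values on the edges by a multiple of `D`.
Either all triangles are joined to each other through common edges, or every edge-connected
component of the star has a boundary edge. -/
theorem abs_sub_vertex_mean_le (hΩ : IsOpen Ω) {z : Plane} {u g : Finset Plane → ℝ} {D : ℝ}
    (hD : ∀ t ∈ 𝒯.triangles, ∀ e ∈ 𝒯.edges, z ∈ e → e ⊆ t → |u t - g e| ≤ D)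
    (hbd : ∀ e ∈ 𝒯.edges, hull e ⊆ frontier Ω → z ∈ e → g e = 0) {t : Finset Plane}
    (ht : t ∈ 𝒯.triangles) (hz : z ∈ t) :
    |u t - (∑ e ∈ 𝒯.edgesAt z, g e) / (𝒯.edgesAt z).card| ≤ (4 * (𝒯.star z).card + 3) * D := by
  have hex : ∀ t ∈ 𝒯.triangles, z ∈ t → ∃ a ∈ t, z ≠ a := fun t ht hz => by
    obtain ⟨b, c, h1, h2, h3, rfl⟩ := (isTriangle ht).exists_eq hz
    exact ⟨b, by simp, h1⟩
  have hpair : ∀ t ∈ 𝒯.triangles, z ∈ t → ∀ a ∈ t, z ≠ a → |u t - g {z, a}| ≤ D :=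
    fun t ht hz a ha hza => hD t ht _ (edge_of_mem ht hz ha hza) (by simp)
      (Finset.insert_subset hz (Finset.singleton_subset_iff.2 ha))
  obtain ⟨a, ha, hza⟩ := hex t ht hz
  have hD0 : 0 ≤ D := (abs_nonneg _).trans (hpair t ht hz a ha hza)
  have hne : (𝒯.edgesAt z).Nonempty :=
    ⟨{z, a}, 𝒯.mem_edgesAt.2 ⟨edge_of_mem ht hz ha hza, by simp⟩⟩
  set n : ℝ := ((𝒯.star z).card : ℝ) with hn
  have hn0 : 0 ≤ n := Nat.cast_nonneg _
  have hchain : ∀ {t t'}, Relation.ReflTransGen (𝒯.Neighbors z) t t' → |u t - u t'| ≤ n * (2 * D) := by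
    refine fun h => abs_sub_le_of_chain (𝒯.star z) (by linarith)
      (fun t t' h => ⟨mem_star.2 ⟨h.1, h.2.2.1⟩, mem_star.2 ⟨h.2.1, h.2.2.2.1⟩⟩)
      (fun t t' h => ?_) h
    obtain ⟨h1, h2, h3, h4, a, h5, h6, h7⟩ := h
    have e1 := hpair t h1 h3 a h6 h5.symm
    have e2 := hpair t' h2 h4 a h7 h5.symm
    rw [abs_sub_comm] at e2
    linarith [abs_sub_le (u t) (g {z, a}) (u t')]
  have hsymm : ∀ {t t'}, Relation.ReflTransGen (𝒯.Neighbors z) t t' →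
      Relation.ReflTransGen (𝒯.Neighbors z) t' t := fun h => by
    induction h with
    | refl => exact .refl
    | tail _ hbc ih => exact ih.head hbc.symm
  -- Neighbours differ by at most `2 D`, hence triangles in one component by at most `2 n D`. From
  -- one component to another, this is used twice, by way of the value zero on the boundary.
  refine abs_sub_mean_le hne fun e he => ?_
  obtain ⟨heE, hze⟩ := 𝒯.mem_edgesAt.1 he
  obtain ⟨t', ht', het'⟩ := exists_triangle (𝒯.mem_edges.1 heE).1
  have hD' := hD t' ht' e heE hze het'
  have hz' := het' hze
  by_cases hall : ∀ t' ∈ 𝒯.triangles, z ∈ t' → Relation.ReflTransGen (𝒯.Neighbors z) t t'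
  · have h1 := hchain (hall t' ht' hz')
    have := abs_sub_le (u t) (u t') (g e)
    nlinarith
  · -- Not even one component is the whole star, so that each has a boundary edge.
    have hsmall : ∀ t' ∈ 𝒯.triangles, z ∈ t' → |u t'| ≤ n * (2 * D) + D := by
      intro t' ht' hz'
      rcases neighbors_chain ht' hz' with ⟨s, hs, hsT, hzs, b, hb, hbz, honly⟩ | h
      · have h1 := hchain hs
        have h2 := hpair s hsT hzs b hb hbz.symm
        rw [hbd _ (edge_of_mem hsT hzs hb hbz.symm)
          (hull_subset_frontier hΩ hsT hzs hb hbz honly) (by simp)] at h2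
        have := abs_sub_le (u t') (u s) 0
        simp only [sub_zero] at this h2
        linarith
      · exact absurd (fun t₁ ht₁ hz₁ => (hsymm (h t ht hz)).trans (h t₁ ht₁ hz₁)) hall
    have h1 := hsmall t ht hz
    have h2 := hsmall t' ht' hz'
    have := abs_sub_le (u t) (u t') (g e)
    have := abs_sub (u t) (u t')
    nlinarith

end Triangulation

/-! ### The averaging operator -/

section nodes

variable {p : ℕ} (hp : p ≠ 0)

include hp in
theorem mem_hull_of_mem_lagrangeNodes {s : Finset Plane} {z : Plane}
    (hz : z ∈ lagrangeNodes p s) : z ∈ hull s := by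
  obtain ⟨α, hα, rfl⟩ := hz
  exact node_mem_hull hp hα

theorem self_mem_lagrangeNodes_singleton (hp : p ≠ 0) (z : Plane) : z ∈ lagrangeNodes p {z} := by
  have : (p : ℝ) ≠ 0 := by exact_mod_cast hp
  exact ⟨fun _ => p, by simp, by simp [div_self this]⟩

include hp in
/-- The nodes of a face are nodes of the triangle. -/
theorem interpolant_lagrangeNodes {t : Finset Plane} (ht : IsTriangle t) (g : Plane → ℝ)
    {s : Finset Plane} (hs : s ⊆ t) {z : Plane} (hz : z ∈ lagrangeNodes p s) :
    (interpolant p t g).val z = g z := by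
  classical
  obtain ⟨α, hα, rfl⟩ := hz
  let β : Plane → ℕ := fun v => if v ∈ s then α v else 0
  have hsum : ∑ v ∈ t, β v = p := by
    rw [← Finset.sum_subset hs fun v _ hv => by simp [β, hv], ← hα]
    exact Finset.sum_congr rfl fun v hv => by simp [β, hv]
  have hβ : β ∈ t.piAntidiag p := Finset.mem_piAntidiag.2
    ⟨hsum, fun v hv => hs (by by_contra h; exact hv (by simp [β, h]))⟩
  have hnode : ∑ v ∈ s, ((α v : ℝ) / p) • v = node p t β := by
    rw [node, ← Finset.sum_subset hs fun v _ hv => by simp [β, hv]]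
    exact Finset.sum_congr rfl fun v hv => by simp [β, hv]
  rw [hnode, interpolant_node hp ht g hβ]

end nodes

namespace Triangulation

variable {Ω : Set Plane} {𝒯 : Triangulation Ω}

/-- The interior of a triangle does not meet edges and vertices. -/
theorem notMem_interior_of_card_lt {s t : Finset Plane} (ht : t ∈ 𝒯.triangles)
    (hs : s ∈ 𝒯.complex.faces) (hcard : s.card < 3) {z : Plane} (hz : z ∈ hull s) :
    z ∉ interior (hull t) := fun hzt => by
  obtain ⟨v, hv, hvs⟩ : ∃ v ∈ t, v ∉ s := by
    by_contra! h
    have := Finset.card_le_card (show t ⊆ s from h)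
    rw [(𝒯.mem_triangles.1 ht).2] at this
    omega
  exact ((mem_interior_hull_iff (isTriangle ht)).1 hzt v hv).ne'
    (bary_eq_zero_of_mem_face ht hs (interior_subset hzt) hz hv hvs)

theorem edge_unique {e e' : Finset Plane} (he : e ∈ 𝒯.edges) (he' : e' ∈ 𝒯.edges) {z : Plane}
    (hz : z ∈ hull e) (hz' : z ∈ hull e') (hzv : z ∉ 𝒯.complex.vertices) : e = e' := by
  classical
  obtain ⟨he, hc⟩ := 𝒯.mem_edges.1 he
  obtain ⟨he', hc'⟩ := 𝒯.mem_edges.1 he'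
  by_contra hne
  have hmem := mem_hull_inter he he' hz hz'
  have hlt : (e ∩ e').card ≤ 1 := by
    by_contra! h
    have h1 := Finset.eq_of_subset_of_card_le (Finset.inter_subset_left (s₁ := e) (s₂ := e'))
      (by omega)
    have h2 := Finset.eq_of_subset_of_card_le (Finset.inter_subset_right (s₁ := e) (s₂ := e'))
      (by omega)
    exact hne (h1.symm.trans h2)
  have hne : (e ∩ e').Nonempty := by
    rw [← Finset.coe_nonempty, ← convexHull_nonempty_iff (𝕜 := ℝ)]
    exact ⟨z, hmem⟩
  obtain ⟨a, ha⟩ := Finset.card_eq_one.1 (le_antisymm hlt hne.card_pos)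
  have hza : z = a := by simpa [ha, hull] using hmem
  rw [hza, Geometry.SimplicialComplex.mem_vertices, ← ha] at hzv
  exact hzv (𝒯.complex.down_closed he Finset.inter_subset_left hne)

open Classical in
variable (𝒯) in
/-- The nodal values of the average of the multiplier `μ`, as a function of the node. The edge or
triangle that is chosen here is the only one that contains the node in its relative interior, see
`nodalValue_edge` and `nodalValue_interior`. -/
noncomputable def nodalValue (p : ℕ) (τ : Finset Plane → ℝ) (μ : SkeletonFun) (z : Plane) : ℝ :=
  if z ∈ 𝒯.complex.vertices then (∑ e ∈ 𝒯.edgesAt z, μ e z) / (𝒯.edgesAt z).card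
  else if h : ∃ e ∈ 𝒯.edges, z ∈ hull e then μ h.choose z
  else if h : ∃ t ∈ 𝒯.triangles, z ∈ interior (hull t) then
    (localU p (τ h.choose) h.choose μ).val z
  else 0

variable {p : ℕ} {τ : Finset Plane → ℝ} {μ : SkeletonFun}

theorem nodalValue_edge {e : Finset Plane} (he : e ∈ 𝒯.edges) {z : Plane} (hz : z ∈ hull e)
    (hzv : z ∉ 𝒯.complex.vertices) : 𝒯.nodalValue p τ μ z = μ e z := by
  have h : ∃ e ∈ 𝒯.edges, z ∈ hull e := ⟨e, he, hz⟩
  rw [nodalValue, if_neg hzv, dif_pos h,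
    edge_unique h.choose_spec.1 he h.choose_spec.2 hz hzv]

theorem nodalValue_interior {t : Finset Plane} (ht : t ∈ 𝒯.triangles) {z : Plane}
    (hz : z ∈ interior (hull t)) :
    𝒯.nodalValue p τ μ z = (localU p (τ t) t μ).val z := by
  have h : ∃ t ∈ 𝒯.triangles, z ∈ interior (hull t) := ⟨t, ht, hz⟩
  have hv : z ∉ 𝒯.complex.vertices := fun hv =>
    notMem_interior_of_card_lt ht (Geometry.SimplicialComplex.mem_vertices.1 hv) (by simp)
      (subset_convexHull ℝ _ (by simp)) hz
  have he : ¬ ∃ e ∈ 𝒯.edges, z ∈ hull e := fun ⟨e, he, hze⟩ =>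
    notMem_interior_of_card_lt ht (𝒯.mem_edges.1 he).1 (by rw [(𝒯.mem_edges.1 he).2]; norm_num)
      hze hz
  have heq : h.choose = t := by
    by_contra hne
    exact Set.disjoint_left.1 (disjoint_interior h.choose_spec.1 ht hne) h.choose_spec.2 hz
  rw [nodalValue, if_neg hv, dif_neg he, dif_pos h, heq]

/-- Interpolants of the same function agree on common faces, as they agree at the nodes of the
face. -/
theorem interpolant_eq_of_mem (hp : p ≠ 0) (g : Plane → ℝ) {t t' : Finset Plane}
    (ht : t ∈ 𝒯.triangles) (ht' : t' ∈ 𝒯.triangles) {x : Plane} (hx : x ∈ hull t)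
    (hx' : x ∈ hull t') : (interpolant p t g).val x = (interpolant p t' g).val x := by
  classical
  have h := eq_zero_of_lagrangeNodes hp (isTriangle ht)
    (sub_mem (interpolant_mem g : interpolant p t g ∈ PolyDeg p)
      (interpolant_mem g : interpolant p t' g ∈ PolyDeg p))
    (Finset.inter_subset_left (s₁ := t) (s₂ := t'))
    (fun z hz => by
      rw [Poly.val_sub, interpolant_lagrangeNodes hp (isTriangle ht) g Finset.inter_subset_left hz,
        interpolant_lagrangeNodes hp (isTriangle ht') g Finset.inter_subset_right hz, sub_self])
    (mem_hull_inter (𝒯.mem_triangles.1 ht).1 (𝒯.mem_triangles.1 ht').1 hx hx')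
  rw [Poly.val_sub] at h
  exact sub_eq_zero.1 h

/-- The interpolants of the nodal values on the triangles are compatible on common faces and
therefore form a continuous function. -/
theorem exists_isAveraging (hp : p ≠ 0) (𝒯 : Triangulation Ω) (τ : Finset Plane → ℝ)
    (μ : SkeletonFun) : ∃ v, IsAveraging 𝒯 p τ μ v := by
  classical
  let g := 𝒯.nodalValue p τ μ
  let v : Plane → ℝ := fun x =>
    if h : ∃ t ∈ 𝒯.triangles, x ∈ hull t then (interpolant p h.choose g).val x else 0
  have hv : ∀ t ∈ 𝒯.triangles, ∀ x ∈ hull t, v x = (interpolant p t g).val x := fun t ht x hx => by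
    have h : ∃ t ∈ 𝒯.triangles, x ∈ hull t := ⟨t, ht, hx⟩
    simp only [v, dif_pos h]
    exact interpolant_eq_of_mem hp g h.choose_spec.1 ht h.choose_spec.2 hx
  have hnode : ∀ s ∈ 𝒯.complex.faces, ∀ z ∈ lagrangeNodes p s, v z = g z := fun s hs z hz => by
    obtain ⟨t, ht, hst⟩ := exists_triangle hs
    have hzt : z ∈ hull t :=
      convexHull_mono (by exact_mod_cast hst) (mem_hull_of_mem_lagrangeNodes hp hz)
    rw [hv t ht z hzt, interpolant_lagrangeNodes hp (isTriangle ht) g hst hz]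
  refine ⟨v, ⟨?_, fun t ht => ⟨interpolant p t g, interpolant_mem g, hv t ht⟩⟩, ?_, ?_, ?_⟩
  · have hc : ContinuousOn v (⋃ t : 𝒯.triangles, hull t.1) :=
      (locallyFinite_of_finite _).continuousOn_iUnion (fun t => (isCompact_hull t.1).isClosed)
        fun t => (Poly.continuous_val _).continuousOn.congr (hv t.1 t.2)
    refine hc.mono fun x hx => ?_
    obtain ⟨t, ht, hxt⟩ := exists_triangle_of_mem_closure (𝒯 := 𝒯) hx
    exact Set.mem_iUnion.2 ⟨⟨t, ht⟩, hxt⟩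
  · intro z hz
    rw [hnode _ (Geometry.SimplicialComplex.mem_vertices.1 hz) z
      (self_mem_lagrangeNodes_singleton hp z)]
    simp only [g, nodalValue, if_pos hz]
  · intro e he z hz hzv
    rw [hnode e (𝒯.mem_edges.1 he).1 z hz]
    exact nodalValue_edge he (mem_hull_of_mem_lagrangeNodes hp hz) hzv
  · intro t ht z hz hzt
    rw [hnode t (𝒯.mem_triangles.1 ht).1 z hz]
    exact nodalValue_interior ht hzt

theorem isAveraging_averaging (hp : p ≠ 0) (𝒯 : Triangulation Ω) (τ : Finset Plane → ℝ)
    (μ : SkeletonFun) : IsAveraging 𝒯 p τ μ (averaging 𝒯 p τ μ) :=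
  Classical.epsilon_spec (exists_isAveraging hp 𝒯 τ μ)

theorem edge_eq_oppositeEdge {t e : Finset Plane} (ht : t ∈ 𝒯.triangles) (he : e ∈ 𝒯.edges)
    (h : e ⊆ t) : ∃ a ∈ t, e = oppositeEdge t a := by
  classical
  have hc : (t \ e).card = 1 := by
    rw [Finset.card_sdiff_of_subset h, (𝒯.mem_triangles.1 ht).2, (𝒯.mem_edges.1 he).2]
  obtain ⟨a, ha⟩ := Finset.card_eq_one.1 hc
  have hat : a ∈ t \ e := by rw [ha]; simp
  refine ⟨a, (Finset.mem_sdiff.1 hat).1, ?_⟩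
  rw [oppositeEdge, Finset.erase_eq, ← ha, Finset.sdiff_sdiff_eq_self h]

/-- If the jumps `U - μ` at the nodes of `t` are bounded by `D`, on `t` and on the triangles that
have a vertex in common with `t`, then so are, up to a factor, the nodal values of the difference
of the average and the local solution. -/
theorem abs_nodal_sub_le (hΩ : IsOpen Ω) (hp : p ≠ 0) (hμ : μ ∈ multiplierSpaceZero 𝒯 p)
    {v : Plane → ℝ} (hv : IsAveraging 𝒯 p τ μ v) {t : Finset Plane} (ht : t ∈ 𝒯.triangles)
    {P : Poly} (hP : ∀ x ∈ hull t, v x = P.val x) {N D : ℝ}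
    (hN : ∀ z, ((𝒯.star z).card : ℝ) ≤ N)
    (hD : ∀ t' ∈ 𝒯.triangles, (∃ z ∈ t, z ∈ t') → ∀ a ∈ t', ∀ z ∈ hull (oppositeEdge t' a),
      |(localU p (τ t') t' μ).val z - μ (oppositeEdge t' a) z| ≤ D)
    {α : Plane → ℕ} (hα : α ∈ t.piAntidiag p) :
    |(P - localU p (τ t) t μ).val (node p t α)| ≤ (4 * N + 3) * D := by
  have hT := isTriangle ht
  obtain ⟨hsum, hsupp⟩ := Finset.mem_piAntidiag.1 hα
  have hzt := node_mem_hull hp hsum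
  have hN0 : 0 ≤ N := (Nat.cast_nonneg _).trans (hN 0)
  obtain ⟨a₀, ha₀⟩ := hT.nonempty
  have hD0 : 0 ≤ D := by
    obtain ⟨b, c, hbc, hb, hc, he⟩ := hT.oppositeEdge_eq_pair ha₀
    exact (abs_nonneg _).trans (hD t ht ⟨a₀, ha₀, ha₀⟩ a₀ ha₀ b
      (subset_convexHull ℝ _ (by rw [he]; simp)))
  have hDle : D ≤ (4 * N + 3) * D := by nlinarith
  set z := node p t α with hz
  rw [Poly.val_sub, ← hP z hzt, abs_sub_comm]
  by_cases hzv : z ∈ 𝒯.complex.vertices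
  · have hz' : z ∈ t := (Geometry.SimplicialComplex.vertex_mem_convexHull_iff hzv
      (𝒯.mem_triangles.1 ht).1).1 hzt
    rw [hv.2.1 z hzv]
    refine (abs_sub_vertex_mean_le hΩ (u := fun t => (localU p (τ t) t μ).val z) (D := D) ?_ ?_ ht
      hz').trans ?_
    · intro t' ht' e he hze het'
      obtain ⟨a, ha, rfl⟩ := edge_eq_oppositeEdge ht' he het'
      exact hD t' ht' ⟨z, hz', het' hze⟩ a ha z (subset_convexHull ℝ _ hze)
    · exact fun e he hfr hze => hμ.2 e he hfr z (subset_convexHull ℝ _ hze)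
    · have := hN z
      gcongr
  · -- If the node is not in the interior of `t`, then a component of `α` vanishes, and the node lies
    -- on the opposite edge.
    by_cases hin : z ∈ interior (hull t)
    · rw [hv.2.2.2 t ht z ⟨α, hsum, rfl⟩ hin, sub_self, abs_zero]
      positivity
    · obtain ⟨a, ha, haz⟩ : ∃ a ∈ t, α a = 0 := by
        by_contra! h
        refine hin ((mem_interior_hull_iff hT).2 fun a ha => ?_)
        rw [bary_node hp hT hsum ha]
        have := Nat.pos_of_ne_zero (h a ha)
        have := Nat.pos_of_ne_zero hp
        positivity
      have hze : z ∈ lagrangeNodes p (oppositeEdge t a) := by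
        refine node_mem_lagrangeNodes (oppositeEdge_subset t a) hsum fun w hw hwe => ?_
        by_contra hne
        refine hwe ?_
        classical
        exact Finset.mem_erase.2 ⟨fun e => hne (e ▸ haz), hw⟩
      rw [hv.2.2.1 _ (oppositeEdge_mem ht ha) z hze hzv]
      exact (hD t ht ⟨a, ha, ha⟩ a ha z (mem_hull_of_mem_lagrangeNodes hp hze)).trans hDle

end Triangulation

/-! ### The average on one level -/

namespace Triangulation

variable {Ω : Set Plane} {𝒯 : Triangulation Ω}

theorem diam_le_meshSize {t : Finset Plane} (ht : t ∈ 𝒯.triangles) :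
    Metric.diam (hull t) ≤ 𝒯.meshSize :=
  le_csSup ((Finset.finite_toSet _).image _).bddAbove ⟨t, ht, rfl⟩

theorem meshSize_pos {t : Finset Plane} (ht : t ∈ 𝒯.triangles) : 0 < 𝒯.meshSize := by
  obtain ⟨a, ha⟩ := (isTriangle ht).nonempty
  obtain ⟨b, c, hbc, hb, hc, -⟩ := (isTriangle ht).oppositeEdge_eq_pair ha
  exact (dist_pos.2 hbc).trans_le ((Metric.dist_le_diam_of_mem (isCompact_hull t).isBounded
    (subset_convexHull ℝ _ hb) (subset_convexHull ℝ _ hc)).trans (diam_le_meshSize ht))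

/-- On a shape-regular and quasi-uniform triangulation, the mesh size is bounded by the radii of
the inscribed discs. As nothing is assumed on the signs of `σ` and `ρ`, the constant is made
positive by absolute values and the summand `1`. -/
theorem exists_shapeBound {σ ρ : ℝ} (hσ : 𝒯.ShapeRegular σ) (hρ : 𝒯.QuasiUniform ρ)
    {t : Finset Plane} (ht : t ∈ 𝒯.triangles) :
    ∃ c r, ShapeBound σ t c r ∧ 𝒯.meshSize ≤ (2 * |ρ| * |σ| + 1) * r := by
  obtain ⟨c, r, hr, hball, hdiam⟩ := hσ t ht
  refine ⟨c, r, ⟨hr, hball, hdiam⟩, ?_⟩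
  have h1 : ρ * Metric.diam (hull t) ≤ |ρ| * Metric.diam (hull t) :=
    mul_le_mul_of_nonneg_right (le_abs_self _) Metric.diam_nonneg
  have h2 : |ρ| * Metric.diam (hull t) ≤ |ρ| * (|σ| * (2 * r)) :=
    mul_le_mul_of_nonneg_left (hdiam.trans
      (mul_le_mul_of_nonneg_right (le_abs_self _) (by linarith))) (abs_nonneg _)
  have := hρ t ht
  linarith

theorem card_star_le_of_regular {σ ρ : ℝ} (hσ : 𝒯.ShapeRegular σ) (hρ : 𝒯.QuasiUniform ρ)
    (z : Plane) : ((𝒯.star z).card : ℝ) ≤ (2 * |ρ| * |σ| + 1) ^ 2 := by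
  set κ := 2 * |ρ| * |σ| + 1 with hκ
  have hκ0 : 0 < κ := by positivity
  rcases 𝒯.triangles.eq_empty_or_nonempty with h0 | ⟨t₀, ht₀⟩
  · rw [star, h0, Finset.filter_empty, Finset.card_empty, Nat.cast_zero]
    positivity
  · have hh := meshSize_pos ht₀
    have h := card_star_le (𝒯 := 𝒯) (h := 𝒯.meshSize) (r := 𝒯.meshSize / κ) (by positivity) hh.le
      (fun t ht => diam_le_meshSize ht)
      (fun t ht => by
        obtain ⟨c, r, hs, hr⟩ := exists_shapeBound hσ hρ ht
        refine ⟨c, (Metric.closedBall_subset_closedBall ?_).trans hs.ball_subset⟩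
        rwa [div_le_iff₀ hκ0, mul_comm]) z
    rwa [div_div_cancel₀ hh.ne'] at h

theorem multiplier_continuousOn {p : ℕ} {μ : SkeletonFun} (hμ : μ ∈ multiplierSpace 𝒯 p)
    {t : Finset Plane} (ht : t ∈ 𝒯.triangles) :
    EdgeContinuous t fun a x => μ (oppositeEdge t a) x := fun a ha => by
  obtain ⟨P, _, hP⟩ := hμ _ (oppositeEdge_mem ht ha)
  exact P.continuous_val.continuousOn.congr hP

/-- The energy of the local solution on one triangle. -/
noncomputable def triangleEnergy (p : ℕ) (τ : Finset Plane → ℝ) (μ : SkeletonFun)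
    (t : Finset Plane) : ℝ :=
  localEnergy (τ t) t μ (localQ p (τ t) t μ) (localU p (τ t) t μ)

open Classical in
variable (𝒯) in
/-- The triangles that have a vertex in common with `t`. -/
noncomputable def patch (t : Finset Plane) : Finset (Finset Plane) :=
  𝒯.triangles.filter fun t' => ∃ z ∈ t, z ∈ t'

theorem mem_patch {t t' : Finset Plane} :
    t' ∈ 𝒯.patch t ↔ t' ∈ 𝒯.triangles ∧ ∃ z ∈ t, z ∈ t' := by
  simp [patch]

/-- A triangle belongs to a bounded number of patches. -/
theorem sum_patch_le {N : ℝ} (hN : ∀ z, ((𝒯.star z).card : ℝ) ≤ N) {E : Finset Plane → ℝ}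
    (hE : ∀ t ∈ 𝒯.triangles, 0 ≤ E t) :
    ∑ t ∈ 𝒯.triangles, ∑ t' ∈ 𝒯.patch t, E t' ≤ 3 * N * ∑ t ∈ 𝒯.triangles, E t := by
  classical
  rw [Finset.sum_comm' (t' := 𝒯.triangles) (s' := 𝒯.patch) (fun t t' => by
    simp only [mem_patch]; tauto), Finset.mul_sum]
  refine Finset.sum_le_sum fun t ht => ?_
  rw [Finset.sum_const, nsmul_eq_mul]
  refine mul_le_mul_of_nonneg_right ?_ (hE t ht)
  have hsub : 𝒯.patch t ⊆ t.biUnion 𝒯.star := fun t' ht' => by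
    obtain ⟨h1, z, h2, h3⟩ := mem_patch.1 ht'
    exact Finset.mem_biUnion.2 ⟨z, h2, mem_star.2 ⟨h1, h3⟩⟩
  have h1 : ((𝒯.patch t).card : ℝ) ≤ ∑ z ∈ t, ((𝒯.star z).card : ℝ) := by
    exact_mod_cast (Finset.card_le_card hsub).trans Finset.card_biUnion_le
  refine h1.trans ((Finset.sum_le_card_nsmul _ _ N fun z _ => hN z).trans ?_)
  rw [(𝒯.mem_triangles.1 ht).2, nsmul_eq_mul]
  norm_num

theorem triangleIntegral_gradient_add_le (t : Finset Plane) (P R : Poly) :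
    triangleIntegral t (dot (gradient P) (gradient P)).val ≤
      2 * triangleIntegral t (dot (gradient R) (gradient R)).val +
      2 * triangleIntegral t (dot (gradient (P - R)) (gradient (P - R))).val := by
  have hc : ∀ P : Poly, Continuous P.val := Poly.continuous_val
  rw [← triangleIntegral_const_mul, ← triangleIntegral_const_mul,
    ← triangleIntegral_add (by fun_prop) (by fun_prop)]
  refine triangleIntegral_mono (by fun_prop) (by fun_prop) fun x _ => ?_
  simp only [val_dot, gradient, map_sub, Poly.val_sub, Fin.sum_univ_two]
  nlinarith [sq_nonneg (Poly.val (MvPolynomial.pderiv 0 P) x - 2 * Poly.val (MvPolynomial.pderiv 0 R) x),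
    sq_nonneg (Poly.val (MvPolynomial.pderiv 1 P) x - 2 * Poly.val (MvPolynomial.pderiv 1 R) x)]

/-- The Dirichlet integral of the average is bounded by the energy of the multiplier. On a triangle,
the average is compared with the local solution `U`: the gradient of `U` is controlled by the
energy, and the difference is controlled by its nodal values, which are bounded by the jumps on the
patch of the triangle. -/
theorem exists_averaging_bound {p : ℕ} (hp : p ≠ 0) (σ ρ : ℝ) {c₀ : ℝ} (hc₀ : 0 < c₀) :
    ∃ C, 0 < C ∧ ∀ (Ω : Set Plane) (𝒯 : Triangulation Ω) (τ : Finset Plane → ℝ), IsOpen Ω →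
      𝒯.ShapeRegular σ → 𝒯.QuasiUniform ρ → (∀ t ∈ 𝒯.triangles, c₀ ≤ τ t * 𝒯.meshSize) →
      ∀ μ ∈ multiplierSpaceZero 𝒯 p, ∀ v, IsAveraging 𝒯 p τ μ v → ∀ P : Finset Plane → Poly,
      (∀ t ∈ 𝒯.triangles, P t ∈ PolyDeg p ∧ ∀ x ∈ hull t, v x = (P t).val x) →
      ∑ t ∈ 𝒯.triangles, triangleIntegral t (dot (gradient (P t)) (gradient (P t))).val ≤
        C * energyForm 𝒯 p τ μ μ := by
  set κ := 2 * |ρ| * |σ| + 1 with hκ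
  have hκ0 : 0 < κ := by positivity
  obtain ⟨C₁, hC₁, h₁⟩ := exists_gradient_bound p σ
  obtain ⟨C₂, hC₂, h₂⟩ := exists_gradient_le_energy p σ (κ / c₀)
  obtain ⟨C₃, hC₃, h₃⟩ := exists_jump_le_energy p σ (κ / c₀)
  set K : ℝ := (p + 1) ^ 3 * (p : ℝ) ^ p * (4 * κ ^ 2 + 3) with hK
  refine ⟨(2 * C₂ + 2 * (C₁ * (K ^ 2 * C₃))) * (3 * κ ^ 2), by positivity,
    fun Ω 𝒯 τ hΩ hσ hρ hτ μ hμ v hv P hP => ?_⟩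
  have hN := card_star_le_of_regular hσ hρ
  rw [← hκ] at hN
  have hτ0 : ∀ t ∈ 𝒯.triangles, 0 < τ t := fun t ht =>
    pos_of_mul_pos_left (hc₀.trans_le (hτ t ht)) (meshSize_pos ht).le
  have hsol : ∀ t ∈ 𝒯.triangles,
      IsLocalSolution p (τ t) t μ (localQ p (τ t) t μ) (localU p (τ t) t μ) := fun t ht =>
    localSolution_spec (isTriangle ht) hp (hτ0 t ht) (multiplier_continuousOn hμ.1 ht)
  have hE : ∀ t ∈ 𝒯.triangles, 0 ≤ triangleEnergy p τ μ t := fun t ht =>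
    localEnergy_nonneg (hτ0 t ht).le
  have hshape : ∀ t ∈ 𝒯.triangles, ∃ c r, ShapeBound σ t c r ∧ r⁻¹ ≤ κ / c₀ * τ t := by
    intro t ht
    obtain ⟨c, r, hs, hr⟩ := exists_shapeBound hσ hρ ht
    refine ⟨c, r, hs, ?_⟩
    rw [inv_le_iff_one_le_mul₀ hs.pos, div_mul_eq_mul_div, div_mul_eq_mul_div, one_le_div hc₀]
    have := mul_le_mul_of_nonneg_left hr (hτ0 t ht).le
    have := hτ t ht
    linarith
  have hloc : ∀ t ∈ 𝒯.triangles, triangleIntegral t (dot (gradient (P t)) (gradient (P t))).val ≤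
      (2 * C₂ + 2 * (C₁ * (K ^ 2 * C₃))) * ∑ t' ∈ 𝒯.patch t, triangleEnergy p τ μ t' := by
    intro t ht
    set S := ∑ t' ∈ 𝒯.patch t, triangleEnergy p τ μ t' with hS
    have hle : ∀ t' ∈ 𝒯.patch t, triangleEnergy p τ μ t' ≤ S := fun t' ht' =>
      Finset.single_le_sum (fun t' ht' => hE t' (mem_patch.1 ht').1) ht'
    have hself : t ∈ 𝒯.patch t := by
      obtain ⟨a, ha⟩ := (isTriangle ht).nonempty
      exact mem_patch.2 ⟨ht, a, ha, ha⟩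
    have hS0 : 0 ≤ S := (hE t ht).trans (hle t hself)
    obtain ⟨c, r, hs, hr⟩ := hshape t ht
    set U := localU p (τ t) t μ with hU
    have hUP : P t - U ∈ PolyDeg p := sub_mem (hP t ht).1 (hsol t ht).2.1
    have hnodes : ∀ α ∈ t.piAntidiag p,
        |(P t - U).val (node p t α)| ≤ (4 * κ ^ 2 + 3) * √(C₃ * S) := fun α hα =>
      abs_nodal_sub_le hΩ hp hμ hv ht (hP t ht).2 hN (fun t' ht' hz a ha z hz' => by
        obtain ⟨c', r', hs', hr'⟩ := hshape t' ht'
        refine Real.abs_le_sqrt ((h₃ t' c' r' (isTriangle ht') hs' (τ t') (hτ0 t' ht') hr' μ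
          (localQ p (τ t') t' μ) _ (hsol t' ht').2.1 (fun a ha => hμ.1 _ (oppositeEdge_mem ht' ha)) a
          ha z hz').trans ?_)
        exact mul_le_mul_of_nonneg_left (hle t' (mem_patch.2 ⟨ht', hz⟩)) hC₃.le) hα
    have hsup : ∀ x ∈ hull t, |(P t - U).val x| ≤ K * √(C₃ * S) := fun x hx => by
      refine (abs_val_le_of_nodes hp (isTriangle ht) hUP hnodes hx).trans_eq ?_
      rw [hK]; ring
    have g₁ := h₁ _ hUP t c r hs _ hsup
    have g₂ := h₂ t c r (isTriangle ht) hs (τ t) (hτ0 t ht) hr μ _ _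
      (multiplier_continuousOn hμ.1 ht) (hsol t ht)
    rw [mul_pow, Real.sq_sqrt (by positivity)] at g₁
    have g₃ := triangleIntegral_gradient_add_le t (P t) U
    have g₄ := mul_le_mul_of_nonneg_left (hle t hself) hC₂.le
    have g₅ : C₂ * localEnergy (τ t) t μ (localQ p (τ t) t μ) (localU p (τ t) t μ) =
      C₂ * triangleEnergy p τ μ t := rfl
    rw [← hU] at g₂ g₅
    linarith
  -- The energy form on the diagonal is, by definition, the sum of the local energies.
  have hform : energyForm 𝒯 p τ μ μ = ∑ t ∈ 𝒯.triangles, triangleEnergy p τ μ t := rfl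
  rw [hform]
  refine (Finset.sum_le_sum hloc).trans ?_
  rw [← Finset.mul_sum, mul_assoc]
  exact mul_le_mul_of_nonneg_left (sum_patch_le hN hE) (by positivity)

/-! ### Refinements -/

/-- The triangles of a triangulation overlap in null sets only, so that the integrals of a
nonnegative function over those inside a larger triangle add up to at most its integral there. -/
theorem sum_triangleIntegral_le {f : Plane → ℝ} (hf : Continuous f) (hf0 : ∀ x, 0 ≤ f x)
    {F : Finset (Finset Plane)} (hF : F ⊆ 𝒯.triangles) {s : Finset Plane}
    (hs : ∀ t ∈ F, hull t ⊆ hull s) :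
    ∑ t ∈ F, triangleIntegral t f ≤ triangleIntegral s f := by
  have hint : ∀ t, triangleIntegral t f = ∫ x in interior (hull t), f x := fun t =>
    (setIntegral_congr_set (interior_ae_eq_of_null_frontier
      ((convex_convexHull ℝ _).addHaar_frontier volume))).symm
  rw [Finset.sum_congr rfl fun t _ => hint t, ← integral_biUnion_finset F
    (fun t _ => isOpen_interior.measurableSet)
    (fun t ht t' ht' hne => disjoint_interior (hF ht) (hF ht') hne)
    (fun t _ => (integrableOn_hull hf).mono_set interior_subset)]
  exact setIntegral_mono_set (integrableOn_hull hf) (Filter.Eventually.of_forall hf0)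
    (Filter.Eventually.of_forall
      (Set.iUnion₂_subset fun t ht => interior_subset.trans (hs t ht)))

theorem sum_refines_le {𝒯' 𝒯 : Triangulation Ω} {π : Finset Plane → Finset Plane}
    (hπ : ∀ t' ∈ 𝒯'.triangles, π t' ∈ 𝒯.triangles ∧ hull t' ⊆ hull (π t'))
    {f : Finset Plane → Plane → ℝ} (hf : ∀ t, Continuous (f t)) (hf0 : ∀ t x, 0 ≤ f t x) :
    ∑ t' ∈ 𝒯'.triangles, triangleIntegral t' (f (π t')) ≤
      ∑ t ∈ 𝒯.triangles, triangleIntegral t (f t) := by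
  classical
  rw [← Finset.sum_fiberwise_of_maps_to fun t' ht' => (hπ t' ht').1]
  refine Finset.sum_le_sum fun t _ => ?_
  rw [Finset.sum_congr rfl fun t' ht' => by rw [(Finset.mem_filter.1 ht').2]]
  refine sum_triangleIntegral_le (hf t) (hf0 t) (Finset.filter_subset _ _) fun t' ht' => ?_
  obtain ⟨h1, h2⟩ := Finset.mem_filter.1 ht'
  rw [← h2]
  exact (hπ t' h1).2

theorem refines_of_le {𝒯 : ℕ → Triangulation Ω} {L : ℕ}
    (h : ∀ l < L, (𝒯 (l + 1)).Refines (𝒯 l)) {l m : ℕ} (hlm : l ≤ m) (hm : m ≤ L) :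
    (𝒯 m).Refines (𝒯 l) := by
  induction m, hlm using Nat.le_induction with
  | base => exact fun t ht => ⟨t, ht, subset_rfl⟩
  | succ m _ ih =>
    intro t ht
    obtain ⟨t', ht', h1⟩ := h m (by omega) t ht
    obtain ⟨s, hs, h2⟩ := ih (by omega) t' ht'
    exact ⟨s, hs, h1.trans h2⟩

/-- The energy of the trace of a continuous piecewise polynomial function is at most its Dirichlet
integral, even if the function is piecewise polynomial on a coarser triangulation. -/
theorem energyForm_le {p : ℕ} (hp : p ≠ 0) {𝒯' 𝒯 : Triangulation Ω} (href : 𝒯'.Refines 𝒯)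
    {τ : Finset Plane → ℝ} (hτ : ∀ t ∈ 𝒯'.triangles, 0 < τ t) {v : Plane → ℝ}
    {P : Finset Plane → Poly}
    (hP : ∀ t ∈ 𝒯.triangles, P t ∈ PolyDeg p ∧ ∀ x ∈ hull t, v x = (P t).val x) :
    energyForm 𝒯' p τ (fun _ x => v x) (fun _ x => v x) ≤
      ∑ t ∈ 𝒯.triangles, triangleIntegral t (dot (gradient (P t)) (gradient (P t))).val := by
  choose! π hπ using href
  refine le_trans ?_ (sum_refines_le hπ (fun t => Poly.continuous_val _)
    fun t x => dot_self_nonneg (gradient (P t)) x)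
  refine Finset.sum_le_sum fun t ht => ?_
  obtain ⟨hpt, hsub⟩ := hπ t ht
  obtain ⟨hdeg, hval⟩ := hP _ hpt
  have hv : ∀ a ∈ t, ∀ x ∈ hull (oppositeEdge t a), v x = (P (π t)).val x :=
    fun a _ x hx => hval x (hsub (hull_oppositeEdge_subset t a hx))
  have hm : EdgeContinuous t fun a x => (fun (_ : Finset Plane) x => v x) (oppositeEdge t a) x :=
    fun a ha => (Poly.continuous_val _).continuousOn.congr (hv a ha)
  exact (localSolution_spec (isTriangle ht) hp (hτ t ht) hm).energy_le (isTriangle ht) hm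
    (hτ t ht).le hdeg hv

end Triangulation

end HDG

theorem mainTheorem2 (p : ℕ) (hp : 2 ≤ p) (σ ρ c₀ c₁ : ℝ) (hc₀ : 0 < c₀) :
    ∃ C : ℝ, 0 < C ∧
      ∀ (Ω : Set HDG.Plane), IsOpen Ω →
      ∀ (L : ℕ) (𝒯 : ℕ → HDG.Triangulation Ω) (τ : ℕ → Finset HDG.Plane → ℝ),
        (∀ l ≤ L, (𝒯 l).ShapeRegular σ) →
        (∀ l ≤ L, (𝒯 l).QuasiUniform ρ) →
        (∀ l < L, (𝒯 (l + 1)).Refines (𝒯 l)) →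
        (∀ l ≤ L, ∀ t ∈ (𝒯 l).triangles,
          c₀ ≤ τ l t * (𝒯 l).meshSize ∧ τ l t * (𝒯 l).meshSize ≤ c₁) →
        ∀ l ≤ L, ∀ μ ∈ HDG.multiplierSpaceZero (𝒯 l) p,
          HDG.energyForm (𝒯 L) p (τ L)
              (HDG.transfer 𝒯 p τ L l μ) (HDG.transfer 𝒯 p τ L l μ)
            ≤ C * HDG.energyForm (𝒯 l) p (τ l) μ μ := by
  have hp0 : p ≠ 0 := by omega
  obtain ⟨C, hC, h⟩ := HDG.Triangulation.exists_averaging_bound hp0 σ ρ hc₀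
  refine ⟨max C 1, by positivity, fun Ω hΩ L 𝒯 τ hσ hρ href hτ l hl μ hμ => ?_⟩
  have hτ0 : ∀ l ≤ L, ∀ t ∈ (𝒯 l).triangles, 0 < τ l t := fun l hl t ht =>
    pos_of_mul_pos_left (hc₀.trans_le (hτ l hl t ht).1)
      (HDG.Triangulation.meshSize_pos ht).le
  have hE : 0 ≤ HDG.energyForm (𝒯 l) p (τ l) μ μ :=
    Finset.sum_nonneg fun t ht => HDG.localEnergy_nonneg (hτ0 l hl t ht).le
  -- On the finest level the transfer is the identity, which needs a constant not below one.
  by_cases hlL : l = L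
  · subst hlL
    rw [HDG.transfer, if_pos rfl]
    exact le_mul_of_one_le_left hE (le_max_right _ _)
  · rw [HDG.transfer, if_neg hlL]
    have hv := HDG.Triangulation.isAveraging_averaging hp0 (𝒯 l) (τ l) μ
    choose! P hPdeg hP using hv.1.2
    have hP' := fun t ht => And.intro (hPdeg t ht) (hP t ht)
    refine (HDG.Triangulation.energyForm_le hp0 (HDG.Triangulation.refines_of_le href hl le_rfl)
      (hτ0 L le_rfl) hP').trans ?_
    exact (h Ω (𝒯 l) (τ l) hΩ (hσ l hl) (hρ l hl) (fun t ht => (hτ l hl t ht).1) μ hμ _ hv P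
      hP').trans (mul_le_mul_of_nonneg_right (le_max_left _ _) hE)
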